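/- Let $A$ and $B$ consist of $N_A$ and $N_B$ fermionic modes, with annihilation operators $\psi_i$ ($i\in A\cup B$), $\{\psi_i,\psi_j^\dagger\}=\delta_{ij}$, $\{\psi_i,\psi_j\}=0$, acting on $\mathcal H_A\otimes\mathcal H_B$, the tensor product of the two Fock spaces (of dimensions $2^{N_A}$ and $2^{N_B}$; the modes of $B$ carry the fermion parity of $A$). A density matrix $\rho$ on $\mathcal H_A\otimes\mathcal H_B$ is a (number-conserving) Gaussian state with correlation matrix $C$ if it satisfies Wick's theorem: for all modes, $\operatorname{Tr}(\rho\,\psi_{i_1}^\dagger\cdots\psi_{i_p}^\dagger\psi_{j_q}\cdots\psi_{j_1})$ equals $\det(C_{i_kj_l})_{k,l\le p}$ if $p=q$ and $0$ if $p\ne q$; in particular $C_{ij}=\operatorname{Tr}(\rho\,\psi_i^\dagger\psi_j)$. Powers of positive semidefinite matrices and logarithms are defined by functional calculus, with $0^s=0$ for $s\neq0$ and $0^0=1$. For $\alpha\ne1$, $z\neq 0$ let $$D_{\alpha,z}(\rho\|\sigma)=\frac1{\alpha-1}\log\operatorname{Tr}\Big(\sigma^{\frac{1-\alpha}{2z}}\rho^{\frac{\alpha}{z}}\sigma^{\frac{1-\alpha}{2z}}\Big)^z,\qquad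 I_{\alpha,z}(A;B)=D_{\alpha,z}(\rho\,\|\,\rho_A\otimes\rho_B),$$ where $\rho_A,\rho_B$ are the reduced states of $\rho$. Write $C'=\begin{pmatrix}C_{AA}&0\\0&C_{BB}\end{pmatrix}$. (1) If $\rho$ is a Gaussian state with correlation matrix $C=\begin{pmatrix}C_{AA}&C_{AB}\\C_{BA}&C_{BB}\end{pmatrix}$ such that $1-C$ is invertible, then $\rho_A\otimes\rho_B$ is a Gaussian state with correlation matrix $C'$, and for all real $\alpha\neq1$ and $z\ne0$ $$I_{\alpha,z}(A;B)=-\frac{\alpha\operatorname{Tr}\log(1-C)}{1-\alpha}-\operatorname{Tr}\log(1-C')-\frac{1}{1-\alpha}\operatorname{Tr}\log\left(1+\left(\Big(\tfrac{C'}{1-C'}\Big)^{\frac{1-\alpha}{2z}}\Big(\tfrac{C}{1-C}\Big)^{\frac{\alpha}{z}}\Big(\tfrac{C'}{1-C'}\Big)^{\frac{1-\alpha}{2z}}\right)^{z}\right).$$ (2) The Rényi mutual informations are computable in polynomial time: there is a single program for a real random access machine (unit cost for real arithmetic, exponential, logarithm and comparison, and for resetting, copying, incrementing and comparing integer counters;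 no real constants in the program) such that for all real $\alpha\ne1$, $z\ne0$ there is a polynomial $p$ with the following property. For all $N_A,N_B,n\in\mathbb N$ and every Gaussian state with correlation matrix $C$ satisfying $2^{-n}\le C\le 1-2^{-n}$, on the input $(N_A,N_B,n,\alpha,z,C)$ the program halts after at most $p(N_A+N_B+n)$ steps and outputs a real number that differs from $I_{\alpha,z}(A;B)$ by at most $2^{-n}$. -/

import Mathlib

open scoped Matrix Kronecker ComplexOrder

/-! ### Functions of Hermitian matrices and Rényi divergences -/

noncomputable section

/-- The real power `M ^ s` of a positive semidefinite matrix, by functional calculus: every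
eigenvalue `x` is replaced by `x ^ s` (with `0 ^ s = 0` for `s ≠ 0`, so that negative powers are
taken on the support, and `0 ^ 0 = 1`). -/
def matPow {m : Type*} [Fintype m] [DecidableEq m] (M : Matrix m m ℂ) (s : ℝ) : Matrix m m ℂ :=
  cfc (fun x : ℝ => x ^ s) M

/-- The logarithm of a positive definite matrix, by functional calculus. -/
def matLog {m : Type*} [Fintype m] [DecidableEq m] (M : Matrix m m ℂ) : Matrix m m ℂ :=
  cfc Real.log M

/-- The `α-z` Rényi relative entropy
`(α - 1)⁻¹ log Tr (σ ^ ((1-α)/2z) ρ ^ (α/z) σ ^ ((1-α)/2z)) ^ z`. -/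
def renyiRelEntropy {m : Type*} [Fintype m] [DecidableEq m] (α z : ℝ) (ρ σ : Matrix m m ℂ) : ℝ :=
  1 / (α - 1) * Real.log
    (matPow (matPow σ ((1 - α) / (2 * z)) * matPow ρ (α / z) * matPow σ ((1 - α) / (2 * z)))
      z).trace.re

/-- The reduced state on the first tensor factor. -/
def reduceA {m n : Type*} [Fintype n] (ρ : Matrix (m × n) (m × n) ℂ) : Matrix m m ℂ :=
  Matrix.of fun S S' => ∑ T, ρ (S, T) (S', T)

/-- The reduced state on the second tensor factor. -/
def reduceB {m n : Type*} [Fintype m] (ρ : Matrix (m × n) (m × n) ℂ) : Matrix n n ℂ :=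
  Matrix.of fun T T' => ∑ S, ρ (S, T) (S, T')

/-- The `α-z` Rényi mutual information `D_{α,z}(ρ_AB ‖ ρ_A ⊗ ρ_B)`. -/
def renyiMutualInfo {m n : Type*} [Fintype m] [DecidableEq m] [Fintype n] [DecidableEq n]
    (α z : ℝ) (ρ : Matrix (m × n) (m × n) ℂ) : ℝ :=
  renyiRelEntropy α z ρ (reduceA ρ ⊗ₖ reduceB ρ)

/-! ### Fermionic modes and Gaussian states -/

/-- The annihilation operator of the mode `i` on the Fock space whose orthonormal basis is
labelled by the sets of occupied modes; the entry at `(S, T)` is `⟨S| ψ_i |T⟩`. -/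
def annihilation {ι : Type*} [LinearOrder ι] (i : ι) : Matrix (Finset ι) (Finset ι) ℂ :=
  Matrix.of fun S T => if i ∈ T ∧ S = T.erase i then (-1) ^ (T.filter (· < i)).card else 0

/-- The fermion parity operator `(-1) ^ N`. -/
def parity (ι : Type*) [DecidableEq ι] : Matrix (Finset ι) (Finset ι) ℂ :=
  Matrix.diagonal fun S => (-1) ^ S.card

/-- The annihilation operators of the modes of `A ∪ B` on the tensor product of the Fock space
of `A` and the Fock space of `B`; the parity factor makes the modes of `A` anticommute with
those of `B`. -/
def mode {A B : Type*} [Fintype A] [LinearOrder A] [Fintype B] [LinearOrder B] :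
    A ⊕ B → Matrix (Finset A × Finset B) (Finset A × Finset B) ℂ
  | Sum.inl a => annihilation a ⊗ₖ (1 : Matrix (Finset B) (Finset B) ℂ)
  | Sum.inr b => parity A ⊗ₖ annihilation b

/-- `ρ` is a (particle-number conserving) Gaussian state with correlation matrix
`C i j = Tr (ρ ψ_i† ψ_j)`: it is a density matrix and all its correlation functions are given by
Wick's theorem in terms of `C`, that is,
`Tr (ρ ψ_{i 0}† ⋯ ψ_{i (p-1)}† ψ_{j (q-1)} ⋯ ψ_{j 0})` is the determinant of the matrix of
two-point functions if `p = q`, and zero otherwise. -/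
structure IsGaussianState {ι F : Type*} [Fintype F] [DecidableEq F] (ψ : ι → Matrix F F ℂ)
    (ρ : Matrix F F ℂ) (C : Matrix ι ι ℂ) : Prop where
  posSemidef : ρ.PosSemidef
  trace_eq_one : ρ.trace = 1
  wick : ∀ (p : ℕ) (i j : Fin p → ι),
    (ρ * ((List.ofFn fun k => (ψ (i k))ᴴ).prod * (List.ofFn fun k => ψ (j k)).reverse.prod)).trace
      = (Matrix.of fun k l => C (i k) (j l)).det
  wick_off : ∀ (p q : ℕ) (i : Fin p → ι) (j : Fin q → ι), p ≠ q →
    (ρ * ((List.ofFn fun k => (ψ (i k))ᴴ).prod * (List.ofFn fun k => ψ (j k)).reverse.prod)).trace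
      = 0

/-- The correlation matrix with the correlations between `A` and `B` removed. -/
def blockDiagPart {A B : Type*} (C : Matrix (A ⊕ B) (A ⊕ B) ℂ) : Matrix (A ⊕ B) (A ⊕ B) ℂ :=
  Matrix.fromBlocks C.toBlocks₁₁ 0 0 C.toBlocks₂₂

/-- The matrix `C / (1 - C)`. -/
def oddsMatrix {m : Type*} [Fintype m] [DecidableEq m] (C : Matrix m m ℂ) : Matrix m m ℂ :=
  C * (1 - C)⁻¹

/-! ### Real random access machines

Programs work with counters, which hold natural numbers and can be reset, copied, incremented and
compared, and with two-dimensional arrays of real numbers, addressed by counters. The arithmetic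
operations, the exponential, the logarithm and the comparison of real numbers have unit cost. A
program contains no real constants: it is a finite string over a countable alphabet. -/

/-- The state of the machine: the counters, and the cell `(k, l)` of each array. -/
structure RamState where
  counter : ℕ → ℕ
  array : ℕ → ℕ → ℕ → ℝ

/-- Expressions for real numbers. `cell a i j` is the content of the array number `a` at the
position given by the current values of the counters number `i` and `j`. -/
inductive RealExpr : Type
  | nat (k : ℕ)
  | cell (a i j : ℕ)
  | add (e f : RealExpr)
  | sub (e f : RealExpr)
  | mul (e f : RealExpr)
  | div (e f : RealExpr)
  | exp (e : RealExpr)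
  | log (e : RealExpr)

/-- The value of an expression. -/
def RealExpr.value (s : RamState) : RealExpr → ℝ
  | .nat k => k
  | .cell a i j => s.array a (s.counter i) (s.counter j)
  | .add e f => e.value s + f.value s
  | .sub e f => e.value s - f.value s
  | .mul e f => e.value s * f.value s
  | .div e f => e.value s / f.value s
  | .exp e => Real.exp (e.value s)
  | .log e => Real.log (e.value s)

/-- The cost of an evaluation: one for each constant, memory access and operation. -/
def RealExpr.cost : RealExpr → ℕ
  | .nat _ => 1
  | .cell _ _ _ => 1
  | .add e f => e.cost + f.cost + 1
  | .sub e f => e.cost + f.cost + 1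
  | .mul e f => e.cost + f.cost + 1
  | .div e f => e.cost + f.cost + 1
  | .exp e => e.cost + 1
  | .log e => e.cost + 1

/-- Tests: comparison of two counters, or of two real numbers. -/
inductive RamTest : Type
  | counterLt (i j : ℕ)
  | realLt (e f : RealExpr)

/-- The truth of a test. -/
def RamTest.Holds (s : RamState) : RamTest → Prop
  | .counterLt i j => s.counter i < s.counter j
  | .realLt e f => e.value s < f.value s

/-- The cost of a test. -/
def RamTest.cost : RamTest → ℕ
  | .counterLt _ _ => 1
  | .realLt e f => e.cost + f.cost + 1

/-- Programs. -/
inductive RamProgram : Type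
  | skip
  | reset (i : ℕ)
  | copy (i j : ℕ)
  | incr (i : ℕ)
  | store (a i j : ℕ) (e : RealExpr)
  | seq (P Q : RamProgram)
  | ifThenElse (t : RamTest) (P Q : RamProgram)
  | whileDo (t : RamTest) (P : RamProgram)

/-- Overwrite a counter. -/
def RamState.setCounter (s : RamState) (i v : ℕ) : RamState :=
  { s with counter := Function.update s.counter i v }

/-- Overwrite the cell `(k, l)` of the array number `a`. -/
def RamState.setCell (s : RamState) (a k l : ℕ) (x : ℝ) : RamState :=
  { s with array := fun a' k' l' => if a' = a ∧ k' = k ∧ l' = l then x else s.array a' k' l' }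

/-- `RamExec P s t s'`: started in the state `s`, the program `P` halts after exactly `t` steps in
the state `s'`. -/
inductive RamExec : RamProgram → RamState → ℕ → RamState → Prop
  | skip (s : RamState) : RamExec .skip s 1 s
  | reset (i : ℕ) (s : RamState) : RamExec (.reset i) s 1 (s.setCounter i 0)
  | copy (i j : ℕ) (s : RamState) : RamExec (.copy i j) s 1 (s.setCounter i (s.counter j))
  | incr (i : ℕ) (s : RamState) : RamExec (.incr i) s 1 (s.setCounter i (s.counter i + 1))
  | store (a i j : ℕ) (e : RealExpr) (s : RamState) :
      RamExec (.store a i j e) s (e.cost + 1)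
        (s.setCell a (s.counter i) (s.counter j) (e.value s))
  | seq {P Q : RamProgram} {s s₁ s₂ : RamState} {t₁ t₂ : ℕ} :
      RamExec P s t₁ s₁ → RamExec Q s₁ t₂ s₂ → RamExec (.seq P Q) s (t₁ + t₂) s₂
  | ifTrue {b : RamTest} {P Q : RamProgram} {s s₁ : RamState} {t : ℕ} :
      b.Holds s → RamExec P s t s₁ → RamExec (.ifThenElse b P Q) s (b.cost + t) s₁
  | ifFalse {b : RamTest} {P Q : RamProgram} {s s₁ : RamState} {t : ℕ} :
      ¬ b.Holds s → RamExec Q s t s₁ → RamExec (.ifThenElse b P Q) s (b.cost + t) s₁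
  | whileTrue {b : RamTest} {P : RamProgram} {s s₁ s₂ : RamState} {t₁ t₂ : ℕ} :
      b.Holds s → RamExec P s t₁ s₁ → RamExec (.whileDo b P) s₁ t₂ s₂ →
      RamExec (.whileDo b P) s (b.cost + t₁ + t₂) s₂
  | whileFalse {b : RamTest} {P : RamProgram} {s : RamState} :
      ¬ b.Holds s → RamExec (.whileDo b P) s b.cost s

/-- The input: the counters `0, 1, 2` hold the numbers of modes of `A` and `B` and the accuracy
parameter `n`; the arrays `0` and `1` hold the real and imaginary parts of the entries of the
correlation matrix (the modes of `A` come first); the first two cells of the array `2` hold `α`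
and `z`. Everything else is zero. -/
def ramInput (NA NB n : ℕ) (α z : ℝ) (C : Matrix (Fin NA ⊕ Fin NB) (Fin NA ⊕ Fin NB) ℂ) :
    RamState where
  counter := fun i => if i = 0 then NA else if i = 1 then NB else if i = 2 then n else 0
  array := fun a k l =>
    if h : k < NA + NB ∧ l < NA + NB ∧ a < 2 then
      let c := C (finSumFinEquiv.symm ⟨k, h.1⟩) (finSumFinEquiv.symm ⟨l, h.2.1⟩)
      if a = 0 then c.re else c.im
    else if a = 2 ∧ k = 0 ∧ l = 0 then α
    else if a = 2 ∧ k = 0 ∧ l = 1 then z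
    else 0

/-- The output is the first cell of the array `3`. -/
def RamState.output (s : RamState) : ℝ := s.array 3 0 0

end

/-! Closed form. Let Γ be second quantization: Γ(M) fixes the vacuum and turns ψ_i† into Σ_j M_ij
ψ_j†. It reverses products, respects adjoints, and sends a diagonal matrix to the diagonal operator
of products over the occupied modes. Hence it carries eigenbases to eigenbases, and for A ≥ 0 it
satisfies Γ(A)^s = Γ(A^s) and Tr Γ(A) = det(1 + A) (`FockModel.matPow_smul_quant`,
`FockModel.trace_quant`).

If 1 - C is invertible, the Gaussian state is ρ = det(1 - C) Γ(C/(1 - C)). Indeed, a relation ρ ψ_i†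
= (Σ_j W_ij ψ_j†) ρ together with cyclicity of the trace gives a linear system for the correlation
functions, and its solution is the Laplace expansion of Wick's determinant
(`FockModel.isGaussianState_of_intertwines`). Conversely, Wick's values determine the state, because
normal ordered monomials span all operators (`FockModel.gaussianState_unique`). The product of the
reduced states satisfies the same kind of relation with a block diagonal W, so it is Gaussian for
C'. The operator inside the divergence is then a positive multiple of Γ of the sandwiched odds
matrices, and the logarithm of its trace is a log det = Tr log (`FockModel.renyiRelEntropy_eq`).

Polynomial time. The closed form involves only matrices of size N = N_A + N_B, and it can be
evaluated by sums and products of matrices: exp y is replaced by (1 + y/2^K)^(2^K), and log x by K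
steps of y ↦ y - 1 + x exp(-y), started at a number Y ≥ |log x|. These are polynomials in a single
Hermitian matrix, so they act on eigenvalues and their accuracy is a scalar question
(`Accurate.logApprox`). Only the sandwich mixes two eigenbases. Its error is carried through t ↦
log(1 + t^z) because functions of Hermitian matrices inherit Lipschitz constants in the Frobenius
norm (`frobenius_norm_conjDiag_sub_le`). The bounds 2^(-n) ≤ C ≤ 1 - 2^(-n) keep all relevant
logarithms O(n) for fixed α and z. So Y = O(n), and K of order Y(Y + N) gives the accuracy exp(-(6Y
+ 4N + 2)), which beats all condition numbers (`error_budget`). The cost is dominated by logarithms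
made of K steps of K squarings each, in total O(K² N³). -/

theorem mul_mul_posSemidef {m : Type*} [Fintype m] {X Y : Matrix m m ℂ}
    (hX : X.IsHermitian) (hY : Y.PosSemidef) : (X * Y * X).PosSemidef := by
  have := hY.mul_mul_conjTranspose_same X
  rwa [hX.eq] at this

/-! ### Hermitian matrices in an explicit eigenbasis -/

section DiagonalForm

variable {m : Type*} [Fintype m] [DecidableEq m]

/-- The Hermitian matrix with orthonormal eigenbasis `U` and eigenvalues `a`. -/
def conjDiag (U : Matrix m m ℂ) (a : m → ℝ) : Matrix m m ℂ :=
  U * Matrix.diagonal (fun i => (a i : ℂ)) * Uᴴ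

/-- The overlap `Uᴴ * V` of two eigenbases of one matrix can have a nonzero entry only where the
eigenvalues agree, so `f` may be applied on both sides. -/
theorem diagonal_mul_eq_of_conjDiag_eq {U V : Matrix m m ℂ} (hU : Uᴴ * U = 1) (hV : Vᴴ * V = 1)
    {a b : m → ℝ} (h : conjDiag U a = conjDiag V b) (f : ℝ → ℝ) :
    Matrix.diagonal (fun i => (f (a i) : ℂ)) * (Uᴴ * V) =
      (Uᴴ * V) * Matrix.diagonal (fun i => (f (b i) : ℂ)) := by
  have h1 : Matrix.diagonal (fun i => (a i : ℂ)) * (Uᴴ * V) =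
      (Uᴴ * V) * Matrix.diagonal (fun i => (b i : ℂ)) := by
    calc Matrix.diagonal (fun i => (a i : ℂ)) * (Uᴴ * V)
        = Uᴴ * U * Matrix.diagonal (fun i => (a i : ℂ)) * (Uᴴ * V) := by rw [hU, one_mul]
      _ = Uᴴ * conjDiag U a * V := by simp only [conjDiag, mul_assoc]
      _ = Uᴴ * V * Matrix.diagonal (fun i => (b i : ℂ)) * (Vᴴ * V) := by
          rw [h]; simp only [conjDiag, mul_assoc]
      _ = _ := by rw [hV, mul_one]
  ext i j
  have h2 := congrFun (congrFun h1 i) j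
  rw [Matrix.diagonal_mul, Matrix.mul_diagonal] at h2 ⊢
  by_cases hq : (Uᴴ * V) i j = 0
  · simp [hq]
  · have h3 : (a i : ℂ) = b j := by
      rw [mul_comm] at h2
      exact mul_left_cancel₀ hq h2
    rw [Complex.ofReal_injective h3, mul_comm]

theorem conjDiag_isHermitian (U : Matrix m m ℂ) (a : m → ℝ) : (conjDiag U a).IsHermitian := by
  simp only [conjDiag, Matrix.IsHermitian, Matrix.conjTranspose_mul, Matrix.diagonal_conjTranspose,
    Matrix.conjTranspose_conjTranspose, mul_assoc]
  congr 3
  ext i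
  simp

theorem Matrix.IsHermitian.exists_conjDiag {A : Matrix m m ℂ} (hA : A.IsHermitian) :
    ∃ (U : Matrix m m ℂ) (a : m → ℝ), U * Uᴴ = 1 ∧ Uᴴ * U = 1 ∧ A = conjDiag U a ∧
      ∀ f : ℝ → ℝ, cfc f A = conjDiag U (fun i => f (a i)) := by
  refine ⟨hA.eigenvectorUnitary, hA.eigenvalues, ?_, ?_, ?_, fun f => ?_⟩
  · exact Unitary.coe_mul_star_self _
  · exact Unitary.coe_star_mul_self _
  · conv_lhs => rw [hA.spectral_theorem]
    rfl
  · rw [hA.cfc_eq]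
    rfl

/-- The spectral theorem evaluates the calculus in one particular eigenbasis; the overlap relation
above carries the value to any other. Later computations can thus use whatever diagonalization is at
hand, in particular the one produced by second quantization. -/
theorem cfc_conjDiag {V : Matrix m m ℂ} (hV' : V * Vᴴ = 1) (b : m → ℝ) (f : ℝ → ℝ) :
    cfc f (conjDiag V b) = conjDiag V (fun i => f (b i)) := by
  have hV : Vᴴ * V = 1 := mul_eq_one_comm.mp hV'
  obtain ⟨U, a, hU1, hU2, hA, hf⟩ := (conjDiag_isHermitian V b).exists_conjDiag
  rw [hf]
  have h := diagonal_mul_eq_of_conjDiag_eq hU2 hV hA.symm f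
  calc conjDiag U (fun i => f (a i))
      = U * Matrix.diagonal (fun i => (f (a i) : ℂ)) * Uᴴ * (V * Vᴴ) := by
        rw [hV', mul_one]; rfl
    _ = U * (Matrix.diagonal (fun i => (f (a i) : ℂ)) * (Uᴴ * V)) * Vᴴ := by
        simp only [mul_assoc]
    _ = (U * Uᴴ) * V * Matrix.diagonal (fun i => (f (b i) : ℂ)) * Vᴴ := by
        rw [h]; simp only [mul_assoc]
    _ = _ := by rw [hU1, one_mul]; rfl

theorem conjDiag_one {U : Matrix m m ℂ} (hU : U * Uᴴ = 1) : conjDiag U (fun _ => 1) = 1 := by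
  simp [conjDiag, hU]

theorem conjDiag_add (U : Matrix m m ℂ) (a b : m → ℝ) :
    conjDiag U (fun i => a i + b i) = conjDiag U a + conjDiag U b := by
  simp only [conjDiag, Complex.ofReal_add, ← Matrix.diagonal_add, mul_add, add_mul]

theorem conjDiag_sub (U : Matrix m m ℂ) (a b : m → ℝ) :
    conjDiag U (fun i => a i - b i) = conjDiag U a - conjDiag U b := by
  simp only [conjDiag, Complex.ofReal_sub, ← Matrix.diagonal_sub, mul_sub, sub_mul]

theorem conjDiag_mul {U : Matrix m m ℂ} (hU : Uᴴ * U = 1) (a b : m → ℝ) :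
    conjDiag U (fun i => a i * b i) = conjDiag U a * conjDiag U b := by
  calc _ = U * Matrix.diagonal (fun i => (a i : ℂ)) * (Uᴴ * U) *
        Matrix.diagonal (fun i => (b i : ℂ)) * Uᴴ := by
        simp only [hU, mul_one, conjDiag, Complex.ofReal_mul, ← Matrix.diagonal_mul_diagonal,
          mul_assoc]
    _ = _ := by simp only [conjDiag, mul_assoc]

theorem conjDiag_smul (U : Matrix m m ℂ) (c : ℝ) (a : m → ℝ) :
    conjDiag U (fun i => c * a i) = (c : ℂ) • conjDiag U a := by
  have : Matrix.diagonal (fun i => ((c * a i : ℝ) : ℂ)) =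
      (c : ℂ) • Matrix.diagonal (fun i => (a i : ℂ)) := by
    ext i j
    by_cases h : i = j <;> simp [h, Matrix.diagonal]
  simp only [conjDiag, this, Matrix.mul_smul, Matrix.smul_mul]

theorem trace_conjDiag {U : Matrix m m ℂ} (hU : Uᴴ * U = 1) (a : m → ℝ) :
    (conjDiag U a).trace = ((∑ i, a i : ℝ) : ℂ) := by
  rw [conjDiag, Matrix.trace_mul_comm, ← mul_assoc, hU, one_mul, Matrix.trace_diagonal]
  simp

theorem det_conjDiag {U : Matrix m m ℂ} (hU : U * Uᴴ = 1) (a : m → ℝ) :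
    (conjDiag U a).det = ((∏ i, a i : ℝ) : ℂ) := by
  have h : U.det * Uᴴ.det = 1 := by rw [← Matrix.det_mul, hU, Matrix.det_one]
  rw [conjDiag, Matrix.det_mul, Matrix.det_mul, mul_right_comm, h, one_mul, Matrix.det_diagonal]
  simp

theorem conjDiag_posSemidef_iff {U : Matrix m m ℂ} (hU : Uᴴ * U = 1) {a : m → ℝ} :
    (conjDiag U a).PosSemidef ↔ ∀ i, 0 ≤ a i := by
  constructor
  · intro h i
    have h1 := h.conjTranspose_mul_mul_same U
    have h2 : Uᴴ * conjDiag U a * U = Matrix.diagonal (fun i => (a i : ℂ)) := by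
      calc _ = (Uᴴ * U) * Matrix.diagonal (fun i => (a i : ℂ)) * (Uᴴ * U) := by
            simp only [conjDiag, mul_assoc]
        _ = _ := by rw [hU, one_mul, mul_one]
    rw [h2, Matrix.posSemidef_diagonal_iff] at h1
    exact_mod_cast h1 i
  · intro h
    apply Matrix.PosSemidef.mul_mul_conjTranspose_same
    rw [Matrix.posSemidef_diagonal_iff]
    intro i
    exact_mod_cast h i

/-- `log det A = Tr log A` for positive definite `A`. -/
theorem log_det_eq_trace_matLog {A : Matrix m m ℂ} (hA : A.PosSemidef) (hu : IsUnit A) :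
    0 < A.det.re ∧ A.det = (A.det.re : ℂ) ∧ (matLog A).trace.re = Real.log A.det.re := by
  obtain ⟨U, a, hU1, hU2, rfl, hf⟩ := hA.isHermitian.exists_conjDiag
  have hu' := (Matrix.isUnit_iff_isUnit_det _).mp hu
  rw [det_conjDiag hU1] at hu' ⊢
  rw [conjDiag_posSemidef_iff hU2] at hA
  have hne : (∏ i, a i) ≠ 0 := by
    intro h
    simp [h] at hu'
  rw [Finset.prod_ne_zero_iff] at hne
  refine ⟨?_, by simp only [Complex.ofReal_re], ?_⟩
  · rw [Complex.ofReal_re]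
    exact Finset.prod_pos fun i hi => lt_of_le_of_ne (hA i) (hne i hi).symm
  · rw [matLog, hf, trace_conjDiag hU2, Complex.ofReal_re, Complex.ofReal_re,
      Real.log_prod hne]

theorem matPow_posSemidef {A : Matrix m m ℂ} (hA : A.PosSemidef) (s : ℝ) :
    (matPow A s).PosSemidef := by
  obtain ⟨U, a, hU1, hU2, rfl, hf⟩ := hA.isHermitian.exists_conjDiag
  rw [conjDiag_posSemidef_iff hU2] at hA
  rw [matPow, hf, conjDiag_posSemidef_iff hU2]
  exact fun i => Real.rpow_nonneg (hA i) s

theorem one_add_isUnit {A : Matrix m m ℂ} (hA : A.PosSemidef) : IsUnit (1 + A) :=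
  (Matrix.PosDef.one.add_posSemidef hA).isUnit

end DiagonalForm

/-! ### Ordered products of anticommuting elements -/

section OrderedProducts

variable {ι R : Type*} [LinearOrder ι] [Ring R]

/-- The product of the `a i` for `i ∈ S`, in increasing order. -/
def ordProd (a : ι → R) (S : Finset ι) : R :=
  ((S.sort).map a).prod

theorem ordProd_empty (a : ι → R) : ordProd a ∅ = 1 := by
  simp [ordProd]

theorem ordProd_insert_min (a : ι → R) {S : Finset ι} {i : ι} (h : ∀ j ∈ S, i < j) :
    ordProd a (insert i S) = a i * ordProd a S := by
  have hi : i ∉ S := fun hi => lt_irrefl _ (h i hi)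
  rw [ordProd, Finset.sort_insert _ (fun j hj => (h j hj).le) hi]
  simp [ordProd]

/-- Each factor with index below `i` that `a i` passes contributes one sign. The signs agree with
those in the matrix elements of the creation operators. -/
theorem mul_ordProd {a : ι → R} (ha : ∀ i j, a i * a j = -(a j * a i)) {i : ι} (S : Finset ι)
    (hi : i ∉ S) :
    a i * ordProd a S = (-1) ^ (S.filter (· < i)).card * ordProd a (insert i S) := by
  induction S using Finset.induction_on_min with
  | empty => simp [ordProd]
  | insert m S hm ih =>
    have hmS : m ∉ S := fun h => lt_irrefl _ (hm m h)
    rw [Finset.mem_insert, not_or] at hi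
    rcases lt_or_gt_of_ne hi.1 with hlt | hgt
    · have hmin : ∀ j ∈ insert m S, i < j := by
        intro j hj
        rcases Finset.mem_insert.mp hj with rfl | hj
        · exact hlt
        · exact hlt.trans (hm j hj)
      rw [ordProd_insert_min a hmin, Finset.filter_false_of_mem
        (fun j hj => not_lt.mpr (hmin j hj).le)]
      simp
    · have hmin : ∀ j ∈ insert i S, m < j := by
        intro j hj
        rcases Finset.mem_insert.mp hj with rfl | hj
        · exact hgt
        · exact hm j hj
      rw [Finset.insert_comm, ordProd_insert_min a hmin, ordProd_insert_min a hm, ← mul_assoc, ha,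
        neg_mul, mul_assoc, ih hi.2, Finset.filter_insert, if_pos hgt,
        Finset.card_insert_of_notMem (fun h => hmS (Finset.mem_filter.mp h).1), pow_succ]
      have hc := (Commute.neg_one_left (a m)).pow_left (S.filter (· < i)).card
      rw [← mul_assoc (a m), ← hc.eq]
      noncomm_ring

theorem mul_ordProd_of_mem {a : ι → R} (ha : ∀ i j, a i * a j = -(a j * a i))
    (hsq : ∀ i, a i * a i = 0) {i : ι} (S : Finset ι) (hi : i ∈ S) : a i * ordProd a S = 0 := by
  induction S using Finset.induction_on_min with
  | empty => simp at hi
  | insert m S hm ih =>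
    rw [ordProd_insert_min a hm]
    rcases Finset.mem_insert.mp hi with rfl | hi
    · rw [← mul_assoc, hsq, zero_mul]
    · rw [← mul_assoc, ha, neg_mul, mul_assoc, ih hi, mul_zero, neg_zero]

end OrderedProducts

/-! ### Anticommutation relations and second quantization on Fock space -/

section FockSpace

variable {ι : Type*} [LinearOrder ι]

/-- The sign of a creation or annihilation of the mode `i` in the state `S`. -/
def jwSign (i : ι) (S : Finset ι) : ℂ := (-1) ^ (S.filter (· < i)).card

theorem jwSign_mul_self (i : ι) (S : Finset ι) : jwSign i S * jwSign i S = 1 := by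
  rw [jwSign, ← mul_pow]
  simp

theorem jwSign_insert {i j : ι} {S : Finset ι} (hj : j ∉ S) :
    jwSign i (insert j S) = if j < i then -jwSign i S else jwSign i S := by
  unfold jwSign
  rw [Finset.filter_insert]
  split_ifs with h
  · rw [Finset.card_insert_of_notMem (fun h => hj (Finset.mem_filter.mp h).1), pow_succ]
    ring
  · rfl

theorem jwSign_erase {i j : ι} {S : Finset ι} (hj : j ∈ S) :
    jwSign i (S.erase j) = if j < i then -jwSign i S else jwSign i S := by
  have h := jwSign_insert (i := i) (Finset.notMem_erase j S)
  rw [Finset.insert_erase hj] at h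
  rw [h]
  split_ifs <;> simp

/-- The basis state with the set `S` of occupied modes. -/
def occ {F : Type*} [DecidableEq F] (S : F) : F → ℂ := Pi.single S 1

variable [Fintype ι]

theorem annihilation_mulVec_occ (i : ι) (T : Finset ι) :
    annihilation i *ᵥ occ T = if i ∈ T then jwSign i T • occ (T.erase i) else 0 := by
  ext S
  rw [occ, Matrix.mulVec_single_one]
  by_cases h : i ∈ T <;> simp [annihilation, h, Matrix.col, occ, jwSign, Pi.single_apply]

theorem creation_mulVec_occ (i : ι) (T : Finset ι) :
    (annihilation i)ᴴ *ᵥ occ T = if i ∈ T then 0 else jwSign i T • occ (insert i T) := by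
  ext S
  rw [occ, Matrix.mulVec_single_one]
  by_cases h : i ∈ T
  · have : ¬ (i ∈ S ∧ T = S.erase i) := fun h' => by
      rw [h'.2] at h
      exact Finset.notMem_erase _ _ h
    simp [annihilation, h, Matrix.col, this]
  · by_cases hS : S = insert i T
    · subst hS
      simp [annihilation, h, Matrix.col, occ, jwSign, Finset.filter_insert]
    · have : ¬ (i ∈ S ∧ T = S.erase i) := fun h' => by
        rw [h'.2, Finset.insert_erase h'.1] at hS
        exact hS rfl
      simp [annihilation, h, Matrix.col, occ, this, hS]

theorem ext_of_mulVec_occ {F : Type*} [Fintype F] [DecidableEq F] {M N : Matrix F F ℂ}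
    (h : ∀ S, M *ᵥ occ S = N *ᵥ occ S) : M = N :=
  Matrix.ext_of_mulVec_single h

/-- Creating the smaller mode first flips the sign of the later creation of the larger one; in the
opposite order there is no flip. The two orders therefore differ by -1. -/
theorem creation_anticomm (i j : ι) :
    (annihilation i)ᴴ * (annihilation j)ᴴ = -((annihilation j)ᴴ * (annihilation i)ᴴ) := by
  apply ext_of_mulVec_occ
  intro T
  rw [Matrix.neg_mulVec, ← Matrix.mulVec_mulVec, ← Matrix.mulVec_mulVec, creation_mulVec_occ,
    creation_mulVec_occ]
  by_cases hi : i ∈ T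
  · by_cases hj : j ∈ T <;> simp [hi, hj, Matrix.mulVec_smul, creation_mulVec_occ]
  · by_cases hj : j ∈ T
    · simp [hi, hj, Matrix.mulVec_smul, creation_mulVec_occ]
    · rcases lt_trichotomy i j with h | rfl | h
      · simp [hi, hj, Matrix.mulVec_smul, creation_mulVec_occ, jwSign_insert, h.ne, h.ne', h,
          h.not_gt, smul_smul, Finset.insert_comm i j, mul_comm]
      · simp [hi, Matrix.mulVec_smul, creation_mulVec_occ]
      · simp [hi, hj, Matrix.mulVec_smul, creation_mulVec_occ, jwSign_insert, h.ne, h.ne', h,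
          h.not_gt, smul_smul, Finset.insert_comm i j, mul_comm]

theorem annihilation_creation (i j : ι) :
    annihilation i * (annihilation j)ᴴ =
      (if i = j then 1 else 0) - (annihilation j)ᴴ * annihilation i := by
  apply ext_of_mulVec_occ
  intro T
  rw [Matrix.sub_mulVec, ← Matrix.mulVec_mulVec, ← Matrix.mulVec_mulVec, creation_mulVec_occ,
    annihilation_mulVec_occ]
  by_cases hij : i = j
  · subst hij
    by_cases hi : i ∈ T
    · simp [hi, Matrix.mulVec_smul, creation_mulVec_occ, jwSign_erase, smul_smul,
        jwSign_mul_self]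
    · simp [hi, Matrix.mulVec_smul, annihilation_mulVec_occ, jwSign_insert, smul_smul,
        jwSign_mul_self]
  · by_cases hi : i ∈ T
    · by_cases hj : j ∈ T
      · simp [hi, hj, hij, Ne.symm hij, Matrix.mulVec_smul, creation_mulVec_occ]
      · rcases lt_or_gt_of_ne hij with h | h <;>
        simp [hi, hj, hij, Ne.symm hij, Matrix.mulVec_smul, creation_mulVec_occ,
          annihilation_mulVec_occ, jwSign_erase, jwSign_insert, smul_smul, h, h.not_gt,
          Finset.erase_insert_of_ne (Ne.symm hij), mul_comm]
    · by_cases hj : j ∈ T <;>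
      simp [hi, hj, hij, Matrix.mulVec_smul, annihilation_mulVec_occ]

theorem annihilation_anticomm (i j : ι) :
    annihilation i * annihilation j = -(annihilation j * annihilation (ι := ι) i) := by
  have h := congrArg Matrix.conjTranspose (creation_anticomm (ι := ι) j i)
  simpa using h

/-- The creation operator of the mode `Σ_j M_ij |j⟩`. -/
def rowCreation (M : Matrix ι ι ℂ) (i : ι) : Matrix (Finset ι) (Finset ι) ℂ :=
  ∑ j, M i j • (annihilation j)ᴴ

theorem rowCreation_anticomm (M : Matrix ι ι ℂ) (i j : ι) :
    rowCreation M i * rowCreation M j = -(rowCreation M j * rowCreation M i) := by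
  simp only [rowCreation, Finset.sum_mul_sum]
  rw [Finset.sum_comm, ← Finset.sum_neg_distrib]
  refine Finset.sum_congr rfl fun k _ => ?_
  rw [← Finset.sum_neg_distrib]
  refine Finset.sum_congr rfl fun l _ => ?_
  rw [smul_mul_smul_comm, smul_mul_smul_comm, creation_anticomm, smul_neg, mul_comm]

theorem rowCreation_sq (M : Matrix ι ι ℂ) (i : ι) : rowCreation M i * rowCreation M i = 0 := by
  ext S T
  exact self_eq_neg.mp (congrFun (congrFun (rowCreation_anticomm M i i) S) T)

/-- The second quantization of `M`: the operator on the Fock space that fixes the vacuum and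
maps `ψ_i†` to `Σ_j M_ij ψ_j†`. -/
def secondQuant (M : Matrix ι ι ℂ) : Matrix (Finset ι) (Finset ι) ℂ :=
  Matrix.of fun S T => (ordProd (rowCreation M) T *ᵥ occ ∅) S

theorem secondQuant_mulVec_occ (M : Matrix ι ι ℂ) (T : Finset ι) :
    secondQuant M *ᵥ occ T = ordProd (rowCreation M) T *ᵥ occ ∅ := by
  ext S
  rw [occ, Matrix.mulVec_single_one]
  rfl

theorem secondQuant_vacuum (M : Matrix ι ι ℂ) : secondQuant M *ᵥ occ ∅ = occ ∅ := by
  rw [secondQuant_mulVec_occ, ordProd_empty, Matrix.one_mulVec]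

/-- The columns are ordered products applied to the vacuum, and putting one more factor in front
produces the same sign as a creation operator does. Together with the image of the vacuum this
relation characterizes `secondQuant M`, and all its algebraic properties are derived from it. -/
theorem secondQuant_creation (M : Matrix ι ι ℂ) (i : ι) :
    secondQuant M * (annihilation i)ᴴ = rowCreation M i * secondQuant M := by
  apply ext_of_mulVec_occ
  intro T
  rw [← Matrix.mulVec_mulVec, ← Matrix.mulVec_mulVec, creation_mulVec_occ,
    secondQuant_mulVec_occ, Matrix.mulVec_mulVec]
  split_ifs with h
  · rw [mul_ordProd_of_mem (rowCreation_anticomm M) (rowCreation_sq M) T h]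
    simp
  · rw [mul_ordProd (rowCreation_anticomm M) T h, Matrix.mulVec_smul, secondQuant_mulVec_occ]
    -- The sign is a power of the matrix -1 on one side and of the scalar -1 on the other; splitting
    -- on parity identifies them.
    rcases neg_one_pow_eq_or (Matrix (Finset ι) (Finset ι) ℂ) (T.filter (· < i)).card with h' | h' <;>
    rcases Nat.even_or_odd (T.filter (· < i)).card with h'' | h'' <;>
    simp [jwSign, h''.neg_one_pow, Matrix.neg_mulVec]

/-- Operators that act in the same way on the vacuum and on creation operators agree. -/
theorem eq_of_creation {X Y : Matrix (Finset ι) (Finset ι) ℂ} (b : ι → Matrix (Finset ι) (Finset ι) ℂ)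
    (h0 : X *ᵥ occ ∅ = Y *ᵥ occ ∅) (hX : ∀ i, X * (annihilation i)ᴴ = b i * X)
    (hY : ∀ i, Y * (annihilation i)ᴴ = b i * Y) : X = Y := by
  apply ext_of_mulVec_occ
  intro T
  induction T using Finset.induction_on with
  | empty => exact h0
  | insert i T hi ih =>
    have h1 : occ (insert i T) = jwSign i T • ((annihilation i)ᴴ *ᵥ occ T) := by
      rw [creation_mulVec_occ, if_neg hi, smul_smul, jwSign_mul_self, one_smul]
    rw [h1, Matrix.mulVec_smul, Matrix.mulVec_smul, Matrix.mulVec_mulVec, Matrix.mulVec_mulVec,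
      hX, hY, ← Matrix.mulVec_mulVec, ← Matrix.mulVec_mulVec, ih]

/-- Both sides fix the vacuum and intertwine the creation operators in the same way. The order is
reversed because rows of `M`, not columns, are the images of the creation operators. -/
theorem secondQuant_mul (M N : Matrix ι ι ℂ) :
    secondQuant (M * N) = secondQuant N * secondQuant M := by
  refine eq_of_creation (rowCreation (M * N)) ?_ (secondQuant_creation _) fun i => ?_
  · rw [← Matrix.mulVec_mulVec, secondQuant_vacuum, secondQuant_vacuum, secondQuant_vacuum]
  · rw [mul_assoc, secondQuant_creation, ← mul_assoc, ← mul_assoc]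
    congr 1
    rw [rowCreation, Finset.mul_sum]
    simp only [mul_smul_comm, secondQuant_creation, rowCreation, Finset.sum_mul, Finset.smul_sum,
      smul_mul_assoc, Matrix.mul_apply, Finset.sum_smul, smul_smul]
    rw [Finset.sum_comm]

theorem secondQuant_diagonal (w : ι → ℂ) :
    secondQuant (Matrix.diagonal w) = Matrix.diagonal fun S => ∏ i ∈ S, w i := by
  refine eq_of_creation (rowCreation (Matrix.diagonal w)) ?_ (secondQuant_creation _) fun i => ?_
  · rw [secondQuant_vacuum]
    ext S
    rw [Matrix.mulVec_diagonal]
    by_cases h : S = ∅ <;> simp [occ, h]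
  · have hr : rowCreation (Matrix.diagonal w) i = w i • (annihilation i)ᴴ := by
      rw [rowCreation, Finset.sum_eq_single i]
      · simp
      · intro j _ hj
        simp [Matrix.diagonal, hj.symm]
      · simp
    rw [hr]
    ext S T
    rw [Matrix.diagonal_mul, smul_mul_assoc, Matrix.smul_apply, Matrix.mul_diagonal,
      Matrix.conjTranspose_apply, annihilation, Matrix.of_apply]
    split_ifs with h
    · rw [h.2, ← Finset.mul_prod_erase _ _ h.1]
      simp only [smul_eq_mul]
      ring
    · simp

theorem annihilation_vacuum (i : ι) : annihilation i *ᵥ occ ∅ = 0 := by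
  rw [annihilation_mulVec_occ]
  simp

theorem conjTranspose_rowCreation (M : Matrix ι ι ℂ) (i : ι) :
    (rowCreation M i)ᴴ = ∑ j, star (M i j) • annihilation j := by
  simp [rowCreation, Matrix.conjTranspose_sum]

/-- The difference of the two sides kills the vacuum, and moving a creation operator through it
gives only a sign and a transformed creation operator, since the contraction terms `M j i` cancel.
The zero operator has the same two properties, so the difference vanishes. -/
theorem annihilation_secondQuant (M : Matrix ι ι ℂ) (i : ι) :
    annihilation i * secondQuant M = secondQuant M * (rowCreation Mᴴ i)ᴴ := by
  rw [← sub_eq_zero]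
  refine eq_of_creation (fun j => -rowCreation M j) ?_ (fun j => ?_) (by simp)
  · rw [Matrix.sub_mulVec, ← Matrix.mulVec_mulVec, ← Matrix.mulVec_mulVec, secondQuant_vacuum,
      annihilation_vacuum, conjTranspose_rowCreation, Matrix.sum_mulVec]
    simp [Matrix.smul_mulVec, annihilation_vacuum]
  · have h1 : annihilation i * rowCreation M j =
        M j i • 1 - rowCreation M j * annihilation i := by
      rw [rowCreation, Finset.mul_sum, Finset.sum_mul]
      simp only [mul_smul_comm, annihilation_creation, smul_sub, Finset.sum_sub_distrib,
        smul_mul_assoc]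
      simp
    have h2 : (rowCreation Mᴴ i)ᴴ * (annihilation j)ᴴ =
        M j i • 1 - (annihilation j)ᴴ * (rowCreation Mᴴ i)ᴴ := by
      rw [conjTranspose_rowCreation, Finset.mul_sum, Finset.sum_mul]
      simp only [mul_smul_comm, annihilation_creation, smul_sub, Finset.sum_sub_distrib,
        smul_mul_assoc]
      simp
    rw [sub_mul, mul_assoc, secondQuant_creation, mul_assoc, h2, ← mul_assoc, h1, sub_mul, mul_sub,
      ← mul_assoc (secondQuant M), secondQuant_creation]
    simp only [smul_mul_assoc, mul_smul_comm, one_mul, mul_one, mul_assoc, neg_mul, mul_sub]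
    abel

theorem secondQuant_conjTranspose (M : Matrix ι ι ℂ) :
    secondQuant Mᴴ = (secondQuant M)ᴴ := by
  refine eq_of_creation (rowCreation Mᴴ) ?_ (secondQuant_creation _) fun i => ?_
  · rw [secondQuant_vacuum]
    -- The adjoint fixes the vacuum exactly when the vacuum row is trivial. Any other basis state is
    -- a creation operator applied to a smaller one, so its image begins with a creation operator
    -- and has no vacuum component.
    have hrow : ∀ S, secondQuant M ∅ S = if S = ∅ then 1 else 0 := by
      intro S
      have h1 : ∀ v : Finset ι → ℂ, (secondQuant M *ᵥ occ S) ∅ = secondQuant M ∅ S := by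
        intro v
        rw [occ, Matrix.mulVec_single_one]
        rfl
      rw [← h1 0]
      split_ifs with h
      · rw [h, secondQuant_vacuum]
        simp [occ]
      · obtain ⟨i, hi⟩ := Finset.nonempty_iff_ne_empty.mpr h
        have h2 : occ S = jwSign i (S.erase i) • ((annihilation i)ᴴ *ᵥ occ (S.erase i)) := by
          rw [creation_mulVec_occ, if_neg (Finset.notMem_erase _ _), smul_smul, jwSign_mul_self,
            one_smul, Finset.insert_erase hi]
        rw [h2, Matrix.mulVec_smul, Matrix.mulVec_mulVec, secondQuant_creation, rowCreation,
          ← Matrix.mulVec_mulVec, Pi.smul_apply, Matrix.sum_mulVec, Finset.sum_apply,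
          Finset.sum_eq_zero, smul_zero]
        intro j _
        rw [Matrix.smul_mulVec, Pi.smul_apply, Matrix.mulVec, dotProduct, Finset.sum_eq_zero,
          smul_zero]
        intro T _
        simp [annihilation]
    ext S
    conv_rhs => rw [occ, Matrix.mulVec_single_one]
    simp only [Matrix.col, Matrix.transpose_apply, Matrix.conjTranspose_apply, hrow, occ,
      Pi.single_apply]
    split_ifs <;> simp
  · have h := congrArg Matrix.conjTranspose (annihilation_secondQuant M i)
    rw [Matrix.conjTranspose_mul, Matrix.conjTranspose_mul, Matrix.conjTranspose_conjTranspose] at h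
    exact h

end FockSpace

/-! ### Abstract Fock representations, and completeness of normal ordered monomials -/

section FockModels

/-- A representation of the canonical anticommutation relations on a Fock space with its
occupation number basis, together with the second quantization map. -/
structure FockModel {ι F : Type*} [Fintype ι] [DecidableEq ι] [Fintype F] [DecidableEq F]
    (ψ : ι → Matrix F F ℂ) (Γ : Matrix ι ι ℂ → Matrix F F ℂ) (occupied : F ≃ Finset ι) :
    Prop where
  anticomm : ∀ i j, ψ i * ψ j = -(ψ j * ψ i)
  car : ∀ i j, ψ i * (ψ j)ᴴ = (if i = j then 1 else 0) - (ψ j)ᴴ * ψ i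
  number : ∀ i x y, ψ i x y ≠ 0 → (occupied y).card = (occupied x).card + 1
  quant_mul : ∀ M N, Γ (M * N) = Γ N * Γ M
  quant_diagonal : ∀ w, Γ (Matrix.diagonal w) = Matrix.diagonal fun x => ∏ i ∈ occupied x, w i
  quant_conjTranspose : ∀ M, Γ Mᴴ = (Γ M)ᴴ
  quant_creation : ∀ M i, Γ M * (ψ i)ᴴ = (∑ j, M i j • (ψ j)ᴴ) * Γ M
  separating : ∀ Δ : Matrix F F ℂ,
    (∀ I J : List ι, (Δ * ((I.map fun i => (ψ i)ᴴ).prod * (J.map ψ).prod)).trace = 0) → Δ = 0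

section NormalOrdering

variable {ι : Type*} [LinearOrder ι] [Fintype ι]

/-- The span of the normal ordered monomials. -/
def normalOrderedSpan (ι : Type*) [LinearOrder ι] [Fintype ι] :
    Submodule ℂ (Matrix (Finset ι) (Finset ι) ℂ) :=
  Submodule.span ℂ (Set.range fun IJ : List ι × List ι =>
    (IJ.1.map fun i => (annihilation i)ᴴ).prod * (IJ.2.map annihilation).prod)

theorem creation_mul_mem_normalOrderedSpan (i : ι) {X : Matrix (Finset ι) (Finset ι) ℂ}
    (hX : X ∈ normalOrderedSpan ι) : (annihilation i)ᴴ * X ∈ normalOrderedSpan ι := by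
  induction hX using Submodule.span_induction with
  | mem X hX =>
    obtain ⟨⟨I, J⟩, rfl⟩ := hX
    exact Submodule.subset_span ⟨(i :: I, J), by simp [mul_assoc]⟩
  | zero => simp
  | add X Y _ _ hX hY => rw [mul_add]; exact add_mem hX hY
  | smul c X _ hX => rw [mul_smul_comm]; exact Submodule.smul_mem _ _ hX

/-- The anticommutation relation moves the annihilator to the right past one creation operator at a
time; each contraction leaves a shorter normal ordered monomial. -/
theorem annihilation_mul_mem_normalOrderedSpan (i : ι) {X : Matrix (Finset ι) (Finset ι) ℂ}
    (hX : X ∈ normalOrderedSpan ι) : annihilation i * X ∈ normalOrderedSpan ι := by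
  induction hX using Submodule.span_induction with
  | mem X hX =>
    obtain ⟨⟨I, J⟩, rfl⟩ := hX
    dsimp only
    induction I with
    | nil => exact Submodule.subset_span ⟨([], i :: J), by simp⟩
    | cons k I ih =>
      rw [List.map_cons, List.prod_cons, mul_assoc, ← mul_assoc, annihilation_creation, sub_mul,
        mul_assoc]
      refine sub_mem ?_ (creation_mul_mem_normalOrderedSpan k ih)
      split_ifs
      · rw [one_mul]
        exact Submodule.subset_span ⟨(I, J), rfl⟩
      · simp
  | zero => simp
  | add X Y _ _ hX hY => rw [mul_add]; exact add_mem hX hY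
  | smul c X _ hX => rw [mul_smul_comm]; exact Submodule.smul_mem _ _ hX

theorem prod_mul_mem_normalOrderedSpan {L : List (Matrix (Finset ι) (Finset ι) ℂ)}
    (hL : ∀ A ∈ L, ∀ X ∈ normalOrderedSpan ι, A * X ∈ normalOrderedSpan ι)
    {X : Matrix (Finset ι) (Finset ι) ℂ} (hX : X ∈ normalOrderedSpan ι) :
    L.prod * X ∈ normalOrderedSpan ι := by
  induction L with
  | nil => simpa using hX
  | cons A L ih =>
    rw [List.prod_cons, mul_assoc]
    exact hL A (by simp) _ (ih fun B hB => hL B (by simp [hB]))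

/-- A product of creation operators produces the state `S` from the vacuum. -/
theorem exists_creation_prod (S : Finset ι) : ∃ (c : ℂ) (L : List ι), c ≠ 0 ∧
    (L.map fun i => (annihilation i)ᴴ).prod *ᵥ occ ∅ = c • occ S := by
  induction S using Finset.induction_on with
  | empty => exact ⟨1, [], one_ne_zero, by simp⟩
  | insert i S hi ih =>
    obtain ⟨c, L, hc, hL⟩ := ih
    refine ⟨c * jwSign i S, i :: L, mul_ne_zero hc ?_, ?_⟩
    · exact pow_ne_zero _ (neg_ne_zero.mpr one_ne_zero)
    · rw [List.map_cons, List.prod_cons, ← Matrix.mulVec_mulVec, hL, Matrix.mulVec_smul,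
        creation_mulVec_occ, if_neg hi, smul_smul]

/-- The projection onto the vacuum. -/
theorem vacuum_projection (l : List ι) :
    (l.map fun i => annihilation i * (annihilation i)ᴴ).prod =
      Matrix.diagonal fun S => if ∀ i ∈ l, i ∉ S then 1 else 0 := by
  induction l with
  | nil => simp
  | cons i l ih =>
    rw [List.map_cons, List.prod_cons, ih]
    have h1 : annihilation i * (annihilation i)ᴴ =
        Matrix.diagonal fun S : Finset ι => if i ∉ S then 1 else 0 := by
      apply ext_of_mulVec_occ
      intro S
      rw [← Matrix.mulVec_mulVec, creation_mulVec_occ]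
      have hd : Matrix.diagonal (fun S : Finset ι => if i ∉ S then (1 : ℂ) else 0) *ᵥ occ S =
          (if i ∉ S then (1 : ℂ) else 0) • occ S := by
        ext T
        rw [Matrix.mulVec_diagonal, Pi.smul_apply, smul_eq_mul, occ, Pi.single_apply]
        by_cases hT : T = S <;> simp [hT]
      rw [hd]
      by_cases h : i ∈ S
      · simp [h]
      · simp [h, Matrix.mulVec_smul, annihilation_mulVec_occ, jwSign_insert, smul_smul,
          jwSign_mul_self]
    rw [h1, Matrix.diagonal_mul_diagonal]
    congr 1
    ext S
    by_cases h : i ∈ S <;> simp [h]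

/-- The matrix unit from `T` to `S` annihilates the modes of `T`, projects onto the vacuum and
creates the modes of `S`. All three factors are products of creation and annihilation operators, and
the span is stable under left multiplication by these. The scalars `c` and `d` are the signs picked
up on the way. -/
theorem mem_normalOrderedSpan (X : Matrix (Finset ι) (Finset ι) ℂ) :
    X ∈ normalOrderedSpan ι := by
  have h1 : (1 : Matrix (Finset ι) (Finset ι) ℂ) ∈ normalOrderedSpan ι :=
    Submodule.subset_span ⟨([], []), by simp⟩
  rw [Matrix.matrix_eq_sum_single X]
  refine Submodule.sum_mem _ fun S _ => Submodule.sum_mem _ fun T _ => ?_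
  obtain ⟨c, L, hc, hL⟩ := exists_creation_prod S
  obtain ⟨d, K, hd, hK⟩ := exists_creation_prod T
  have hL' : ∀ S', (L.map fun i => (annihilation i)ᴴ).prod S' ∅ = (c • occ S) S' := by
    intro S'
    rw [← hL, occ, Matrix.mulVec_single_one]
    rfl
  have hK' : ∀ T', (K.map fun i => (annihilation i)ᴴ).prodᴴ ∅ T' = star ((d • occ T) T') := by
    intro T'
    rw [← hK, occ, Matrix.mulVec_single_one]
    rfl
  have key : Matrix.single S T (X S T) = (X S T / (c * star d)) •
      ((L.map fun i => (annihilation i)ᴴ).prod *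
        ((Finset.univ.toList.map fun i : ι => annihilation i * (annihilation i)ᴴ).prod *
          (((K.map fun i => (annihilation i)ᴴ).prod)ᴴ * 1))) := by
    have hv : (fun S : Finset ι => if ∀ i ∈ (Finset.univ : Finset ι).toList, i ∉ S then
        (1 : ℂ) else 0) = fun S => if S = ∅ then 1 else 0 := by
      ext S
      congr 1
      simp [Finset.eq_empty_iff_forall_notMem]
    rw [vacuum_projection, hv]
    ext S' T'
    rw [Matrix.smul_apply, Matrix.mul_apply, Finset.sum_eq_single ∅]
    · have hs : star d ≠ 0 := star_ne_zero.mpr hd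
      rw [Matrix.diagonal_mul, mul_one, hL', hK']
      simp only [occ, Pi.smul_apply, Pi.single_apply, Matrix.single_apply, smul_eq_mul]
      rcases eq_or_ne S' S with rfl | hS
      · rcases eq_or_ne T' T with rfl | hT
        · simpa using (div_mul_cancel₀ _ (mul_ne_zero hc hs)).symm
        · simp [hT, hT.symm]
      · simp [hS, hS.symm]
    · intro U _ hU
      rw [Matrix.diagonal_mul, if_neg hU]
      simp
    · simp
  rw [key]
  refine Submodule.smul_mem _ _ (prod_mul_mem_normalOrderedSpan ?_
    (prod_mul_mem_normalOrderedSpan ?_ ?_))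
  · intro A hA X hX
    obtain ⟨i, -, rfl⟩ := List.mem_map.mp hA
    exact creation_mul_mem_normalOrderedSpan i hX
  · intro A hA X hX
    obtain ⟨i, -, rfl⟩ := List.mem_map.mp hA
    rw [mul_assoc]
    exact annihilation_mul_mem_normalOrderedSpan i (creation_mul_mem_normalOrderedSpan i hX)
  · rw [Matrix.conjTranspose_list_prod]
    refine prod_mul_mem_normalOrderedSpan ?_ h1
    intro A hA X hX
    simp only [List.map_map, List.mem_reverse, List.mem_map, Function.comp_apply,
      Matrix.conjTranspose_conjTranspose] at hA
    obtain ⟨i, -, rfl⟩ := hA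
    exact annihilation_mul_mem_normalOrderedSpan i hX

theorem fockModel_annihilation (ι : Type*) [LinearOrder ι] [Fintype ι] :
    FockModel (annihilation (ι := ι)) secondQuant (Equiv.refl _) where
  anticomm := annihilation_anticomm
  car := annihilation_creation
  number i S T h := by
    simp only [annihilation, Matrix.of_apply] at h
    split_ifs at h with h'
    · rw [h'.2]
      exact (Finset.card_erase_add_one h'.1).symm
    · exact absurd rfl h
  quant_mul := secondQuant_mul
  quant_diagonal := secondQuant_diagonal
  quant_conjTranspose := secondQuant_conjTranspose
  quant_creation := secondQuant_creation
  separating Δ h := by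
    have hall : ∀ X ∈ normalOrderedSpan ι, (Δ * X).trace = 0 := by
      intro X hX
      induction hX using Submodule.span_induction with
      | mem X hX =>
        obtain ⟨⟨I, J⟩, rfl⟩ := hX
        exact h I J
      | zero => simp
      | add X Y _ _ hX hY => rw [mul_add, Matrix.trace_add, hX, hY, add_zero]
      | smul c X _ hX => rw [mul_smul_comm, Matrix.trace_smul, hX, smul_zero]
    ext S T
    have := hall (Matrix.single T S 1) (mem_normalOrderedSpan _)
    simpa [Matrix.trace_mul_single] using this

end NormalOrdering

variable {ι F : Type*} [Fintype ι] [DecidableEq ι] [Fintype F] [DecidableEq F]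
  {ψ : ι → Matrix F F ℂ} {Γ : Matrix ι ι ℂ → Matrix F F ℂ} {occupied : F ≃ Finset ι}

theorem submatrix_list_prod {F F' : Type*} [Fintype F] [DecidableEq F] [Fintype F']
    [DecidableEq F'] (f : F' ≃ F) (L : List (Matrix F F ℂ)) :
    L.prod.submatrix f f = (L.map fun A => A.submatrix f f).prod := by
  induction L with
  | nil => simp
  | cons A L ih => rw [List.prod_cons, List.map_cons, List.prod_cons, ← ih,
      Matrix.submatrix_mul_equiv]

/-- This transports the model of the ordered sum of the modes of `A` and `B` to the tensor product
of the two Fock spaces. -/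
theorem FockModel.reindex (h : FockModel ψ Γ occupied) {ι' F' : Type*} [Fintype ι']
    [DecidableEq ι'] [Fintype F'] [DecidableEq F'] (e : ι' ≃ ι) (f : F' ≃ F) :
    FockModel (fun i => (ψ (e i)).submatrix f f)
      (fun M => (Γ (M.submatrix e.symm e.symm)).submatrix f f)
      ((f.trans occupied).trans e.symm.finsetCongr) where
  anticomm i j := by
    rw [Matrix.submatrix_mul_equiv, Matrix.submatrix_mul_equiv, h.anticomm, Matrix.submatrix_neg]
    rfl
  car i j := by
    rw [Matrix.conjTranspose_submatrix, Matrix.submatrix_mul_equiv, Matrix.submatrix_mul_equiv,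
      h.car, Matrix.submatrix_sub]
    by_cases hij : i = j <;> simp [hij]
  number i x y hxy := by
    simpa using h.number _ _ _ hxy
  quant_mul M N := by
    rw [Matrix.submatrix_mul_equiv, ← h.quant_mul, Matrix.submatrix_mul_equiv]
  quant_diagonal w := by
    rw [Matrix.submatrix_diagonal_equiv, h.quant_diagonal, Matrix.submatrix_diagonal_equiv]
    congr 1
    ext x
    simp
  quant_conjTranspose M := by
    rw [← Matrix.conjTranspose_submatrix, h.quant_conjTranspose, Matrix.conjTranspose_submatrix]
  quant_creation M i := by
    rw [Matrix.conjTranspose_submatrix, Matrix.submatrix_mul_equiv, h.quant_creation,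
      ← Matrix.submatrix_mul_equiv _ _ f f f]
    congr 1
    rw [← e.sum_comp]
    ext x y
    simp [Matrix.sum_apply]
  separating Δ hΔ := by
    have h0 : Δ.submatrix f.symm f.symm = 0 := by
      apply h.separating
      intro I J
      have h1 := hΔ (I.map e.symm) (J.map e.symm)
      rw [← h1]
      have h2 : ∀ A : Matrix F F ℂ, A.trace = (A.submatrix f f).trace := fun A =>
        (Equiv.sum_comp f fun x => A x x).symm
      rw [h2, ← Matrix.submatrix_mul_equiv _ _ f f f, ← Matrix.submatrix_mul_equiv _ _ f f f,
        submatrix_list_prod, submatrix_list_prod]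
      simp [List.map_map, Function.comp_def]
      rfl
    have h1 := congrArg (fun A => Matrix.submatrix A f f) h0
    simpa using h1

end FockModels

/-! ### Particle number and Wick's theorem -/

section WickTheorem

variable {ι F : Type*} [Fintype ι] [DecidableEq ι] [Fintype F] [DecidableEq F]
  {ψ : ι → Matrix F F ℂ} {Γ : Matrix ι ι ℂ → Matrix F F ℂ} {occupied : F ≃ Finset ι}

/-- `X` changes the quantity `c` by `k`. -/
def ShiftsBy (c : F → ℕ) (k : ℤ) (X : Matrix F F ℂ) : Prop :=
  ∀ x y, X x y ≠ 0 → (c x : ℤ) = c y + k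

theorem ShiftsBy.mul {c : F → ℕ} {k l : ℤ} {X Y : Matrix F F ℂ} (hX : ShiftsBy c k X)
    (hY : ShiftsBy c l Y) : ShiftsBy c (k + l) (X * Y) := by
  intro x y hxy
  rw [Matrix.mul_apply] at hxy
  obtain ⟨z, -, hz⟩ := Finset.exists_ne_zero_of_sum_ne_zero hxy
  have h1 := hX x z (left_ne_zero_of_mul hz)
  have h2 := hY z y (right_ne_zero_of_mul hz)
  omega

theorem shiftsBy_one (c : F → ℕ) : ShiftsBy c 0 (1 : Matrix F F ℂ) := by
  intro x y h
  by_cases hxy : x = y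
  · simp [hxy]
  · simp [hxy] at h

theorem shiftsBy_list_prod {c : F → ℕ} {k : ℤ} {L : List (Matrix F F ℂ)}
    (hL : ∀ A ∈ L, ShiftsBy c k A) : ShiftsBy c (L.length * k) L.prod := by
  induction L with
  | nil => simpa using shiftsBy_one c
  | cons A L ih =>
    rw [List.prod_cons, List.length_cons]
    have h := (hL A (by simp)).mul (ih fun B hB => hL B (by simp [hB]))
    convert h using 1
    push_cast
    ring

theorem ShiftsBy.trace_mul_eq_zero {c : F → ℕ} {k : ℤ} {X Y : Matrix F F ℂ}
    (hX : ShiftsBy c 0 X) (hY : ShiftsBy c k Y) (hk : k ≠ 0) : (X * Y).trace = 0 := by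
  refine Finset.sum_eq_zero fun x _ => ?_
  by_contra h
  have := (hX.mul hY) x x h
  omega

theorem FockModel.shiftsBy_mode (h : FockModel ψ Γ occupied) (i : ι) :
    ShiftsBy (fun x => (occupied x).card) (-1) (ψ i) := by
  intro x y hxy
  have := h.number i x y hxy
  dsimp only
  omega

theorem FockModel.shiftsBy_creation (h : FockModel ψ Γ occupied) (i : ι) :
    ShiftsBy (fun x => (occupied x).card) 1 (ψ i)ᴴ := by
  intro x y hxy
  have := h.number i y x (fun h0 => hxy (by rw [Matrix.conjTranspose_apply, h0, star_zero]))
  dsimp only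
  omega

/-- The scalar matrix 2 commutes with `M`, so `Γ M` commutes with its second quantization
2^(particle number), whose values separate the particle numbers. -/
theorem FockModel.shiftsBy_quant (h : FockModel ψ Γ occupied) (M : Matrix ι ι ℂ) :
    ShiftsBy (fun x => (occupied x).card) 0 (Γ M) := by
  intro x y hxy
  have h1 : Γ (M * Matrix.diagonal fun _ => 2) = Γ (Matrix.diagonal (fun _ => 2) * M) := by
    congr 1
    ext i j
    rw [Matrix.mul_diagonal, Matrix.diagonal_mul, mul_comm]
  rw [h.quant_mul, h.quant_mul, h.quant_diagonal] at h1
  have h2 := congrFun (congrFun h1 x) y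
  rw [Matrix.mul_diagonal, Matrix.diagonal_mul, mul_comm] at h2
  have h3 := mul_left_cancel₀ hxy h2
  simp only [Finset.prod_const] at h3
  have h4 : (2 : ℕ) ^ (occupied x).card = 2 ^ (occupied y).card := by exact_mod_cast h3
  have h5 := Nat.pow_right_injective le_rfl h4
  dsimp only
  omega

/-- The reversed product ends in `ψ (j 0)`, so the creation operator passes the indices 0, …, k - 1
before it is contracted with the index k; this is the sign `(-1) ^ k`. -/
theorem FockModel.annihilations_mul_creation (h : FockModel ψ Γ occupied) (m : ι) :
    ∀ (q : ℕ) (j : Fin (q + 1) → ι),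
      (List.ofFn fun k => ψ (j k)).reverse.prod * (ψ m)ᴴ =
        ∑ k : Fin (q + 1), ((-1) ^ (k : ℕ) * if j k = m then (1 : ℂ) else 0) •
            (List.ofFn fun l => ψ (j (k.succAbove l))).reverse.prod
          + (-1 : ℂ) ^ (q + 1) • ((ψ m)ᴴ * (List.ofFn fun k => ψ (j k)).reverse.prod) := by
  intro q
  induction q with
  | zero =>
    intro j
    simp only [List.ofFn_succ, List.ofFn_zero, List.reverse_cons, List.reverse_nil, List.nil_append,
      List.prod_cons, List.prod_nil, mul_one, h.car, Fin.sum_univ_succ,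
      Finset.univ_eq_empty, Finset.sum_empty, add_zero]
    by_cases hj : j 0 = m <;> simp [hj, sub_eq_add_neg]
  | succ q ih =>
    intro j
    rw [List.ofFn_succ, List.reverse_cons, List.prod_append, List.prod_singleton, mul_assoc, h.car,
      mul_sub, ← mul_assoc, ih fun k => j k.succ, add_mul, Finset.sum_mul, Fin.sum_univ_succ (n := q + 1)]
    have hk : ∀ k : Fin (q + 1),
        (List.ofFn fun l => ψ (j (k.succ.succAbove l))).reverse.prod =
          (List.ofFn fun l => ψ (j (k.succAbove l).succ)).reverse.prod * ψ (j 0) := by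
      intro k
      rw [List.ofFn_succ (n := q)]
      simp
    simp only [hk, smul_mul_assoc, Fin.val_succ, pow_succ, Fin.val_zero, pow_zero, one_mul,
      Fin.succAbove_zero, mul_assoc]
    have hs : ∀ x : Fin (q + 1), ((-1 : ℂ) ^ (x : ℕ) * (-1 * if j x.succ = m then 1 else 0)) •
        ((List.ofFn fun l => ψ (j (x.succAbove l).succ)).reverse.prod * ψ (j 0)) =
        -(((-1 : ℂ) ^ (x : ℕ) * if j x.succ = m then 1 else 0) •
        ((List.ofFn fun l => ψ (j (x.succAbove l).succ)).reverse.prod * ψ (j 0))) := by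
      intro x
      rw [← neg_smul]
      congr 1
      ring
    simp only [hs, Finset.sum_neg_distrib]
    by_cases hj : j 0 = m
    · simp only [hj, if_true, mul_one, one_smul, mul_neg, neg_smul, neg_neg]
      abel
    · simp only [hj, if_false, mul_one, mul_zero, zero_smul, mul_neg, neg_smul, neg_neg]
      abel

theorem FockModel.creations_mul_creation (h : FockModel ψ Γ occupied) (m : ι) (L : List ι) :
    (L.map fun i => (ψ i)ᴴ).prod * (ψ m)ᴴ =
      (-1 : ℂ) ^ L.length • ((ψ m)ᴴ * (L.map fun i => (ψ i)ᴴ).prod) := by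
  induction L with
  | nil => simp
  | cons i L ih =>
    have h1 : (ψ i)ᴴ * (ψ m)ᴴ = -((ψ m)ᴴ * (ψ i)ᴴ) := by
      have := congrArg Matrix.conjTranspose (h.anticomm m i)
      simpa using this
    rw [List.map_cons, List.prod_cons, mul_assoc, ih, mul_smul_comm, ← mul_assoc, h1,
      List.length_cons, pow_succ]
    simp [mul_assoc]

theorem FockModel.trace_monomial_eq_zero (h : FockModel ψ Γ occupied) {ρ : Matrix F F ℂ}
    (hcons : ShiftsBy (fun x => (occupied x).card) 0 ρ) {p q : ℕ} (i : Fin p → ι) (j : Fin q → ι)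
    (hpq : p ≠ q) :
    (ρ * ((List.ofFn fun k => (ψ (i k))ᴴ).prod * (List.ofFn fun k => ψ (j k)).reverse.prod)).trace
      = 0 := by
  have h1 : ShiftsBy (fun x => (occupied x).card) _ (List.ofFn fun k => (ψ (i k))ᴴ).prod :=
    shiftsBy_list_prod (k := 1) fun A hA => by
      obtain ⟨k, rfl⟩ := (List.mem_ofFn' _ _).mp hA
      exact h.shiftsBy_creation _
  have h2 : ShiftsBy (fun x => (occupied x).card) _ (List.ofFn fun k => ψ (j k)).reverse.prod :=
    shiftsBy_list_prod (k := -1) fun A hA => by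
      obtain ⟨k, rfl⟩ := (List.mem_ofFn' _ _).mp (List.mem_reverse.mp hA)
      exact h.shiftsBy_mode _
  refine hcons.trace_mul_eq_zero (h1.mul h2) ?_
  simp only [List.length_ofFn, List.length_reverse]
  omega

/-- **Wick's theorem** for a density matrix that intertwines the creation operators. -/
theorem FockModel.isGaussianState_of_intertwines (h : FockModel ψ Γ occupied) {ρ : Matrix F F ℂ}
    (hpos : ρ.PosSemidef) (htr : ρ.trace = 1)
    (hcons : ShiftsBy (fun x => (occupied x).card) 0 ρ) {W D C : Matrix ι ι ℂ}
    (hint : ∀ i, ρ * (ψ i)ᴴ = (∑ j, W i j • (ψ j)ᴴ) * ρ) (hD : D * (1 + W) = 1)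
    (hC : D * W = C) : IsGaussianState ψ ρ C where
  posSemidef := hpos
  trace_eq_one := htr
  wick_off _ _ i j hpq := h.trace_monomial_eq_zero hcons i j hpq
  wick p := by
    induction p with
    | zero => simp [htr]
    | succ p ih =>
      intro i j
      -- The index of the first creation operator is left free: `g m` is the wanted trace with `i 0`
      -- replaced by `m`, and `t m` collects its contractions with the annihilators. A linear system
      -- for the vector `g` replaces the separate computation of one entry.
      set X := (List.ofFn fun k : Fin p => (ψ (i k.succ))ᴴ).prod *
        (List.ofFn fun k => ψ (j k)).reverse.prod with hX
      set T : Fin (p + 1) → ℂ := fun k => (ρ * ((List.ofFn fun k : Fin p => (ψ (i k.succ))ᴴ).prod *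
        (List.ofFn fun l => ψ (j (k.succAbove l))).reverse.prod)).trace with hT
      set g : ι → ℂ := fun m => (ρ * ((ψ m)ᴴ * X)).trace with hg
      set t : ι → ℂ := fun m => ∑ k : Fin (p + 1), ((-1) ^ (k : ℕ) *
        if j k = m then (1 : ℂ) else 0) * T k with ht
      have hXm : ∀ m, (ρ * (X * (ψ m)ᴴ)).trace = t m - g m := by
        intro m
        have hc := h.creations_mul_creation m (List.ofFn fun k : Fin p => i k.succ)
        rw [List.map_ofFn, List.length_ofFn] at hc
        simp only [Function.comp_def] at hc
        -- Moving `(ψ m)ᴴ` to the front passes p + 1 annihilators and p creation operators, so the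
        -- total sign is odd.
        rw [hX, mul_assoc, h.annihilations_mul_creation, mul_add, mul_smul_comm, ← mul_assoc _ (ψ m)ᴴ,
          hc, smul_mul_assoc, smul_smul, ← pow_add, mul_assoc (ψ m)ᴴ, ← hX,
          Odd.neg_one_pow ⟨p, by ring⟩, mul_add, Matrix.trace_add, mul_smul_comm, Matrix.trace_smul,
          Finset.mul_sum, Finset.mul_sum, Matrix.trace_sum]
        simp only [mul_smul_comm, Matrix.trace_smul, smul_eq_mul, ht, hT, hg]
        ring
      -- Once around the trace: the intertwining relation takes the creation operator to the left of
      -- `ρ`, cyclicity puts it behind `X`, and `hXm` brings it back. So g = W (t - g).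
      have hlin : ∀ m, g m = ∑ l, W m l * (t l - g l) := by
        intro m
        simp only [hg]
        rw [← mul_assoc, hint, mul_assoc, Finset.sum_mul, Matrix.trace_sum]
        refine Finset.sum_congr rfl fun l _ => ?_
        rw [smul_mul_assoc, Matrix.trace_smul, Matrix.trace_mul_comm, mul_assoc, hXm, smul_eq_mul]
      have hvec : (1 + W) *ᵥ g = W *ᵥ t := by
        ext m
        rw [Matrix.add_mulVec, Matrix.one_mulVec, Pi.add_apply]
        simp only [Matrix.mulVec, dotProduct]
        rw [hlin m, ← Finset.sum_add_distrib]
        exact Finset.sum_congr rfl fun l _ => by ring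
      have hsol : g = C *ᵥ t := by
        rw [← hC, ← Matrix.mulVec_mulVec, ← hvec, Matrix.mulVec_mulVec, hD, Matrix.one_mulVec]
      rw [List.ofFn_succ, List.prod_cons, mul_assoc, ← hX]
      change g (i 0) = _
      -- In `C *ᵥ t` only the indices `l = j k` survive, which leaves the expansion of the
      -- determinant along its first row; the minors are given by the induction hypothesis.
      rw [hsol, Matrix.det_succ_row_zero]
      simp only [Matrix.mulVec, dotProduct, ht, Finset.mul_sum]
      rw [Finset.sum_comm]
      refine Finset.sum_congr rfl fun k _ => ?_
      rw [Finset.sum_eq_single (j k)]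
      · rw [if_pos rfl]
        simp only [hT, ih]
        have : (Matrix.of fun k l => C (i k) (j l)).submatrix Fin.succ k.succAbove =
          Matrix.of fun k_1 l => C (i k_1.succ) (j (k.succAbove l)) := rfl
        rw [this, Matrix.of_apply]
        ring
      · intro l _ hl
        rw [if_neg hl.symm]
        ring
      · simp

/-- Wick's theorem determines the state. -/
theorem FockModel.gaussianState_unique (h : FockModel ψ Γ occupied) {ρ ρ' : Matrix F F ℂ}
    {C : Matrix ι ι ℂ} (hρ : IsGaussianState ψ ρ C) (hρ' : IsGaussianState ψ ρ' C) : ρ = ρ' := by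
  rw [← sub_eq_zero]
  apply h.separating
  intro I J
  have hI : (I.map fun i => (ψ i)ᴴ) = List.ofFn fun k : Fin I.length => (ψ (I.get k))ᴴ := by
    conv_lhs => rw [← List.ofFn_get I, List.map_ofFn]
    rfl
  have hJ : J.map ψ = (List.ofFn fun k : Fin J.reverse.length => ψ (J.reverse.get k)).reverse := by
    have h1 : J.reverse.map ψ = List.ofFn fun k => ψ (J.reverse.get k) := by
      conv_lhs => rw [← List.ofFn_get J.reverse, List.map_ofFn]
      rfl
    rw [← h1, ← List.map_reverse, List.reverse_reverse]
  have key : ∀ (p q : ℕ) (i : Fin p → ι) (j : Fin q → ι),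
      (ρ * ((List.ofFn fun k => (ψ (i k))ᴴ).prod *
        (List.ofFn fun k => ψ (j k)).reverse.prod)).trace =
      (ρ' * ((List.ofFn fun k => (ψ (i k))ᴴ).prod *
        (List.ofFn fun k => ψ (j k)).reverse.prod)).trace := by
    intro p q i j
    by_cases hpq : p = q
    · subst hpq
      rw [hρ.wick, hρ'.wick]
    · rw [hρ.wick_off _ _ _ _ hpq, hρ'.wick_off _ _ _ _ hpq]
  rw [hI, hJ, sub_mul, Matrix.trace_sub, sub_eq_zero]
  exact key _ _ _ _

end WickTheorem

/-! ### Gaussian states as second quantizations; the relative entropy -/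

section GaussianStates

variable {ι F : Type*} [Fintype ι] [DecidableEq ι] [Fintype F] [DecidableEq F]
  {ψ : ι → Matrix F F ℂ} {Γ : Matrix ι ι ℂ → Matrix F F ℂ} {occupied : F ≃ Finset ι}

theorem IsGaussianState.correlation_eq {ι F : Type*} [Fintype F] [DecidableEq F]
    {ψ : ι → Matrix F F ℂ} {ρ : Matrix F F ℂ} {C : Matrix ι ι ℂ}
    (hρ : IsGaussianState ψ ρ C) (i j : ι) :
    C i j = (ρ * ((ψ i)ᴴ * ψ j)).trace := by
  have h := hρ.wick 1 (fun _ => i) (fun _ => j)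
  simpa using h.symm

theorem IsGaussianState.correlation_isHermitian {ι F : Type*} [Fintype F] [DecidableEq F]
    {ψ : ι → Matrix F F ℂ} {ρ : Matrix F F ℂ} {C : Matrix ι ι ℂ}
    (hρ : IsGaussianState ψ ρ C) : C.IsHermitian := by
  ext i j
  rw [Matrix.conjTranspose_apply, hρ.correlation_eq, hρ.correlation_eq, ← Matrix.trace_conjTranspose,
    Matrix.conjTranspose_mul, Matrix.conjTranspose_mul, Matrix.conjTranspose_conjTranspose,
    hρ.posSemidef.isHermitian.eq, Matrix.trace_mul_comm]

/-- Writing the form as a trace of a ρ aᴴ with a = Σ x_j ψ_j makes it nonnegative, hence C ≥ 0. The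
companion with aᴴ ρ a yields 1 - C ≥ 0, because the anticommutation relations turn 1 - C into the
matrix of the traces of ρ ψ_j ψ_i†. -/
theorem quadraticForm_eq_trace (ψ : ι → Matrix F F ℂ) (ρ : Matrix F F ℂ) (x : ι → ℂ) :
    star x ⬝ᵥ ((Matrix.of fun i j => (ρ * ((ψ i)ᴴ * ψ j)).trace) *ᵥ x) =
      ((∑ j, x j • ψ j) * ρ * (∑ j, x j • ψ j)ᴴ).trace := by
  rw [mul_assoc, Matrix.trace_mul_comm, mul_assoc, Matrix.conjTranspose_sum, Finset.sum_mul_sum]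
  simp only [Finset.mul_sum, Matrix.trace_sum, dotProduct, Matrix.mulVec, Matrix.of_apply,
    Matrix.conjTranspose_smul, smul_mul_assoc, mul_smul_comm, Matrix.trace_smul, smul_eq_mul,
    Pi.star_apply]
  exact Finset.sum_congr rfl fun i _ => Finset.sum_congr rfl fun j _ => by ring

theorem quadraticForm_eq_trace' (ψ : ι → Matrix F F ℂ) (ρ : Matrix F F ℂ) (x : ι → ℂ) :
    star x ⬝ᵥ ((Matrix.of fun i j => (ρ * (ψ j * (ψ i)ᴴ)).trace) *ᵥ x) =
      ((∑ j, x j • ψ j)ᴴ * ρ * (∑ j, x j • ψ j)).trace := by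
  rw [mul_assoc, Matrix.trace_mul_comm, mul_assoc, Matrix.conjTranspose_sum, Finset.sum_mul_sum]
  simp only [Finset.mul_sum, Matrix.trace_sum, dotProduct, Matrix.mulVec, Matrix.of_apply,
    Matrix.conjTranspose_smul, smul_mul_assoc, mul_smul_comm, Matrix.trace_smul, smul_eq_mul,
    Pi.star_apply]
  rw [Finset.sum_comm]
  exact Finset.sum_congr rfl fun i _ => Finset.sum_congr rfl fun j _ => by ring

theorem IsGaussianState.correlation_posSemidef {ρ : Matrix F F ℂ} {C : Matrix ι ι ℂ}
    (hρ : IsGaussianState ψ ρ C) : C.PosSemidef := by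
  refine Matrix.PosSemidef.of_dotProduct_mulVec_nonneg hρ.correlation_isHermitian fun x => ?_
  have hC : C = Matrix.of fun i j => (ρ * ((ψ i)ᴴ * ψ j)).trace := by
    ext i j
    exact hρ.correlation_eq i j
  rw [hC, quadraticForm_eq_trace]
  exact (hρ.posSemidef.mul_mul_conjTranspose_same _).trace_nonneg

theorem FockModel.one_sub_correlation_posSemidef (h : FockModel ψ Γ occupied) {ρ : Matrix F F ℂ}
    {C : Matrix ι ι ℂ} (hρ : IsGaussianState ψ ρ C) : (1 - C).PosSemidef := by
  refine Matrix.PosSemidef.of_dotProduct_mulVec_nonneg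
    (Matrix.isHermitian_one.sub hρ.correlation_isHermitian) fun x => ?_
  have hC : 1 - C = Matrix.of fun i j => (ρ * (ψ j * (ψ i)ᴴ)).trace := by
    ext i j
    rw [Matrix.sub_apply, hρ.correlation_eq i j, Matrix.of_apply, h.car, mul_sub, Matrix.trace_sub]
    by_cases hij : i = j
    · subst hij
      simp [hρ.trace_eq_one]
    · simp [hij, Ne.symm hij]
  rw [hC, quadraticForm_eq_trace']
  exact (hρ.posSemidef.conjTranspose_mul_mul_same _).trace_nonneg

/-- `C` is the correlation matrix of a state of full rank on the unoccupied side. -/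
structure IsSubunit {ι : Type*} [Fintype ι] [DecidableEq ι] (C : Matrix ι ι ℂ) : Prop where
  posSemidef : C.PosSemidef
  one_sub : (1 - C).PosSemidef
  isUnit : IsUnit (1 - C)

theorem IsSubunit.exists_conjDiag {C : Matrix ι ι ℂ} (hC : IsSubunit C) :
    ∃ (U : Matrix ι ι ℂ) (c : ι → ℝ), U * Uᴴ = 1 ∧ Uᴴ * U = 1 ∧ C = conjDiag U c ∧
      (∀ i, 0 ≤ c i) ∧ (∀ i, c i < 1) ∧ 1 - C = conjDiag U (fun i => 1 - c i) := by
  obtain ⟨U, c, hU1, hU2, hCU, -⟩ := hC.posSemidef.isHermitian.exists_conjDiag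
  have h1 : 1 - C = conjDiag U (fun i => 1 - c i) := by
    rw [conjDiag_sub, conjDiag_one hU1, hCU]
  refine ⟨U, c, hU1, hU2, hCU, ?_, ?_, h1⟩
  · rw [← conjDiag_posSemidef_iff hU2, ← hCU]
    exact hC.posSemidef
  · have h2 := hC.one_sub
    have h3 := (Matrix.isUnit_iff_isUnit_det _).mp hC.isUnit
    rw [h1, conjDiag_posSemidef_iff hU2] at h2
    rw [h1, det_conjDiag hU1] at h3
    intro i
    refine lt_of_le_of_ne (by linarith [h2 i]) fun hi => ?_
    rw [Finset.prod_eq_zero (Finset.mem_univ i) (by rw [hi, sub_self])] at h3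
    simp at h3

theorem oddsMatrix_conjDiag {U : Matrix ι ι ℂ} (hU1 : U * Uᴴ = 1) {c : ι → ℝ}
    (hc : ∀ i, c i < 1) :
    oddsMatrix (conjDiag U c) = conjDiag U (fun i => c i / (1 - c i)) := by
  have hU2 : Uᴴ * U = 1 := mul_eq_one_comm.mp hU1
  have h1 : 1 - conjDiag U c = conjDiag U (fun i => 1 - c i) := by
    rw [conjDiag_sub, conjDiag_one hU1]
  have h2 : (1 - conjDiag U c)⁻¹ = conjDiag U (fun i => (1 - c i)⁻¹) := by
    apply Matrix.inv_eq_right_inv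
    rw [h1, ← conjDiag_mul hU2, ← conjDiag_one hU1]
    congr 1
    ext i
    exact mul_inv_cancel₀ (by linarith [hc i])
  rw [oddsMatrix, h2, ← conjDiag_mul hU2]
  rfl

theorem IsSubunit.oddsMatrix_posSemidef {C : Matrix ι ι ℂ} (hC : IsSubunit C) :
    (oddsMatrix C).PosSemidef := by
  obtain ⟨U, c, hU1, hU2, rfl, h0, h1, -⟩ := hC.exists_conjDiag
  rw [oddsMatrix_conjDiag hU1 h1, conjDiag_posSemidef_iff hU2]
  exact fun i => div_nonneg (h0 i) (by linarith [h1 i])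

/-- These are the two equations required by Wick's theorem, with D = 1 - C and W the odds matrix. -/
theorem IsSubunit.mul_one_add_oddsMatrix {C : Matrix ι ι ℂ} (hC : IsSubunit C) :
    (1 - C) * (1 + oddsMatrix C) = 1 ∧ (1 - C) * oddsMatrix C = C := by
  obtain ⟨U, c, hU1, hU2, hCU, h0, h1, hs⟩ := hC.exists_conjDiag
  have h2 : (1 - C) * oddsMatrix C = C := by
    rw [hs, hCU, oddsMatrix_conjDiag hU1 h1, ← conjDiag_mul hU2]
    congr 1
    ext i
    have : 1 - c i ≠ 0 := by linarith [h1 i]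
    field_simp
  exact ⟨by rw [mul_add, h2, mul_one, sub_add_cancel], h2⟩

theorem FockModel.quant_one (h : FockModel ψ Γ occupied) : Γ 1 = 1 := by
  rw [← Matrix.diagonal_one, h.quant_diagonal]
  simp

/-- Multiplicativity and compatibility with adjoints make second quantization carry an eigenbasis to
an eigenbasis. The eigenbasis is `Γ Uᴴ` and not `Γ U` because products are reversed. -/
theorem FockModel.quant_conjDiag (h : FockModel ψ Γ occupied) {U : Matrix ι ι ℂ}
    (hU : U * Uᴴ = 1) (a : ι → ℝ) :
    Γ Uᴴ * (Γ Uᴴ)ᴴ = 1 ∧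
      Γ (conjDiag U a) = conjDiag (Γ Uᴴ) fun x => ∏ i ∈ occupied x, a i := by
  constructor
  · rw [← h.quant_conjTranspose, Matrix.conjTranspose_conjTranspose, ← h.quant_mul, hU, h.quant_one]
  · rw [conjDiag, h.quant_mul, h.quant_mul, h.quant_diagonal, conjDiag, ← h.quant_conjTranspose,
      Matrix.conjTranspose_conjTranspose, mul_assoc]
    simp only [Complex.ofReal_prod]

theorem FockModel.quant_posSemidef (h : FockModel ψ Γ occupied) {A : Matrix ι ι ℂ}
    (hA : A.PosSemidef) : (Γ A).PosSemidef := by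
  obtain ⟨U, a, hU1, hU2, rfl, -⟩ := hA.isHermitian.exists_conjDiag
  obtain ⟨hV, h1⟩ := h.quant_conjDiag hU1 a
  rw [h1, conjDiag_posSemidef_iff (mul_eq_one_comm.mp hV)]
  rw [conjDiag_posSemidef_iff hU2] at hA
  exact fun x => Finset.prod_nonneg fun i _ => hA i

/-- Real powers are multiplicative on nonnegative numbers, hence on the eigenvalues, which are
products over occupied modes. Zero eigenvalues cause no trouble, so `C` may be singular. -/
theorem FockModel.matPow_smul_quant (h : FockModel ψ Γ occupied) {A : Matrix ι ι ℂ}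
    (hA : A.PosSemidef) {c : ℝ} (hc : 0 ≤ c) (s : ℝ) :
    matPow ((c : ℂ) • Γ A) s = ((c ^ s : ℝ) : ℂ) • Γ (matPow A s) := by
  obtain ⟨U, a, hU1, hU2, rfl, hf⟩ := hA.isHermitian.exists_conjDiag
  rw [conjDiag_posSemidef_iff hU2] at hA
  obtain ⟨hV, h1⟩ := h.quant_conjDiag hU1 a
  rw [matPow, matPow, hf, h1, (h.quant_conjDiag hU1 _).2, ← conjDiag_smul, ← conjDiag_smul,
    cfc_conjDiag hV]
  congr 1
  ext x
  rw [Real.mul_rpow hc (Finset.prod_nonneg fun i _ => hA i), Real.finsetProd_rpow _ _ fun i _ => hA i]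

/-- Summing the products of eigenvalues over all sets of occupied modes is expanding ∏ (1 + a_i). -/
theorem FockModel.trace_quant (h : FockModel ψ Γ occupied) {A : Matrix ι ι ℂ}
    (hA : A.IsHermitian) : (Γ A).trace = (1 + A).det := by
  obtain ⟨U, a, hU1, hU2, rfl, -⟩ := hA.exists_conjDiag
  obtain ⟨hV, h1⟩ := h.quant_conjDiag hU1 a
  rw [h1, trace_conjDiag (mul_eq_one_comm.mp hV), ← conjDiag_one hU1, ← conjDiag_add,
    det_conjDiag hU1, Finset.prod_one_add, Finset.powerset_univ]
  exact congrArg _ (occupied.sum_comp fun S => ∏ i ∈ S, a i)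

/-- The Gaussian state with correlation matrix `C`. -/
theorem FockModel.isGaussianState (h : FockModel ψ Γ occupied) {C : Matrix ι ι ℂ}
    (hC : IsSubunit C) : IsGaussianState ψ (((1 - C).det.re : ℂ) • Γ (oddsMatrix C)) C := by
  obtain ⟨hdpos, hdre, -⟩ := log_det_eq_trace_matLog hC.one_sub hC.isUnit
  obtain ⟨h1, h2⟩ := hC.mul_one_add_oddsMatrix
  refine h.isGaussianState_of_intertwines (W := oddsMatrix C) ?_ ?_ ?_ ?_ h1 h2
  · exact (h.quant_posSemidef hC.oddsMatrix_posSemidef).smul (by exact_mod_cast hdpos.le)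
  · rw [Matrix.trace_smul, h.trace_quant hC.oddsMatrix_posSemidef.isHermitian, smul_eq_mul, ← hdre,
      ← Matrix.det_mul, h1, Matrix.det_one]
  · intro x y hxy
    exact h.shiftsBy_quant _ x y (right_ne_zero_of_mul hxy)
  · intro i
    rw [smul_mul_assoc, h.quant_creation, mul_smul_comm]

/-- Positivity of `ρ` confines `C` to 0 ≤ C ≤ 1, so the explicit state exists; it has the same Wick
values, and these determine the state. -/
theorem FockModel.eq_of_isGaussianState (h : FockModel ψ Γ occupied) {ρ : Matrix F F ℂ}
    {C : Matrix ι ι ℂ} (hρ : IsGaussianState ψ ρ C) (hC : IsUnit (1 - C)) :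
    IsSubunit C ∧ ρ = ((1 - C).det.re : ℂ) • Γ (oddsMatrix C) := by
  have hs : IsSubunit C := ⟨hρ.correlation_posSemidef, h.one_sub_correlation_posSemidef hρ, hC⟩
  exact ⟨hs, h.gaussianState_unique hρ (h.isGaussianState hs)⟩

/-- The `α-z` Rényi relative entropy of two Gaussian states. -/
theorem FockModel.renyiRelEntropy_eq (h : FockModel ψ Γ occupied) {C C' : Matrix ι ι ℂ}
    (hC : IsSubunit C) (hC' : IsSubunit C') {α z : ℝ} (hα : α ≠ 1) (hz : z ≠ 0) :
    renyiRelEntropy α z (((1 - C).det.re : ℂ) • Γ (oddsMatrix C))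
        (((1 - C').det.re : ℂ) • Γ (oddsMatrix C')) =
      - (α * (matLog (1 - C)).trace.re / (1 - α))
        - (matLog (1 - C')).trace.re
        - (matLog (1 + matPow
              (matPow (oddsMatrix C') ((1 - α) / (2 * z))
                * matPow (oddsMatrix C) (α / z)
                * matPow (oddsMatrix C') ((1 - α) / (2 * z))) z)).trace.re
            / (1 - α) := by
  obtain ⟨hd, -, hlog⟩ := log_det_eq_trace_matLog hC.one_sub hC.isUnit
  obtain ⟨hd', -, hlog'⟩ := log_det_eq_trace_matLog hC'.one_sub hC'.isUnit
  set X := matPow (oddsMatrix C') ((1 - α) / (2 * z))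
  set Y := matPow (oddsMatrix C) (α / z)
  set d := (1 - C).det.re
  set d' := (1 - C').det.re
  have hX : X.PosSemidef := matPow_posSemidef hC'.oddsMatrix_posSemidef _
  have hY : Y.PosSemidef := matPow_posSemidef hC.oddsMatrix_posSemidef _
  have hP : (X * Y * X).PosSemidef := mul_mul_posSemidef hX.isHermitian hY
  have hM := matPow_posSemidef hP z
  obtain ⟨hdM, hdM', hlogM⟩ := log_det_eq_trace_matLog
    (Matrix.PosSemidef.one.add hM) (one_add_isUnit hM)
  set k : ℝ := d' ^ ((1 - α) / (2 * z)) * d ^ (α / z) * d' ^ ((1 - α) / (2 * z)) with hk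
  have hkpos : 0 < k := by positivity
  -- The product X Y X is a palindrome, so the reversal of products by `Γ` is harmless. The scalars
  -- gather in `k`, and z log k = (1 - α) log d' + α log d gives the first two terms of the formula.
  have hin : matPow (((d' : ℝ) : ℂ) • Γ (oddsMatrix C')) ((1 - α) / (2 * z)) *
      matPow (((d : ℝ) : ℂ) • Γ (oddsMatrix C)) (α / z) *
      matPow (((d' : ℝ) : ℂ) • Γ (oddsMatrix C')) ((1 - α) / (2 * z)) =
      ((k : ℝ) : ℂ) • Γ (X * Y * X) := by
    rw [h.matPow_smul_quant hC'.oddsMatrix_posSemidef hd'.le,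
      h.matPow_smul_quant hC.oddsMatrix_posSemidef hd.le, h.quant_mul, h.quant_mul,
      smul_mul_smul_comm, smul_mul_smul_comm, hk, mul_assoc (Γ X)]
    push_cast
    rfl
  rw [renyiRelEntropy, hin, h.matPow_smul_quant hP hkpos.le, Matrix.trace_smul,
    h.trace_quant hM.isHermitian, smul_eq_mul, Complex.re_ofReal_mul,
    Real.log_mul (Real.rpow_pos_of_pos hkpos _).ne' hdM.ne', Real.log_rpow hkpos, hlogM, hlog,
    hlog', hk, Real.log_mul (by positivity) (by positivity), Real.log_mul (by positivity) (by positivity),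
    Real.log_rpow hd', Real.log_rpow hd]
  have h1 : 1 - α ≠ 0 := sub_ne_zero.mpr hα.symm
  have h2 : α - 1 ≠ 0 := sub_ne_zero.mpr hα
  have h3 : α - 1 = -(1 - α) := by ring
  rw [h3]
  field_simp
  ring

end GaussianStates

/-! ### Bipartite systems: reduced states and their product -/

section Bipartite

variable {A B : Type*} [Fintype A] [LinearOrder A] [Fintype B] [LinearOrder B]

/-- The occupied modes of a pair of occupation number states. -/
def pairOcc (A B : Type*) : Finset A × Finset B ≃ Finset (A ⊕ₗ B) :=
  (Finset.sumEquiv.symm.toEquiv).trans toLex.finsetCongr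

theorem inl_mem_pairOcc {S : Finset A} {T : Finset B} {a : A} :
    toLex (Sum.inl a) ∈ pairOcc A B (S, T) ↔ a ∈ S := by
  simp [pairOcc]

theorem inr_mem_pairOcc {S : Finset A} {T : Finset B} {b : B} :
    toLex (Sum.inr b) ∈ pairOcc A B (S, T) ↔ b ∈ T := by
  simp [pairOcc]

theorem card_pairOcc (S : Finset A) (T : Finset B) :
    (pairOcc A B (S, T)).card = S.card + T.card := by
  simp [pairOcc]

theorem lex_sum_ext {X Y : Finset (A ⊕ₗ B)}
    (hl : ∀ a : A, toLex (Sum.inl a) ∈ X ↔ toLex (Sum.inl a) ∈ Y)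
    (hr : ∀ b : B, toLex (Sum.inr b) ∈ X ↔ toLex (Sum.inr b) ∈ Y) : X = Y := by
  ext x
  obtain ⟨x, rfl⟩ := toLex.surjective x
  rcases x with a | b
  · exact hl a
  · exact hr b

theorem pairOcc_erase_inl [DecidableEq (A ⊕ₗ B)] (S : Finset A) (T : Finset B) (a : A) :
    (pairOcc A B (S, T)).erase (toLex (Sum.inl a)) = pairOcc A B (S.erase a, T) := by
  apply lex_sum_ext <;> intro x <;> simp [inl_mem_pairOcc, inr_mem_pairOcc]

theorem pairOcc_erase_inr [DecidableEq (A ⊕ₗ B)] (S : Finset A) (T : Finset B) (b : B) :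
    (pairOcc A B (S, T)).erase (toLex (Sum.inr b)) = pairOcc A B (S, T.erase b) := by
  apply lex_sum_ext <;> intro x <;> simp [inl_mem_pairOcc, inr_mem_pairOcc]

theorem pairOcc_filter_inl (S : Finset A) (T : Finset B) (a : A) :
    (pairOcc A B (S, T)).filter (· < toLex (Sum.inl a)) =
      pairOcc A B (S.filter (· < a), ∅) := by
  apply lex_sum_ext <;> intro x <;> simp [inl_mem_pairOcc, inr_mem_pairOcc]

theorem pairOcc_filter_inr (S : Finset A) (T : Finset B) (b : B) :
    (pairOcc A B (S, T)).filter (· < toLex (Sum.inr b)) =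
      pairOcc A B (S, T.filter (· < b)) := by
  apply lex_sum_ext <;> intro x <;> simp [inl_mem_pairOcc, inr_mem_pairOcc]

/-- In the lexicographic order all modes of `A` precede those of `B`. The sign of a mode of `B`
therefore counts every occupied mode of `A`, and this is the parity factor. -/
theorem mode_eq_submatrix (i : A ⊕ B) :
    mode i = (annihilation (toLex i)).submatrix (pairOcc A B) (pairOcc A B) := by
  ext ⟨S, T⟩ ⟨S', T'⟩
  rw [Matrix.submatrix_apply]
  simp only [annihilation, Matrix.of_apply]
  rcases i with a | b
  · simp only [pairOcc_erase_inl, pairOcc_filter_inl, inl_mem_pairOcc, card_pairOcc, mode,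
      Matrix.kroneckerMap_apply, annihilation, Matrix.of_apply, Matrix.one_apply,
      (pairOcc A B).apply_eq_iff_eq, Prod.mk.injEq, Finset.card_empty, add_zero]
    by_cases hT : T = T' <;> simp [hT]
  · simp only [pairOcc_erase_inr, pairOcc_filter_inr, inr_mem_pairOcc, card_pairOcc, mode,
      Matrix.kroneckerMap_apply, annihilation, Matrix.of_apply, parity, Matrix.diagonal_apply,
      (pairOcc A B).apply_eq_iff_eq, Prod.mk.injEq]
    by_cases hS : S = S' <;> simp [hS, pow_add]

variable (A B) in
theorem exists_fockModel_mode : ∃ (Γ : Matrix (A ⊕ B) (A ⊕ B) ℂ →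
      Matrix (Finset A × Finset B) (Finset A × Finset B) ℂ)
    (occupied : Finset A × Finset B ≃ Finset (A ⊕ B)),
    FockModel (mode (A := A) (B := B)) Γ occupied ∧
      ∀ x, (occupied x).card = x.1.card + x.2.card := by
  have h := (fockModel_annihilation (A ⊕ₗ B)).reindex (toLex (α := A ⊕ B)) (pairOcc A B)
  have hm : (mode (A := A) (B := B)) =
      fun i => (annihilation (toLex i)).submatrix (pairOcc A B) (pairOcc A B) :=
    funext mode_eq_submatrix
  rw [← hm] at h
  exact ⟨_, _, by convert h, fun x => by simp [← card_pairOcc]⟩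

theorem trace_reduceA_mul {F G : Type*} [Fintype F] [DecidableEq F] [Fintype G] [DecidableEq G]
    (ρ : Matrix (F × G) (F × G) ℂ) (X : Matrix F F ℂ) :
    (reduceA ρ * X).trace = (ρ * (X ⊗ₖ (1 : Matrix G G ℂ))).trace := by
  simp only [Matrix.trace, Matrix.diag, Matrix.mul_apply, reduceA, Matrix.of_apply,
    Fintype.sum_prod_type, Matrix.kroneckerMap_apply, Matrix.one_apply, mul_ite, mul_one, mul_zero,
    Finset.sum_ite_eq', Finset.mem_univ, if_true, Finset.sum_mul]
  refine Finset.sum_congr rfl fun x _ => ?_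
  rw [Finset.sum_comm]

theorem trace_reduceB_mul {F G : Type*} [Fintype F] [DecidableEq F] [Fintype G] [DecidableEq G]
    (ρ : Matrix (F × G) (F × G) ℂ) (X : Matrix G G ℂ) :
    (reduceB ρ * X).trace = (ρ * ((1 : Matrix F F ℂ) ⊗ₖ X)).trace := by
  have h1 : ∀ S T, ∑ x : F × G, ρ (S, T) x * ((1 : Matrix F F ℂ) ⊗ₖ X) x (S, T) =
      ∑ T', ρ (S, T) (S, T') * X T' T := by
    intro S T
    rw [Fintype.sum_prod_type, Finset.sum_eq_single S]
    · simp
    · intro S' _ hS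
      simp [hS]
    · simp
  simp only [Matrix.trace, Matrix.diag, Matrix.mul_apply, reduceB, Matrix.of_apply, h1,
    Finset.sum_mul]
  rw [Fintype.sum_prod_type, Finset.sum_comm (s := (Finset.univ : Finset F))]
  exact Finset.sum_congr rfl fun T _ => Finset.sum_comm

theorem reduceA_posSemidef {F G : Type*} [Fintype F] [Fintype G]
    {ρ : Matrix (F × G) (F × G) ℂ} (h : ρ.PosSemidef) : (reduceA ρ).PosSemidef := by
  have : reduceA ρ = ∑ T, ρ.submatrix (fun S => (S, T)) (fun S => (S, T)) := by
    ext S S'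
    simp [reduceA, Matrix.sum_apply]
  rw [this]
  exact Matrix.posSemidef_sum _ fun T _ => h.submatrix _

theorem reduceB_posSemidef {F G : Type*} [Fintype F] [Fintype G]
    {ρ : Matrix (F × G) (F × G) ℂ} (h : ρ.PosSemidef) : (reduceB ρ).PosSemidef := by
  have : reduceB ρ = ∑ S, ρ.submatrix (fun T => (S, T)) (fun T => (S, T)) := by
    ext T T'
    simp [reduceB, Matrix.sum_apply]
  rw [this]
  exact Matrix.posSemidef_sum _ fun T _ => h.submatrix _

theorem kronecker_list_prod_one {F G : Type*} [Fintype F] [DecidableEq F] [Fintype G]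
    [DecidableEq G] (L : List (Matrix F F ℂ)) :
    (L.map fun X => X ⊗ₖ (1 : Matrix G G ℂ)).prod = L.prod ⊗ₖ (1 : Matrix G G ℂ) := by
  induction L with
  | nil => simp
  | cons X L ih =>
    rw [List.map_cons, List.prod_cons, ih, List.prod_cons, ← Matrix.mul_kronecker_mul, one_mul]

theorem kronecker_list_prod {F G : Type*} [Fintype F] [DecidableEq F] [Fintype G]
    [DecidableEq G] (P : Matrix F F ℂ) (L : List (Matrix G G ℂ)) :
    (L.map fun X => P ⊗ₖ X).prod = (P ^ L.length) ⊗ₖ L.prod := by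
  induction L with
  | nil => simp
  | cons X L ih =>
    rw [List.map_cons, List.prod_cons, ih, List.prod_cons, ← Matrix.mul_kronecker_mul,
      List.length_cons, pow_succ']

theorem parity_isHermitian (A : Type*) [DecidableEq A] : (parity A)ᴴ = parity A := by
  rw [parity, Matrix.diagonal_conjTranspose]
  congr 1
  ext S
  simp

theorem parity_mul_self (A : Type*) [Fintype A] [DecidableEq A] : parity A * parity A = 1 := by
  rw [parity, Matrix.diagonal_mul_diagonal, ← Matrix.diagonal_one]
  congr 1
  ext S
  rw [← mul_pow]
  simp

theorem mode_inl_conjTranspose (a : A) :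
    (mode (A := A) (B := B) (Sum.inl a))ᴴ = (annihilation a)ᴴ ⊗ₖ 1 := by
  rw [mode, Matrix.conjTranspose_kronecker, Matrix.conjTranspose_one]

theorem mode_inr_conjTranspose (b : B) :
    (mode (A := A) (B := B) (Sum.inr b))ᴴ = parity A ⊗ₖ (annihilation b)ᴴ := by
  rw [mode, Matrix.conjTranspose_kronecker, parity_isHermitian]

/-- The modes of `A` act as ψ ⊗ 1, so correlation functions of the reduced state are correlation
functions of `ρ`. -/
theorem isGaussianState_reduceA
    {ρ : Matrix (Finset A × Finset B) (Finset A × Finset B) ℂ} {C : Matrix (A ⊕ B) (A ⊕ B) ℂ}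
    (hρ : IsGaussianState mode ρ C) :
    IsGaussianState annihilation (reduceA ρ) C.toBlocks₁₁ := by
  have key : ∀ {p q : ℕ} (i : Fin p → A) (j : Fin q → A),
      (reduceA ρ * ((List.ofFn fun k => (annihilation (i k))ᴴ).prod *
        (List.ofFn fun k => annihilation (j k)).reverse.prod)).trace =
      (ρ * ((List.ofFn fun k => (mode (Sum.inl (i k)))ᴴ).prod *
        (List.ofFn fun k => mode (Sum.inl (j k))).reverse.prod)).trace := by
    intro p q i j
    rw [trace_reduceA_mul, ← mul_one (1 : Matrix (Finset B) (Finset B) ℂ),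
      Matrix.mul_kronecker_mul, ← kronecker_list_prod_one, ← kronecker_list_prod_one,
      List.map_reverse, List.map_ofFn, List.map_ofFn]
    simp only [mode_inl_conjTranspose, Function.comp_def]
    rfl
  refine ⟨reduceA_posSemidef hρ.posSemidef, ?_, fun p i j => ?_, fun p q i j hpq => ?_⟩
  · rw [← mul_one (reduceA ρ), trace_reduceA_mul, Matrix.one_kronecker_one, mul_one,
      hρ.trace_eq_one]
  · rw [key, hρ.wick]
    rfl
  · rw [key, hρ.wick_off _ _ _ _ hpq]

/-- Here each mode carries a parity factor. In a monomial with p creation and p annihilation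
operators the factors cancel, since parity squares to 1. In an unbalanced monomial they may not, so
its expectation is shown to vanish by conservation of the particle number instead. -/
theorem isGaussianState_reduceB
    {ρ : Matrix (Finset A × Finset B) (Finset A × Finset B) ℂ} {C : Matrix (A ⊕ B) (A ⊕ B) ℂ}
    (hρ : IsGaussianState mode ρ C)
    (hcons : ShiftsBy (fun x : Finset A × Finset B => x.1.card + x.2.card) 0 ρ) :
    IsGaussianState annihilation (reduceB ρ) C.toBlocks₂₂ := by
  have key : ∀ {p : ℕ} (i : Fin p → B) (j : Fin p → B),
      (reduceB ρ * ((List.ofFn fun k => (annihilation (i k))ᴴ).prod *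
        (List.ofFn fun k => annihilation (j k)).reverse.prod)).trace =
      (ρ * ((List.ofFn fun k => (mode (Sum.inr (i k)))ᴴ).prod *
        (List.ofFn fun k => mode (Sum.inr (j k))).reverse.prod)).trace := by
    intro p i j
    have hp : parity A ^ p * parity A ^ p = 1 := by
      rw [← (Commute.refl (parity A)).mul_pow, parity_mul_self, one_pow]
    have h1 := kronecker_list_prod (parity A) (List.ofFn fun k => (annihilation (i k))ᴴ)
    have h2 := kronecker_list_prod (parity A) (List.ofFn fun k => annihilation (j k)).reverse
    rw [List.length_ofFn] at h1
    rw [List.length_reverse, List.length_ofFn] at h2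
    rw [trace_reduceB_mul, ← hp, Matrix.mul_kronecker_mul, ← h1, ← h2, List.map_reverse,
      List.map_ofFn, List.map_ofFn]
    simp only [mode_inr_conjTranspose, Function.comp_def]
    rfl
  refine ⟨reduceB_posSemidef hρ.posSemidef, ?_, fun p i j => ?_, fun p q i j hpq => ?_⟩
  · rw [← mul_one (reduceB ρ), trace_reduceB_mul, Matrix.one_kronecker_one, mul_one,
      hρ.trace_eq_one]
  · rw [key, hρ.wick]
    rfl
  · refine (fockModel_annihilation B).trace_monomial_eq_zero ?_ i j hpq
    intro T T' hT
    obtain ⟨S, -, hS⟩ := Finset.exists_ne_zero_of_sum_ne_zero hT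
    have := hcons _ _ hS
    simpa using this

theorem parity_comm {A : Type*} [Fintype A] [DecidableEq A] {X : Matrix (Finset A) (Finset A) ℂ}
    (hX : ShiftsBy Finset.card 0 X) : X * parity A = parity A * X := by
  ext S T
  rw [parity, Matrix.mul_diagonal, Matrix.diagonal_mul]
  by_cases h : X S T = 0
  · simp [h]
  · have := hX S T h
    have hc : S.card = T.card := by omega
    rw [hc, mul_comm]

theorem IsSubunit.submatrix {ι κ : Type*} [Fintype ι] [DecidableEq ι] [Fintype κ] [DecidableEq κ]
    {C : Matrix ι ι ℂ} (hC : IsSubunit C) {f : κ → ι} (hf : Function.Injective f) :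
    IsSubunit (C.submatrix f f) := by
  have h1 : (1 - C).PosDef := (hC.one_sub.posDef_iff_isUnit).mpr hC.isUnit
  have h2 : 1 - C.submatrix f f = (1 - C).submatrix f f := by
    rw [Matrix.submatrix_sub, ← Matrix.submatrix_one f hf]
    rfl
  have h3 := h1.submatrix hf
  rw [← h2] at h3
  exact ⟨hC.posSemidef.submatrix f, h3.posSemidef, h3.isUnit⟩

/-- The product of the reduced states of a Gaussian state is Gaussian, and the Rényi mutual
information is given by the correlation matrix. -/
theorem gaussianState_renyiMutualInfo
    {ρ : Matrix (Finset A × Finset B) (Finset A × Finset B) ℂ} {C : Matrix (A ⊕ B) (A ⊕ B) ℂ}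
    (hρ : IsGaussianState mode ρ C) (hu : IsUnit (1 - C)) :
    IsGaussianState mode (reduceA ρ ⊗ₖ reduceB ρ) (blockDiagPart C) ∧
      ∀ α z : ℝ, α ≠ 1 → z ≠ 0 →
        renyiMutualInfo α z ρ =
          - (α * (matLog (1 - C)).trace.re / (1 - α))
            - (matLog (1 - blockDiagPart C)).trace.re
            - (matLog (1 + matPow
                  (matPow (oddsMatrix (blockDiagPart C)) ((1 - α) / (2 * z))
                    * matPow (oddsMatrix C) (α / z)
                    * matPow (oddsMatrix (blockDiagPart C)) ((1 - α) / (2 * z))) z)).trace.re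
                / (1 - α) := by
  obtain ⟨Γ, occupied, h, hcard⟩ := exists_fockModel_mode A B
  obtain ⟨hC, hρeq⟩ := h.eq_of_isGaussianState hρ hu
  have hcons : ShiftsBy (fun x : Finset A × Finset B => x.1.card + x.2.card) 0 ρ := by
    intro x y hxy
    rw [hρeq] at hxy
    have := h.shiftsBy_quant _ x y (right_ne_zero_of_mul hxy)
    simpa [hcard] using this
  have hCA : IsSubunit C.toBlocks₁₁ := hC.submatrix Sum.inl_injective
  have hCB : IsSubunit C.toBlocks₂₂ := hC.submatrix Sum.inr_injective
  have hgA := isGaussianState_reduceA hρ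
  have hgB := isGaussianState_reduceB hρ hcons
  have mA := fockModel_annihilation A
  have mB := fockModel_annihilation B
  have hA := (mA.eq_of_isGaussianState hgA hCA.isUnit).2
  have hB := (mB.eq_of_isGaussianState hgB hCB.isUnit).2
  have hsA : ShiftsBy Finset.card 0 (reduceA ρ) := by
    intro S T hST
    rw [hA] at hST
    exact mA.shiftsBy_quant _ S T (right_ne_zero_of_mul hST)
  have hsB : ShiftsBy Finset.card 0 (reduceB ρ) := by
    intro S T hST
    rw [hB] at hST
    exact mB.shiftsBy_quant _ S T (right_ne_zero_of_mul hST)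
  have hiA : ∀ a, reduceA ρ * (annihilation a)ᴴ =
      (∑ j, oddsMatrix C.toBlocks₁₁ a j • (annihilation j)ᴴ) * reduceA ρ := by
    intro a
    rw [hA, smul_mul_assoc, mA.quant_creation, mul_smul_comm]
  have hiB : ∀ b, reduceB ρ * (annihilation b)ᴴ =
      (∑ j, oddsMatrix C.toBlocks₂₂ b j • (annihilation j)ᴴ) * reduceB ρ := by
    intro b
    rw [hB, smul_mul_assoc, mB.quant_creation, mul_smul_comm]
  -- The reduced states intertwine with the odds matrices of the two diagonal blocks of `C`, so
  -- their product intertwines with this `W`. Wick's theorem asks only for the two equations with D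
  -- = 1 - C', which can be checked blockwise.
  set W := Matrix.fromBlocks (oddsMatrix C.toBlocks₁₁) 0 0 (oddsMatrix C.toBlocks₂₂) with hW
  have hD : 1 - blockDiagPart C =
      Matrix.fromBlocks (1 - C.toBlocks₁₁) 0 0 (1 - C.toBlocks₂₂) := by
    rw [blockDiagPart, ← Matrix.fromBlocks_one, sub_eq_add_neg, Matrix.fromBlocks_neg,
      Matrix.fromBlocks_add]
    simp [sub_eq_add_neg]
  have hDW : (1 - blockDiagPart C) * (1 + W) = 1 := by
    rw [hD, hW, ← Matrix.fromBlocks_one, Matrix.fromBlocks_add, Matrix.fromBlocks_multiply]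
    simp [hCA.mul_one_add_oddsMatrix.1, hCB.mul_one_add_oddsMatrix.1]
  have hg : IsGaussianState mode (reduceA ρ ⊗ₖ reduceB ρ) (blockDiagPart C) := by
    refine h.isGaussianState_of_intertwines (W := W) (hgA.posSemidef.kronecker hgB.posSemidef)
      ?_ ?_ ?_ hDW ?_
    · rw [Matrix.trace_kronecker, hgA.trace_eq_one, hgB.trace_eq_one, one_mul]
    · intro x y hxy
      have h1 := hsA _ _ (left_ne_zero_of_mul hxy)
      have h2 := hsB _ _ (right_ne_zero_of_mul hxy)
      simp only [hcard]
      push_cast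
      omega
    · rintro (a | b)
      · rw [mode_inl_conjTranspose, ← Matrix.mul_kronecker_mul, hiA, mul_one, Fintype.sum_sum_type]
        simp only [hW, Matrix.fromBlocks_apply₁₁, Matrix.fromBlocks_apply₁₂, Matrix.zero_apply,
          zero_smul, Finset.sum_const_zero, add_zero, mode_inl_conjTranspose, Finset.sum_mul,
          smul_mul_assoc, ← Matrix.mul_kronecker_mul, one_mul, ← Matrix.smul_kronecker]
        ext x y
        simp [Matrix.sum_apply, Finset.sum_mul]
      -- A mode of `B` brings a parity operator on `A`, which must pass the reduced state of `A`; it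
      -- does because that state conserves the particle number.
      · rw [mode_inr_conjTranspose, ← Matrix.mul_kronecker_mul, hiB, parity_comm hsA,
          Fintype.sum_sum_type]
        simp only [hW, Matrix.fromBlocks_apply₂₁, Matrix.fromBlocks_apply₂₂, Matrix.zero_apply,
          zero_smul, Finset.sum_const_zero, zero_add, mode_inr_conjTranspose, Finset.sum_mul,
          smul_mul_assoc, ← Matrix.mul_kronecker_mul, ← Matrix.kronecker_smul]
        ext x y
        simp [Matrix.sum_apply, Finset.mul_sum]
    · rw [hD, hW, Matrix.fromBlocks_multiply]
      simp [hCA.mul_one_add_oddsMatrix.2, hCB.mul_one_add_oddsMatrix.2, blockDiagPart]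
  have hu' : IsUnit (1 - blockDiagPart C) := IsUnit.of_mul_eq_one _ hDW
  obtain ⟨hC', hσ⟩ := h.eq_of_isGaussianState hg hu'
  refine ⟨hg, fun α z hα hz => ?_⟩
  rw [renyiMutualInfo, hσ, hρeq]
  exact h.renyiRelEntropy_eq hC hC' hα hz

end Bipartite

/-! ### Approximate exponential and logarithm of real numbers -/

section ScalarApproximations

/-- The approximation `(1 + y h) ^ (2 ^ K)` of `exp y`, for `h = 2 ^ (-K)`. -/
noncomputable def expApprox (K : ℕ) (y : ℝ) : ℝ := (1 + y * (1 / 2) ^ K) ^ (2 ^ K)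

/-- An approximate Newton step for the solution `y` of `exp y = x`. -/
noncomputable def logStep (K : ℕ) (x y : ℝ) : ℝ := y - 1 + x * expApprox K (-y)

/-- The approximation of `log x` by `K` Newton steps starting at `Y`. -/
noncomputable def logApprox (K : ℕ) (Y x : ℝ) : ℝ := (logStep K x)^[K] Y

/-- The approximation equals exp(2^K log(1 + t)) with t = y/2^K, and t - 2t² ≤ log(1 + t) ≤ t for
|t| ≤ 1/4. Keeping the error `θ` in the exponent makes it a relative error with a known sign. -/
theorem expApprox_eq_exp {K : ℕ} {B y : ℝ} (hB : 1 ≤ B) (hy : |y| ≤ B)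
    (hK : 2 * B ^ 2 * (1 / 2) ^ K ≤ 1 / 2) :
    ∃ θ, 0 ≤ θ ∧ θ ≤ 2 * B ^ 2 * (1 / 2) ^ K ∧ expApprox K y = Real.exp (y - θ) := by
  set h : ℝ := (1 / 2) ^ K with hh
  have hpos : 0 < h := by positivity
  have hh2 : (2 : ℝ) ^ K * h = 1 := by rw [hh, ← mul_pow]; norm_num
  set t := y * h with ht
  have hBh : B * h ≤ 1 / 4 := by nlinarith [mul_le_mul_of_nonneg_right hB hpos.le]
  have htabs : |t| ≤ 1 / 4 := by
    rw [ht, abs_mul, abs_of_pos hpos]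
    exact (mul_le_mul_of_nonneg_right hy hpos.le).trans hBh
  have ht1 := (abs_le.mp htabs).1
  have ht2 := (abs_le.mp htabs).2
  have h1t : 0 < 1 + t := by linarith
  have hup : Real.log (1 + t) ≤ t := by linarith [Real.log_le_sub_one_of_pos h1t]
  have hlow : t - 2 * t ^ 2 ≤ Real.log (1 + t) := by
    have h1 := Real.one_sub_inv_le_log_of_pos h1t
    have h2 : t - 2 * t ^ 2 ≤ 1 - (1 + t)⁻¹ := by
      have : 1 - (1 + t)⁻¹ = t / (1 + t) := by field_simp; ring
      rw [this, le_div_iff₀ h1t]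
      nlinarith [sq_nonneg t]
    linarith
  have hyt : y = 2 ^ K * t := by rw [ht]; linear_combination (-y) * hh2
  have ht2B : 2 ^ K * (2 * t ^ 2) ≤ 2 * B ^ 2 * h := by
    have e1 : 2 ^ K * (2 * t ^ 2) = 2 * y ^ 2 * h := by
      rw [ht]; linear_combination (2 * y ^ 2 * h) * hh2
    rw [e1]
    have : y ^ 2 ≤ B ^ 2 := sq_le_sq' (by linarith [(abs_le.mp hy).1]) (abs_le.mp hy).2
    nlinarith
  refine ⟨y - 2 ^ K * Real.log (1 + t), ?_, ?_, ?_⟩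
  · have : 2 ^ K * Real.log (1 + t) ≤ 2 ^ K * t := by gcongr
    linarith
  · have : 2 ^ K * (t - 2 * t ^ 2) ≤ 2 ^ K * Real.log (1 + t) := by gcongr
    linarith
  · rw [sub_sub_cancel, expApprox, ← hh, ← ht, show (2 : ℝ) ^ K = ((2 ^ K : ℕ) : ℝ) by push_cast; rfl,
      Real.exp_nat_mul, Real.exp_log h1t]

/-- The parameters `K`, `Y` guarantee the accuracy `ε`. -/
structure Accurate (K : ℕ) (Y ε : ℝ) : Prop where
  one_le : 1 ≤ Y
  exp_le : 2 * (3 * Y + 1) ^ 2 * (1 / 2) ^ K ≤ ε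
  log_le : 2 * Y * (2 * Y / (1 + 2 * Y)) ^ K ≤ ε
  le_half : ε ≤ 1 / 2

theorem Accurate.expApprox {K : ℕ} {Y ε : ℝ} (h : Accurate K Y ε) {y : ℝ} (hy : |y| ≤ 3 * Y + 1) :
    ∃ θ, 0 ≤ θ ∧ θ ≤ ε ∧ expApprox K y = Real.exp (y - θ) := by
  obtain ⟨θ, h0, h1, h2⟩ := expApprox_eq_exp (B := 3 * Y + 1) (by linarith [h.one_le]) hy
    (h.exp_le.trans h.le_half)
  exact ⟨θ, h0, h1.trans h.exp_le, h2⟩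

/-- A step turns the error d = y - log x into d - 1 + exp(-d - θ). By e^u ≥ 1 + u this is at least
-θ, and by e^(-d) ≤ 1/(1 + d) it is at most d · d/(1 + d). While 0 < d ≤ 2Y, the error shrinks by
the factor c = 2Y/(1 + 2Y). Once -ε ≤ d ≤ 0, the bound d²/(1 + d) ≤ ε follows from ε ≤ 1/2. The
start Y lies above log x by at most 2Y. -/
theorem Accurate.logApprox {K : ℕ} {Y ε : ℝ} (h : Accurate K Y ε) {x : ℝ} (hx : 0 < x)
    (hY : |Real.log x| ≤ Y) : |logApprox K Y x - Real.log x| ≤ ε := by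
  have hY1 := h.one_le
  have hε := h.le_half
  have hε0 : 0 ≤ ε := le_trans (by positivity) h.exp_le
  obtain ⟨hl1, hl2⟩ := abs_le.mp hY
  set c := 2 * Y / (1 + 2 * Y) with hc
  have hc0 : 0 ≤ c := by positivity
  have hc1 : c ≤ 1 := by rw [hc, div_le_one (by positivity)]; linarith
  have key : ∀ k : ℕ, -ε ≤ (logStep K x)^[k] Y - Real.log x ∧
      (logStep K x)^[k] Y - Real.log x ≤ max ε (2 * Y * c ^ k) := by
    intro k
    induction k with
    | zero => exact ⟨by simp; linarith, by simp; right; linarith⟩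
    | succ k ih =>
      rw [Function.iterate_succ_apply']
      set y := (logStep K x)^[k] Y
      set d := y - Real.log x with hd
      obtain ⟨ih1, ih2⟩ := ih
      have hck : c ^ k ≤ 1 := pow_le_one₀ hc0 hc1
      have hdY : d ≤ 2 * Y := ih2.trans (max_le (by linarith) (by nlinarith))
      obtain ⟨θ, hθ0, hθ1, hθ⟩ := h.expApprox (y := -y) (by rw [abs_le]; constructor <;> linarith)
      have hstep : logStep K x y - Real.log x = d - 1 + Real.exp (-d - θ) := by
        rw [logStep, hθ]
        have : x * Real.exp (-y - θ) = Real.exp (-d - θ) := by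
          nth_rewrite 1 [← Real.exp_log hx]
          rw [← Real.exp_add]
          congr 1
          rw [hd]
          ring
        rw [this, hd]
        ring
      rw [hstep]
      have hd1 : 0 < 1 + d := by linarith
      constructor
      · linarith [Real.add_one_le_exp (-d - θ)]
      · have h1 : Real.exp (-d - θ) ≤ (1 + d)⁻¹ := by
          calc Real.exp (-d - θ) ≤ Real.exp (-d) := Real.exp_le_exp.mpr (by linarith)
            _ = (Real.exp d)⁻¹ := Real.exp_neg d
            _ ≤ (1 + d)⁻¹ := by
              apply inv_anti₀ hd1
              linarith [Real.add_one_le_exp d]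
        have h2 : d - 1 + (1 + d)⁻¹ = d * (d / (1 + d)) := by field_simp; ring
        have h3 : d - 1 + Real.exp (-d - θ) ≤ d * (d / (1 + d)) := by linarith
        refine h3.trans ?_
        rcases le_or_gt d 0 with hneg | hpos
        · refine le_max_of_le_left ?_
          rw [← mul_div_assoc, div_le_iff₀ hd1]
          nlinarith
        · have hdc : d / (1 + d) ≤ c := by
            rw [hc, div_le_div_iff₀ hd1 (by positivity)]
            nlinarith
          calc d * (d / (1 + d)) ≤ max ε (2 * Y * c ^ k) * c := by gcongr
            _ = max (ε * c) (2 * Y * c ^ (k + 1)) := by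
              rw [max_mul_of_nonneg _ _ hc0, pow_succ, mul_assoc (2 * Y)]
            _ ≤ max ε (2 * Y * c ^ (k + 1)) := max_le_max (by nlinarith) le_rfl
  obtain ⟨h1, h2⟩ := key K
  exact abs_le.mpr ⟨h1, h2.trans (max_le le_rfl h.log_le)⟩

/-- For b ≤ a one has 1 + e^a ≤ e^(a - b) (1 + e^b). Thus log(1 + p^z) is as stable as its exponent
z log p, however large p^z is. -/
theorem abs_log_one_add_exp_sub_le (a b : ℝ) :
    |Real.log (1 + Real.exp a) - Real.log (1 + Real.exp b)| ≤ |a - b| := by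
  wlog hab : b ≤ a generalizing a b
  · rw [abs_sub_comm, abs_sub_comm a]
    exact this b a (le_of_not_ge hab)
  have h1 : 0 < 1 + Real.exp a := by positivity
  have h2 : 0 < 1 + Real.exp b := by positivity
  have h3 : Real.log (1 + Real.exp b) ≤ Real.log (1 + Real.exp a) :=
    Real.log_le_log h2 (by linarith [Real.exp_le_exp.mpr hab])
  rw [abs_of_nonneg (sub_nonneg.mpr h3), abs_of_nonneg (sub_nonneg.mpr hab), sub_le_iff_le_add,
    ← Real.log_exp (a - b), ← Real.log_mul (Real.exp_pos _).ne' h2.ne']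
  apply Real.log_le_log h1
  rw [mul_add, ← Real.exp_add, sub_add_cancel]
  linarith [Real.one_le_exp (sub_nonneg.mpr hab)]

/-- Approximation of `(x / (1 - x)) ^ s`. -/
theorem Accurate.odds_rpow {K : ℕ} {Y ε : ℝ} (h : Accurate K Y ε) {x s : ℝ} (hx0 : 0 < x)
    (hx1 : x < 1) (hl0 : |Real.log x| ≤ Y) (hl1 : |Real.log (1 - x)| ≤ Y)
    (hs : |s| * |Real.log x - Real.log (1 - x)| + 2 * |s| ≤ 3 * Y + 1) :
    ∃ τ, |τ| ≤ (2 * |s| + 1) * ε ∧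
      _root_.expApprox K (s * (_root_.logApprox K Y x - _root_.logApprox K Y (1 - x))) =
        (x / (1 - x)) ^ s * Real.exp τ := by
  have e0 := h.logApprox hx0 hl0
  have e1 := h.logApprox (sub_pos.mpr hx1) hl1
  have hε := h.le_half
  set l0 := _root_.logApprox K Y x
  set l1 := _root_.logApprox K Y (1 - x)
  have hdiff : |s * (l0 - l1) - s * (Real.log x - Real.log (1 - x))| ≤ |s| * (2 * ε) := by
    rw [← mul_sub, abs_mul]
    gcongr
    rw [show l0 - l1 - (Real.log x - Real.log (1 - x)) =
      (l0 - Real.log x) - (l1 - Real.log (1 - x)) by ring]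
    exact (abs_sub _ _).trans (by linarith)
  obtain ⟨θ, hθ0, hθ1, hθ⟩ := h.expApprox (y := s * (l0 - l1)) (by
    have := abs_sub_abs_le_abs_sub (s * (l0 - l1)) (s * (Real.log x - Real.log (1 - x)))
    rw [abs_mul s (Real.log x - _)] at this
    nlinarith [abs_nonneg s])
  refine ⟨s * (l0 - l1) - s * (Real.log x - Real.log (1 - x)) - θ, ?_, ?_⟩
  · refine (abs_sub _ _).trans ?_
    rw [abs_of_nonneg hθ0]
    linarith
  · rw [hθ, Real.rpow_def_of_pos (div_pos hx0 (sub_pos.mpr hx1)),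
      Real.log_div hx0.ne' (sub_pos.mpr hx1).ne', ← Real.exp_add]
    congr 1
    ring

/-- Approximation of `log (1 + p ^ z)`. -/
theorem Accurate.log_one_add_rpow {K : ℕ} {Y ε : ℝ} (h : Accurate K Y ε) {p z : ℝ} (hp : 0 < p)
    (hl : |Real.log p| ≤ Y) (hz : |z| * |Real.log p| + |z| + 2 ≤ Y) :
    |_root_.logApprox K Y (1 + _root_.expApprox K (z * _root_.logApprox K Y p)) -
      Real.log (1 + p ^ z)| ≤ (|z| + 2) * ε := by
  have e0 := h.logApprox hp hl
  have hε := h.le_half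
  set l := _root_.logApprox K Y p
  have hdiff : |z * l - z * Real.log p| ≤ |z| * ε := by
    rw [← mul_sub, abs_mul]
    gcongr
  have hzl : |z * l| ≤ |z| * |Real.log p| + |z| := by
    have := abs_sub_abs_le_abs_sub (z * l) (z * Real.log p)
    rw [abs_mul z (Real.log p)] at this
    nlinarith [abs_nonneg z]
  obtain ⟨θ, hθ0, hθ1, hθ⟩ := h.expApprox (y := z * l) (by linarith [h.one_le])
  rw [hθ]
  have hpz : p ^ z = Real.exp (z * Real.log p) := by
    rw [Real.rpow_def_of_pos hp, mul_comm]
  have h1 : 0 < 1 + Real.exp (z * l - θ) := by positivity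
  have h2 := h.logApprox h1 (by
    have h0 : 0 ≤ Real.log (1 + Real.exp (z * l - θ)) :=
      Real.log_nonneg (by linarith [Real.exp_pos (z * l - θ)])
    rw [abs_of_nonneg h0]
    have h3 := abs_log_one_add_exp_sub_le (z * l - θ) 0
    rw [sub_zero, Real.exp_zero] at h3
    have h4 : Real.log (1 + 1) ≤ 1 := by
      have := Real.log_le_sub_one_of_pos (show (0 : ℝ) < 1 + 1 by norm_num)
      linarith
    have h5 := (abs_le.mp h3).2
    have h6 : |z * l - θ| ≤ |z * l| + θ := (abs_sub _ _).trans (by rw [abs_of_nonneg hθ0])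
    linarith)
  have h3 := abs_log_one_add_exp_sub_le (z * l - θ) (z * Real.log p)
  rw [hpz]
  have h4 : |z * l - θ - z * Real.log p| ≤ |z| * ε + ε := by
    rw [sub_right_comm]
    refine (abs_sub _ _).trans ?_
    rw [abs_of_nonneg hθ0]
    linarith
  have h5 := abs_sub_le (_root_.logApprox K Y (1 + Real.exp (z * l - θ)))
    (Real.log (1 + Real.exp (z * l - θ))) (Real.log (1 + Real.exp (z * Real.log p)))
  linarith

/-- The number `(1 + 2Y)(12Y + 4d + 5)` of steps gives the accuracy `exp (-(6Y + 4d + 2))`. -/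
theorem accurate_of_le {K : ℕ} {Y d : ℝ} (hY : 1 ≤ Y) (hd : 0 ≤ d)
    (hK : (1 + 2 * Y) * (12 * Y + 4 * d + 5) ≤ K) :
    Accurate K Y (Real.exp (-(6 * Y + 4 * d + 2))) where
  one_le := hY
  exp_le := by
    have h1 : 3 * Y + 1 ≤ Real.exp (3 * Y + 1) := by linarith [Real.add_one_le_exp (3 * Y + 1)]
    have h2 : (2 : ℝ) ≤ Real.exp 1 := by linarith [Real.add_one_le_exp (1 : ℝ)]
    have h3 : ((1 / 2 : ℝ)) ^ K ≤ Real.exp (-(K / 2)) := by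
      have h5 : (1 / 2 : ℝ) ≤ Real.exp (-(1 / 2)) := by linarith [Real.add_one_le_exp (-(1 / 2) : ℝ)]
      calc (1 / 2 : ℝ) ^ K ≤ Real.exp (-(1 / 2)) ^ K := by gcongr
        _ = Real.exp (-(K / 2)) := by
          rw [← Real.exp_nat_mul]
          congr 1
          ring
    calc 2 * (3 * Y + 1) ^ 2 * (1 / 2) ^ K
        ≤ Real.exp 1 * Real.exp (3 * Y + 1) ^ 2 * Real.exp (-(K / 2)) := by gcongr
      _ = Real.exp (1 + 2 * (3 * Y + 1) - K / 2) := by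
        rw [← Real.exp_nat_mul, ← Real.exp_add, ← Real.exp_add]
        congr 1
      _ ≤ _ := by
        -- What is needed is 12Y + 4d + 5 ≤ K/2, and this is the origin of that number; the factor 1
        -- + 2Y ≥ 3 leaves room.
        apply Real.exp_le_exp.mpr
        nlinarith
  log_le := by
    have h1 : 2 * Y ≤ Real.exp (2 * Y) := by linarith [Real.add_one_le_exp (2 * Y)]
    -- The contraction factor is 1 - 1/(1 + 2Y), so about 1 + 2Y steps gain one unit in the
    -- exponent. Hence the factor 1 + 2Y in the bound on `K`.
    have h2 : 2 * Y / (1 + 2 * Y) ≤ Real.exp (-(1 / (1 + 2 * Y))) := by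
      have := Real.add_one_le_exp (-(1 / (1 + 2 * Y)))
      have e : 2 * Y / (1 + 2 * Y) = -(1 / (1 + 2 * Y)) + 1 := by field_simp; ring
      linarith
    calc 2 * Y * (2 * Y / (1 + 2 * Y)) ^ K
        ≤ Real.exp (2 * Y) * Real.exp (-(1 / (1 + 2 * Y))) ^ K := by gcongr
      _ = Real.exp (2 * Y - K / (1 + 2 * Y)) := by
        rw [← Real.exp_nat_mul, ← Real.exp_add]
        congr 1
        ring
      _ ≤ _ := by
        apply Real.exp_le_exp.mpr
        have : 12 * Y + 4 * d + 5 ≤ K / (1 + 2 * Y) := by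
          rw [le_div_iff₀ (by positivity)]
          linarith
        linarith
  le_half := by
    have h2 : (2 : ℝ) ≤ Real.exp 1 := by linarith [Real.add_one_le_exp (1 : ℝ)]
    calc Real.exp (-(6 * Y + 4 * d + 2)) ≤ Real.exp (-1) := Real.exp_le_exp.mpr (by linarith)
      _ = (Real.exp 1)⁻¹ := Real.exp_neg 1
      _ ≤ 1 / 2 := by rw [one_div]; exact inv_anti₀ (by norm_num) h2

end ScalarApproximations

/-! ### Perturbation bounds in the Frobenius norm -/

section FrobeniusEstimates

attribute [local instance] Matrix.frobeniusNormedAddCommGroup Matrix.frobeniusNormedRing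
  Matrix.frobeniusNormedSpace

variable {m : Type*} [Fintype m] [DecidableEq m]

theorem frobenius_norm_sq (A : Matrix m m ℂ) : ‖A‖ ^ 2 = ∑ i, ∑ j, ‖A i j‖ ^ 2 := by
  rw [Matrix.frobenius_norm_def, ← Real.sqrt_eq_rpow, Real.sq_sqrt (by positivity)]
  norm_cast

theorem frobenius_norm_sq_eq_trace (A : Matrix m m ℂ) : ((‖A‖ ^ 2 : ℝ) : ℂ) = (A * Aᴴ).trace := by
  rw [frobenius_norm_sq]
  push_cast
  refine Finset.sum_congr rfl fun i _ => ?_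
  rw [Matrix.diag_apply, Matrix.mul_apply]
  refine Finset.sum_congr rfl fun j _ => ?_
  rw [Matrix.conjTranspose_apply, Complex.star_def, Complex.mul_conj, Complex.normSq_eq_norm_sq]
  push_cast
  rfl

theorem frobenius_norm_unitary_mul {U : Matrix m m ℂ} (hU : Uᴴ * U = 1) (A : Matrix m m ℂ) :
    ‖U * A‖ = ‖A‖ := by
  have h : ((‖U * A‖ ^ 2 : ℝ) : ℂ) = ((‖A‖ ^ 2 : ℝ) : ℂ) := by
    rw [frobenius_norm_sq_eq_trace, frobenius_norm_sq_eq_trace, Matrix.conjTranspose_mul,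
      Matrix.trace_mul_comm, mul_assoc, ← mul_assoc Uᴴ, hU, one_mul, Matrix.trace_mul_comm]
  exact (sq_eq_sq₀ (norm_nonneg _) (norm_nonneg _)).mp (Complex.ofReal_injective h)

theorem frobenius_norm_mul_unitary {U : Matrix m m ℂ} (hU : U * Uᴴ = 1) (A : Matrix m m ℂ) :
    ‖A * U‖ = ‖A‖ := by
  have h : ((‖A * U‖ ^ 2 : ℝ) : ℂ) = ((‖A‖ ^ 2 : ℝ) : ℂ) := by
    rw [frobenius_norm_sq_eq_trace, frobenius_norm_sq_eq_trace, Matrix.conjTranspose_mul,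
      mul_assoc, ← mul_assoc U, hU, one_mul]
  exact (sq_eq_sq₀ (norm_nonneg _) (norm_nonneg _)).mp (Complex.ofReal_injective h)

/-- The norm is unitarily invariant. Multiplying by `Uᴴ` on the left and by `V` on the right turns
the difference into the matrix with entries (a i - b j) times the overlap. Functions of the two
matrices then have the same weights, and Lipschitz bounds can be applied entry by entry. -/
theorem frobenius_norm_conjDiag_sub_sq {U V : Matrix m m ℂ} (hU : Uᴴ * U = 1) (hV : Vᴴ * V = 1)
    (a b : m → ℝ) :
    ‖conjDiag U a - conjDiag V b‖ ^ 2 = ∑ i, ∑ j, (a i - b j) ^ 2 * ‖(Uᴴ * V) i j‖ ^ 2 := by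
  have hU' : U * Uᴴ = 1 := mul_eq_one_comm.mp hU
  have h1 : ‖conjDiag U a - conjDiag V b‖ = ‖Uᴴ * ((conjDiag U a - conjDiag V b) * V)‖ := by
    rw [frobenius_norm_unitary_mul (by rw [Matrix.conjTranspose_conjTranspose]; exact hU'),
      frobenius_norm_mul_unitary (mul_eq_one_comm.mp hV)]
  have h2 : Uᴴ * ((conjDiag U a - conjDiag V b) * V) =
      Matrix.diagonal (fun i => (a i : ℂ)) * (Uᴴ * V) -
        (Uᴴ * V) * Matrix.diagonal (fun i => (b i : ℂ)) := by
    have e1 : Uᴴ * (conjDiag U a * V) = (Uᴴ * U) * (Matrix.diagonal (fun i => (a i : ℂ)) *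
        (Uᴴ * V)) := by simp only [conjDiag, mul_assoc]
    have e2 : Uᴴ * (conjDiag V b * V) = (Uᴴ * V) * Matrix.diagonal (fun i => (b i : ℂ)) *
        (Vᴴ * V) := by simp only [conjDiag, mul_assoc]
    rw [sub_mul, mul_sub, e1, e2, hU, hV, one_mul, mul_one]
  rw [h1, h2, frobenius_norm_sq]
  refine Finset.sum_congr rfl fun i _ => Finset.sum_congr rfl fun j _ => ?_
  rw [Matrix.sub_apply, Matrix.diagonal_mul, Matrix.mul_diagonal, mul_comm _ (b j : ℂ), ← sub_mul,
    norm_mul, mul_pow, ← Complex.ofReal_sub, Complex.norm_real, Real.norm_eq_abs, sq_abs]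

/-- Functions of Hermitian matrices inherit Lipschitz bounds in the Frobenius norm. -/
theorem frobenius_norm_conjDiag_sub_le {U V : Matrix m m ℂ} (hU : Uᴴ * U = 1) (hV : Vᴴ * V = 1)
    {a b : m → ℝ} {f : ℝ → ℝ} {L : ℝ} (hL : 0 ≤ L)
    (hf : ∀ i j, |f (a i) - f (b j)| ≤ L * |a i - b j|) :
    ‖conjDiag U (fun i => f (a i)) - conjDiag V (fun j => f (b j))‖ ≤
      L * ‖conjDiag U a - conjDiag V b‖ := by
  refine (sq_le_sq₀ (norm_nonneg _) (by positivity)).mp ?_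
  rw [mul_pow, frobenius_norm_conjDiag_sub_sq hU hV, frobenius_norm_conjDiag_sub_sq hU hV,
    Finset.mul_sum]
  refine Finset.sum_le_sum fun i _ => ?_
  rw [Finset.mul_sum]
  refine Finset.sum_le_sum fun j _ => ?_
  rw [← mul_assoc]
  refine mul_le_mul_of_nonneg_right ?_ (by positivity)
  rw [← mul_pow, ← sq_abs, ← sq_abs (L * _), abs_mul, abs_of_nonneg hL]
  exact pow_le_pow_left₀ (abs_nonneg _) (hf i j) 2

theorem frobenius_norm_conjDiag_le {U : Matrix m m ℂ} (hU : Uᴴ * U = 1) {a : m → ℝ} {B : ℝ}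
    (ha : ∀ i, |a i| ≤ B) : ‖conjDiag U a‖ ≤ Fintype.card m * B := by
  have hU' : U * Uᴴ = 1 := mul_eq_one_comm.mp hU
  have h1 : ‖conjDiag U a‖ = ‖Matrix.diagonal fun i => (a i : ℂ)‖ := by
    rw [conjDiag, frobenius_norm_mul_unitary (by rw [Matrix.conjTranspose_conjTranspose]; exact hU),
      frobenius_norm_unitary_mul hU]
  have h2 : Matrix.diagonal (fun i => (a i : ℂ)) = ∑ i, Matrix.single i i (a i : ℂ) := by
    rw [Matrix.matrix_eq_sum_single (Matrix.diagonal fun i => (a i : ℂ))]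
    refine Finset.sum_congr rfl fun i _ => ?_
    rw [Finset.sum_eq_single i]
    · simp
    · intro j _ hj
      simp [hj.symm]
    · simp
  have h3 : ∀ i, ‖Matrix.single i i (a i : ℂ)‖ ≤ B := by
    intro i
    refine le_trans (le_of_eq ?_) (ha i)
    refine (sq_eq_sq₀ (norm_nonneg _) (abs_nonneg _)).mp ?_
    rw [frobenius_norm_sq, Finset.sum_eq_single i, Finset.sum_eq_single i]
    · simp
    · intro j _ hj
      simp [hj.symm]
    · simp
    · intro j _ hj
      simp [Matrix.single, hj.symm]
    · simp
  rw [h1, h2]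
  calc _ ≤ ∑ i, ‖Matrix.single i i (a i : ℂ)‖ := norm_sum_le _ _
    _ ≤ ∑ _i : m, B := Finset.sum_le_sum fun i _ => h3 i
    _ = _ := by simp

theorem abs_trace_re_le (A : Matrix m m ℂ) : |A.trace.re| ≤ Fintype.card m * ‖A‖ := by
  have h1 : ∀ i, ‖A i i‖ ≤ ‖A‖ := by
    intro i
    refine (sq_le_sq₀ (norm_nonneg _) (norm_nonneg _)).mp ?_
    rw [frobenius_norm_sq]
    refine le_trans ?_ (Finset.single_le_sum (f := fun i => ∑ j, ‖A i j‖ ^ 2)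
      (fun i _ => by positivity) (Finset.mem_univ i))
    exact Finset.single_le_sum (f := fun j => ‖A i j‖ ^ 2) (fun j _ => by positivity)
      (Finset.mem_univ i)
  calc |A.trace.re| ≤ ‖A.trace‖ := Complex.abs_re_le_norm _
    _ ≤ ∑ i, ‖A i i‖ := norm_sum_le _ _
    _ ≤ ∑ _i : m, ‖A‖ := Finset.sum_le_sum fun i _ => h1 i
    _ = _ := by simp

/-- The difference telescopes into three products, each with one differing factor. -/
theorem frobenius_norm_triple_sub_le {X X' Y Y' : Matrix m m ℂ} {B δ : ℝ} (hB : 0 ≤ B)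
    (hX : ‖X‖ ≤ B) (hX' : ‖X'‖ ≤ B) (hY : ‖Y‖ ≤ B) (hY' : ‖Y'‖ ≤ B)
    (hdX : ‖X' - X‖ ≤ δ) (hdY : ‖Y' - Y‖ ≤ δ) :
    ‖X' * Y' * X' - X * Y * X‖ ≤ 3 * B ^ 2 * δ := by
  have h0 : 0 ≤ δ := (norm_nonneg _).trans hdX
  have e : X' * Y' * X' - X * Y * X =
      (X' - X) * Y' * X' + X * (Y' - Y) * X' + X * Y * (X' - X) := by noncomm_ring
  have hm : ∀ A B' C : Matrix m m ℂ, ‖A * B' * C‖ ≤ ‖A‖ * ‖B'‖ * ‖C‖ := fun A B' C =>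
    (norm_mul_le _ _).trans (mul_le_mul_of_nonneg_right (norm_mul_le _ _) (norm_nonneg _))
  rw [e]
  calc _ ≤ ‖(X' - X) * Y' * X'‖ + ‖X * (Y' - Y) * X'‖ + ‖X * Y * (X' - X)‖ := norm_add₃_le
    _ ≤ δ * B * B + B * δ * B + B * B * δ := by
      refine add_le_add (add_le_add ((hm _ _ _).trans ?_) ((hm _ _ _).trans ?_))
        ((hm _ _ _).trans ?_) <;> gcongr
    _ = _ := by ring

end FrobeniusEstimates

/-! ### The iterations on matrices -/

section MatrixAlgorithm

variable {m : Type*} [Fintype m] [DecidableEq m]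

/-- Repeated squaring. -/
def sqIter (K : ℕ) (E : Matrix m m ℂ) : Matrix m m ℂ := (fun E => E * E)^[K] E

/-- One step of the Newton iteration for the logarithm of `X`. -/
def logIterStep (K : ℕ) (h : ℝ) (X L : Matrix m m ℂ) : Matrix m m ℂ :=
  L - 1 + X * sqIter K (1 + ((-h : ℝ) : ℂ) • L)

/-- The Newton iteration for the logarithm of `X`. -/
def logIter (K : ℕ) (h Y : ℝ) (X : Matrix m m ℂ) : Matrix m m ℂ :=
  (logIterStep K h X)^[K] ((Y : ℂ) • 1)

/-- The approximation of `exp (c L)` by repeated squaring. -/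
def expIter (K : ℕ) (c : ℝ) (L : Matrix m m ℂ) : Matrix m m ℂ := sqIter K (1 + (c : ℂ) • L)

/-- The approximation of `X ^ s Y ^ r X ^ s` for the odds matrices `X` of `C'` and `Y` of `C`. -/
def sandwichIter (K : ℕ) (h Y s r : ℝ) (C C' : Matrix m m ℂ) : Matrix m m ℂ :=
  expIter K (s * h) (logIter K h Y C' - logIter K h Y (1 - C')) *
    expIter K (r * h) (logIter K h Y C - logIter K h Y (1 - C)) *
    expIter K (s * h) (logIter K h Y C' - logIter K h Y (1 - C'))

/-- The approximate Rényi mutual information. -/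
def renyiIter (K : ℕ) (h Y s r z u w : ℝ) (C C' : Matrix m m ℂ) : ℝ :=
  -(u * (logIter K h Y (1 - C)).trace.re) - (logIter K h Y (1 - C')).trace.re
    - w * (logIter K h Y
      (1 + expIter K (z * h) (logIter K h Y (sandwichIter K h Y s r C C')))).trace.re

theorem sqIter_conjDiag {U : Matrix m m ℂ} (hU : Uᴴ * U = 1) (K : ℕ) (a : m → ℝ) :
    sqIter K (conjDiag U a) = conjDiag U fun i => a i ^ 2 ^ K := by
  induction K generalizing a with
  | zero => simp [sqIter]
  | succ K ih =>
    have : sqIter (K + 1) (conjDiag U a) = sqIter K (conjDiag U a * conjDiag U a) := rfl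
    rw [this, ← conjDiag_mul hU, ih]
    congr 1
    ext i
    rw [← sq, ← pow_mul, pow_succ']

theorem expIter_conjDiag {U : Matrix m m ℂ} (hU : U * Uᴴ = 1) (K : ℕ) (c : ℝ) (a : m → ℝ) :
    expIter K (c * (1 / 2) ^ K) (conjDiag U a) = conjDiag U fun i => expApprox K (c * a i) := by
  rw [expIter, ← conjDiag_smul, ← conjDiag_one hU, ← conjDiag_add,
    sqIter_conjDiag (mul_eq_one_comm.mp hU)]
  congr 1
  ext i
  rw [expApprox]
  ring_nf

/-- Every iterate is a real polynomial in the matrix, so it stays diagonal in the given eigenbasis.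
The eigenbasis appears only in the analysis; the algorithm never computes it. -/
theorem logIter_conjDiag {U : Matrix m m ℂ} (hU : U * Uᴴ = 1) (K : ℕ) (Y : ℝ) (a : m → ℝ) :
    logIter K ((1 / 2) ^ K) Y (conjDiag U a) = conjDiag U fun i => logApprox K Y (a i) := by
  have hU2 : Uᴴ * U = 1 := mul_eq_one_comm.mp hU
  have hstep : ∀ l : m → ℝ, logIterStep K ((1 / 2) ^ K) (conjDiag U a) (conjDiag U l) =
      conjDiag U fun i => logStep K (a i) (l i) := by
    intro l
    have h1 := expIter_conjDiag hU K (-1) l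
    rw [neg_one_mul] at h1
    simp only [neg_one_mul] at h1
    rw [expIter] at h1
    rw [logIterStep, h1, ← conjDiag_mul hU2, ← conjDiag_one hU, ← conjDiag_sub, ← conjDiag_add]
    rfl
  have hiter : ∀ k : ℕ, (logIterStep K ((1 / 2) ^ K) (conjDiag U a))^[k] ((Y : ℂ) • 1) =
      conjDiag U fun i => (logStep K (a i))^[k] Y := by
    intro k
    induction k with
    | zero =>
      rw [Function.iterate_zero_apply, ← conjDiag_one hU, ← conjDiag_smul]
      simp
    | succ k ih =>
      rw [Function.iterate_succ_apply', ih, hstep]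
      simp only [Function.iterate_succ_apply']
  exact hiter K

theorem one_sub_conjDiag {U : Matrix m m ℂ} (hU : U * Uᴴ = 1) (a : m → ℝ) :
    1 - conjDiag U a = conjDiag U fun i => 1 - a i := by
  rw [conjDiag_sub, conjDiag_one hU]

theorem one_add_conjDiag {U : Matrix m m ℂ} (hU : U * Uᴴ = 1) (a : m → ℝ) :
    1 + conjDiag U a = conjDiag U fun i => 1 + a i := by
  rw [conjDiag_add, conjDiag_one hU]

/-- Bounds for the eigenvalues of `X Y X`. -/
theorem eigenvalue_bounds_sandwich {U V Q : Matrix m m ℂ} (hU : U * Uᴴ = 1) (hV : V * Vᴴ = 1)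
    (hQ : Q * Qᴴ = 1) {x y p : m → ℝ} {a : ℝ}
    (hx : ∀ i, Real.exp (-a) ≤ x i ∧ x i ≤ Real.exp a)
    (hy : ∀ i, Real.exp (-a) ≤ y i ∧ y i ≤ Real.exp a)
    (hP : conjDiag U x * conjDiag V y * conjDiag U x = conjDiag Q p) :
    ∀ i, Real.exp (-(3 * a)) ≤ p i ∧ p i ≤ Real.exp (3 * a) := by
  have hU2 : Uᴴ * U = 1 := mul_eq_one_comm.mp hU
  have hV2 : Vᴴ * V = 1 := mul_eq_one_comm.mp hV
  have hQ2 : Qᴴ * Q = 1 := mul_eq_one_comm.mp hQ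
  have hconst : ∀ (W : Matrix m m ℂ), W * Wᴴ = 1 → ∀ c : ℝ, conjDiag W (fun _ => c) = (c : ℂ) • 1 := by
    intro W hW c
    rw [← conjDiag_one hW, ← conjDiag_smul]
    simp
  have hX := conjDiag_isHermitian U x
  have e3 : Real.exp (-(3 * a)) = Real.exp (-a) * (Real.exp (-a) * Real.exp (-a)) := by
    rw [← Real.exp_add, ← Real.exp_add]
    ring_nf
  have e3' : Real.exp (3 * a) = Real.exp a * (Real.exp a * Real.exp a) := by
    rw [← Real.exp_add, ← Real.exp_add]
    ring_nf
  -- The identity is X (Y - c) X + c (X² - c²) = XYX - c³. For c = exp(-a) both summands on the left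
  -- are positive semidefinite, for c = exp a both are negative semidefinite; this bounds the
  -- spectrum of XYX by c³.
  have key : ∀ c : ℝ, conjDiag U x * conjDiag V (fun i => y i - c) * conjDiag U x +
      (c : ℂ) • conjDiag U (fun i => x i * x i - c * c) =
      conjDiag Q (fun i => p i - c * (c * c)) := by
    intro c
    rw [conjDiag_sub, hconst V hV, conjDiag_sub, hconst U hU, conjDiag_sub, hconst Q hQ, ← hP,
      conjDiag_mul hU2]
    simp only [mul_sub, sub_mul, mul_smul_comm, smul_mul_assoc, mul_one, smul_sub, smul_smul]
    push_cast
    abel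
  have h1 : (conjDiag Q (fun i => p i - Real.exp (-a) * (Real.exp (-a) * Real.exp (-a)))).PosSemidef := by
    rw [← key]
    refine (mul_mul_posSemidef hX ?_).add (Matrix.PosSemidef.smul ?_ ?_)
    · rw [conjDiag_posSemidef_iff hV2]
      exact fun i => sub_nonneg.mpr (hy i).1
    · rw [conjDiag_posSemidef_iff hU2]
      exact fun i => sub_nonneg.mpr (mul_self_le_mul_self (Real.exp_pos _).le (hx i).1)
    · exact_mod_cast (Real.exp_pos _).le
  have h2 : (-conjDiag Q (fun i => p i - Real.exp a * (Real.exp a * Real.exp a))).PosSemidef := by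
    have hneg : ∀ (W : Matrix m m ℂ) (c : m → ℝ), -conjDiag W c = conjDiag W fun i => -c i := by
      intro W c
      have := conjDiag_smul W (-1) c
      simp only [neg_one_mul] at this
      rw [this]
      simp
    rw [← key, neg_add, ← smul_neg, hneg U, ← neg_mul, ← mul_neg, hneg V]
    refine (mul_mul_posSemidef hX ?_).add (Matrix.PosSemidef.smul ?_ ?_)
    · rw [conjDiag_posSemidef_iff hV2]
      exact fun i => by linarith [(hy i).2]
    · rw [conjDiag_posSemidef_iff hU2]
      intro i
      have := mul_self_le_mul_self ((Real.exp_pos _).le.trans (hx i).1) (hx i).2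
      linarith
    · exact_mod_cast (Real.exp_pos _).le
  rw [conjDiag_posSemidef_iff hQ2] at h1
  have h2' : (conjDiag Q (fun i => Real.exp a * (Real.exp a * Real.exp a) - p i)).PosSemidef := by
    convert h2 using 1
    rw [conjDiag_sub, conjDiag_sub, neg_sub]
  rw [conjDiag_posSemidef_iff hQ2] at h2'
  intro i
  rw [e3, e3']
  exact ⟨by linarith [h1 i], by linarith [h2' i]⟩

theorem abs_log_sub_log_le {x y a : ℝ} (hx : Real.exp (-a) ≤ x) (hy : Real.exp (-a) ≤ y) :
    |Real.log x - Real.log y| ≤ Real.exp a * |x - y| := by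
  wlog hxy : y ≤ x generalizing x y
  · rw [abs_sub_comm, abs_sub_comm x]
    exact this hy hx (le_of_not_ge hxy)
  have hy0 : 0 < y := (Real.exp_pos _).trans_le hy
  have hx0 : 0 < x := (Real.exp_pos _).trans_le hx
  rw [abs_of_nonneg (sub_nonneg.mpr (Real.log_le_log hy0 hxy)), abs_of_nonneg (sub_nonneg.mpr hxy),
    ← Real.log_div hx0.ne' hy0.ne']
  have h1 := Real.log_le_sub_one_of_pos (div_pos hx0 hy0)
  have h2 : x / y - 1 = y⁻¹ * (x - y) := by field_simp
  have h3 : y⁻¹ ≤ Real.exp a := by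
    rw [← inv_inv (Real.exp a), ← Real.exp_neg]
    exact inv_anti₀ (Real.exp_pos _) hy
  calc _ ≤ y⁻¹ * (x - y) := by linarith
    _ ≤ _ := mul_le_mul_of_nonneg_right h3 (sub_nonneg.mpr hxy)

/-- The eigenvalues of `C` lie between `δ` and `1 - δ`. -/
theorem exists_conjDiag_of_bounds {C : Matrix m m ℂ} {δ : ℝ}
    (h0 : (C - (δ : ℂ) • 1).PosSemidef) (h1 : ((1 - (δ : ℂ)) • 1 - C).PosSemidef) :
    ∃ (U : Matrix m m ℂ) (c : m → ℝ), U * Uᴴ = 1 ∧ C = conjDiag U c ∧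
      ∀ i, δ ≤ c i ∧ c i ≤ 1 - δ := by
  have hC : C.IsHermitian := by
    have h2 : ((δ : ℂ) • (1 : Matrix m m ℂ)).IsHermitian := by
      rw [Matrix.IsHermitian, Matrix.conjTranspose_smul, Matrix.conjTranspose_one]
      simp
    have := h0.isHermitian.add h2
    rwa [sub_add_cancel] at this
  obtain ⟨U, c, hU1, hU2, rfl, -⟩ := hC.exists_conjDiag
  have hconst : ∀ x : ℝ, conjDiag U (fun _ => x) = (x : ℂ) • 1 := by
    intro x
    rw [← conjDiag_one hU1, ← conjDiag_smul]
    simp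
  refine ⟨U, c, hU1, rfl, fun i => ?_⟩
  have e : (1 - (δ : ℂ)) = ((1 - δ : ℝ) : ℂ) := by push_cast; rfl
  rw [← hconst, ← conjDiag_sub, conjDiag_posSemidef_iff hU2] at h0
  rw [e, ← hconst, ← conjDiag_sub, conjDiag_posSemidef_iff hU2] at h1
  exact ⟨by linarith [h0 i], by linarith [h1 i]⟩

end MatrixAlgorithm

/-! ### Error analysis of the matrix algorithm -/

section Accuracy

attribute [local instance] Matrix.frobeniusNormedAddCommGroup Matrix.frobeniusNormedRing
  Matrix.frobeniusNormedSpace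

variable {m : Type*} [Fintype m] [DecidableEq m]

theorem abs_log_le_of_half_pow_le {x : ℝ} {n : ℕ} (h0 : (1 / 2) ^ n ≤ x) (h1 : x ≤ 1) :
    -(n : ℝ) ≤ Real.log x ∧ Real.log x ≤ 0 := by
  have hp : (0 : ℝ) < (1 / 2) ^ n := by positivity
  refine ⟨?_, Real.log_nonpos (hp.le.trans h0) h1⟩
  have h2 := Real.log_le_log hp h0
  have h3 : Real.log 2 ≤ 1 := by
    have := Real.log_le_sub_one_of_pos (show (0 : ℝ) < 2 by norm_num)
    linarith
  rw [Real.log_pow, one_div, Real.log_inv] at h2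
  nlinarith [Nat.cast_nonneg (α := ℝ) n]

theorem matPow_conjDiag {U : Matrix m m ℂ} (hU : U * Uᴴ = 1) (a : m → ℝ) (s : ℝ) :
    matPow (conjDiag U a) s = conjDiag U fun i => a i ^ s :=
  cfc_conjDiag hU a _

theorem matLog_conjDiag {U : Matrix m m ℂ} (hU : U * Uᴴ = 1) (a : m → ℝ) :
    matLog (conjDiag U a) = conjDiag U fun i => Real.log (a i) :=
  cfc_conjDiag hU a _

theorem trace_conjDiag_re {U : Matrix m m ℂ} (hU : U * Uᴴ = 1) (a : m → ℝ) :
    (conjDiag U a).trace.re = ∑ i, a i := by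
  rw [trace_conjDiag (mul_eq_one_comm.mp hU), Complex.ofReal_re]

theorem abs_sum_sub_sum_le {m : Type*} [Fintype m] {f g : m → ℝ} {B : ℝ} (h : ∀ i, |f i - g i| ≤ B) :
    |∑ i, f i - ∑ i, g i| ≤ Fintype.card m * B := by
  rw [← Finset.sum_sub_distrib]
  refine (Finset.abs_sum_le_sum_abs _ _).trans ?_
  calc _ ≤ ∑ _i : m, B := Finset.sum_le_sum fun i _ => h i
    _ = _ := by simp

/-- The magnitudes of the parameters of the algorithm. -/
structure ParamBound (b s r z u w : ℝ) : Prop where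
  two_le : 2 ≤ b
  hs : |s| ≤ b
  hr : |r| ≤ b
  hz : |z| ≤ b
  hu : |u| ≤ b ^ 2
  hw : |w| ≤ b

/-- The approximate powers of an odds matrix. -/
theorem expIter_odds_close {b s Y ε : ℝ} {n K : ℕ} (hb : 2 ≤ b) (hs : |s| ≤ b)
    (hY : Y = 8 * b ^ 2 * (n + 1)) (hacc : Accurate K Y ε) (hε : Real.exp Y * ε ≤ 1)
    {U : Matrix m m ℂ} (hU : U * Uᴴ = 1) {c : m → ℝ}
    (hc : ∀ i, (1 / 2) ^ n ≤ c i ∧ c i ≤ 1 - (1 / 2) ^ n) :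
    ∃ x x' : m → ℝ,
      matPow (oddsMatrix (conjDiag U c)) s = conjDiag U x ∧
      expIter K (s * (1 / 2) ^ K) (logIter K ((1 / 2) ^ K) Y (conjDiag U c) -
        logIter K ((1 / 2) ^ K) Y (1 - conjDiag U c)) = conjDiag U x' ∧
      (∀ i, Real.exp (-(b * n + 1)) ≤ x i ∧ x i ≤ Real.exp (b * n + 1)) ∧
      (∀ i, Real.exp (-(b * n + 1)) ≤ x' i ∧ x' i ≤ Real.exp (b * n + 1)) ∧
      ‖conjDiag U x‖ ≤ Fintype.card m * Real.exp Y ∧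
      ‖conjDiag U x'‖ ≤ Fintype.card m * Real.exp Y ∧
      ‖conjDiag U x' - conjDiag U x‖ ≤ Fintype.card m * (Real.exp Y * ε) := by
  have hn : (0 : ℝ) ≤ n := Nat.cast_nonneg n
  have hU2 : Uᴴ * U = 1 := mul_eq_one_comm.mp hU
  have hp : (0 : ℝ) < (1 / 2) ^ n := by positivity
  have hε0 : 0 ≤ ε := le_trans (by positivity) hacc.exp_le
  have hbn : 0 ≤ b * n := by positivity
  have hbn2 : b * n ≤ b ^ 2 * n := mul_le_mul_of_nonneg_right (by nlinarith) hn
  have hbnY : b * n + 1 ≤ Y := by nlinarith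
  have hnY : (n : ℝ) ≤ Y := by nlinarith
  have hlt : ∀ i, c i < 1 := fun i => by linarith [(hc i).2]
  have hlog : ∀ i, |Real.log (c i) - Real.log (1 - c i)| ≤ n ∧ |Real.log (c i)| ≤ n ∧
      |Real.log (1 - c i)| ≤ n := by
    intro i
    have h1 := abs_log_le_of_half_pow_le (hc i).1 (by linarith [(hc i).2])
    have h2 := abs_log_le_of_half_pow_le (x := 1 - c i) (n := n) (by linarith [(hc i).2])
      (by linarith [(hc i).1])
    refine ⟨abs_le.mpr ⟨?_, ?_⟩, abs_le.mpr ⟨?_, ?_⟩, abs_le.mpr ⟨?_, ?_⟩⟩ <;> linarith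
  have hex : ∀ i, ∃ τ, |τ| ≤ (2 * |s| + 1) * ε ∧
      expApprox K (s * (logApprox K Y (c i) - logApprox K Y (1 - c i))) =
        (c i / (1 - c i)) ^ s * Real.exp τ := by
    intro i
    obtain ⟨h1, h2, h3⟩ := hlog i
    refine hacc.odds_rpow (hp.trans_le (hc i).1) (hlt i) (h2.trans hnY) (h3.trans hnY) ?_
    have : |s| * |Real.log (c i) - Real.log (1 - c i)| ≤ b * n :=
      mul_le_mul hs h1 (abs_nonneg _) (by linarith)
    nlinarith
  choose τ hτ hτe using hex
  have hτ' : ∀ i, |τ i| ≤ (2 * b + 1) * ε := fun i =>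
    (hτ i).trans (mul_le_mul_of_nonneg_right (by linarith) hε0)
  have h2b : 2 * (2 * b + 1) ≤ Real.exp (4 * b + 1) := by
    linarith [Real.add_one_le_exp (4 * b + 1)]
  have hτ1 : ∀ i, |τ i| ≤ 1 := by
    intro i
    have h1 : 2 * b + 1 ≤ Real.exp Y := by
      have := Real.add_one_le_exp Y
      nlinarith
    exact (hτ' i).trans ((mul_le_mul_of_nonneg_right h1 hε0).trans hε)
  set x : m → ℝ := fun i => (c i / (1 - c i)) ^ s with hx
  set x' : m → ℝ := fun i => x i * Real.exp (τ i) with hx'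
  have hxe : ∀ i, x i = Real.exp (s * (Real.log (c i) - Real.log (1 - c i))) := by
    intro i
    have h0 : 0 < c i := hp.trans_le (hc i).1
    have h1 : 0 < 1 - c i := by linarith [hlt i]
    rw [hx]
    dsimp only
    rw [Real.rpow_def_of_pos (div_pos h0 h1), Real.log_div h0.ne' h1.ne', mul_comm]
  have hexp : ∀ i, |s * (Real.log (c i) - Real.log (1 - c i))| ≤ b * n := by
    intro i
    rw [abs_mul]
    exact mul_le_mul hs (hlog i).1 (abs_nonneg _) (by linarith)
  have hxb : ∀ i, Real.exp (-(b * n + 1)) ≤ x i ∧ x i ≤ Real.exp (b * n) := by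
    intro i
    rw [hxe]
    obtain ⟨h1, h2⟩ := abs_le.mp (hexp i)
    exact ⟨Real.exp_le_exp.mpr (by linarith), Real.exp_le_exp.mpr h2⟩
  have hxb' : ∀ i, Real.exp (-(b * n + 1)) ≤ x' i ∧ x' i ≤ Real.exp (b * n + 1) := by
    intro i
    rw [hx']
    dsimp only
    rw [hxe, ← Real.exp_add]
    obtain ⟨h1, h2⟩ := abs_le.mp (hexp i)
    obtain ⟨h3, h4⟩ := abs_le.mp (hτ1 i)
    exact ⟨Real.exp_le_exp.mpr (by linarith), Real.exp_le_exp.mpr (by linarith)⟩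
  have hexpY : Real.exp (b * n + 1) ≤ Real.exp Y := Real.exp_le_exp.mpr hbnY
  have hexp1 : Real.exp (b * n) ≤ Real.exp (b * n + 1) := Real.exp_le_exp.mpr (by linarith)
  refine ⟨x, x', ?_, ?_, fun i => ⟨(hxb i).1, (hxb i).2.trans hexp1⟩, hxb', ?_, ?_, ?_⟩
  · rw [oddsMatrix_conjDiag hU hlt, matPow_conjDiag hU]
  · rw [one_sub_conjDiag hU, logIter_conjDiag hU, logIter_conjDiag hU, ← conjDiag_sub,
      expIter_conjDiag hU]
    congr 1
    ext i
    exact hτe i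
  · refine frobenius_norm_conjDiag_le hU2 fun i => ?_
    rw [abs_of_pos ((Real.exp_pos _).trans_le (hxb i).1)]
    exact (hxb i).2.trans (hexp1.trans hexpY)
  · refine frobenius_norm_conjDiag_le hU2 fun i => ?_
    rw [abs_of_pos ((Real.exp_pos _).trans_le (hxb' i).1)]
    exact (hxb' i).2.trans hexpY
  · rw [← conjDiag_sub]
    refine frobenius_norm_conjDiag_le hU2 fun i => ?_
    have h1 : x' i - x i = x i * (Real.exp (τ i) - 1) := by rw [hx']; ring
    rw [h1, abs_mul, abs_of_pos ((Real.exp_pos _).trans_le (hxb i).1)]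
    -- For |τ| ≤ 1 the error e^τ - 1 is at most 2|τ|. The factor 2(2b + 1) is absorbed by exp(4b +
    -- 1), and 4b + 1 + bn ≤ Y is part of the reason for Y = 8b²(n + 1).
    calc x i * |Real.exp (τ i) - 1| ≤ Real.exp (b * n) * (2 * |τ i|) :=
          mul_le_mul (hxb i).2 (Real.abs_exp_sub_one_le (hτ1 i)) (abs_nonneg _) (Real.exp_pos _).le
      _ ≤ Real.exp (b * n) * (2 * ((2 * b + 1) * ε)) := by gcongr; exact hτ' i
      _ = (2 * (2 * b + 1)) * Real.exp (b * n) * ε := by ring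
      _ ≤ Real.exp (4 * b + 1) * Real.exp (b * n) * ε := by gcongr
      _ = Real.exp (4 * b + 1 + b * n) * ε := by rw [← Real.exp_add]
      _ ≤ Real.exp Y * ε := by
        refine mul_le_mul_of_nonneg_right (Real.exp_le_exp.mpr ?_) hε0
        nlinarith

/-- Powers of `d` are absorbed by exp(4d), everything depending on `b` and `n` by exp(4Y), so each
of the four terms is at most G = exp(4d + 4Y) ε. The exponent 6Y + 4d + 2 in `ε` is chosen so that
4G ≤ e² G = exp(-2Y) ≤ 2^(-n). -/
theorem error_budget {b s r z u w Y ε d : ℝ} {n : ℕ} (hp : ParamBound b s r z u w)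
    (hY : Y = 8 * b ^ 2 * (n + 1)) (hd : 0 ≤ d) (hε : ε = Real.exp (-(6 * Y + 4 * d + 2))) :
    |u| * (d * ε) + d * ε + |w| * (d * ((|z| + 2) * ε) +
      d * (|z| * Real.exp (3 * (b * n + 1)) *
        (3 * (d * Real.exp Y) ^ 2 * (d * (Real.exp Y * ε))))) ≤ (1 / 2) ^ n := by
  have hb := hp.two_le
  have hn : (0 : ℝ) ≤ n := Nat.cast_nonneg n
  have hε0 : 0 < ε := by rw [hε]; exact Real.exp_pos _
  have hbn2 : b * n ≤ b ^ 2 * n := mul_le_mul_of_nonneg_right (by nlinarith) hn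
  have hY0 : 0 ≤ Y := by rw [hY]; positivity
  have hYe : Y ≤ Real.exp Y := by linarith [Real.add_one_le_exp Y]
  have hde : d ≤ Real.exp d := by linarith [Real.add_one_le_exp d]
  have hexpY1 : 1 ≤ Real.exp Y := Real.one_le_exp hY0
  have hd4 : d ≤ Real.exp (4 * d) := hde.trans (Real.exp_le_exp.mpr (by linarith))
  have hd4' : d ^ 4 ≤ Real.exp (4 * d) := by
    calc d ^ 4 ≤ Real.exp d ^ 4 := by gcongr
      _ = _ := by rw [← Real.exp_nat_mul]; norm_num
  have hY4 : Real.exp Y ≤ Real.exp (4 * Y) := Real.exp_le_exp.mpr (by linarith)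
  have h14 : 1 ≤ Real.exp (4 * Y) := hexpY1.trans hY4
  set G := Real.exp (4 * d) * Real.exp (4 * Y) * ε with hG
  have t1 : |u| * (d * ε) ≤ G := by
    have : |u| ≤ Real.exp (4 * Y) := hp.hu.trans (by nlinarith)
    calc |u| * (d * ε) ≤ Real.exp (4 * Y) * (Real.exp (4 * d) * ε) := by gcongr
      _ = G := by rw [hG]; ring
  have t2 : d * ε ≤ G := by
    calc d * ε = d * 1 * ε := by ring
      _ ≤ Real.exp (4 * d) * Real.exp (4 * Y) * ε := by gcongr
  have t3 : |w| * (d * ((|z| + 2) * ε)) ≤ G := by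
    have : |w| * (|z| + 2) ≤ Real.exp (4 * Y) := by
      calc |w| * (|z| + 2) ≤ b * (b + 2) :=
            mul_le_mul hp.hw (by linarith [hp.hz]) (by positivity) (by linarith)
        _ ≤ Y := by nlinarith
        _ ≤ _ := hYe.trans hY4
    calc |w| * (d * ((|z| + 2) * ε)) = d * (|w| * (|z| + 2)) * ε := by ring
      _ ≤ Real.exp (4 * d) * Real.exp (4 * Y) * ε := by gcongr
  have t4 : |w| * (d * (|z| * Real.exp (3 * (b * n + 1)) *
        (3 * (d * Real.exp Y) ^ 2 * (d * (Real.exp Y * ε))))) ≤ G := by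
    have h1 : 3 * (|w| * |z|) ≤ Real.exp (3 * b ^ 2) := by
      have : |w| * |z| ≤ b * b := mul_le_mul hp.hw hp.hz (abs_nonneg _) (by linarith)
      nlinarith [Real.add_one_le_exp (3 * b ^ 2)]
    have e3 : Real.exp Y ^ 3 = Real.exp (3 * Y) := by rw [← Real.exp_nat_mul]; norm_num
    calc _ = d ^ 4 * ((3 * (|w| * |z|)) * Real.exp (3 * (b * n + 1)) * Real.exp Y ^ 3) * ε := by ring
      _ ≤ Real.exp (4 * d) * (Real.exp (3 * b ^ 2) * Real.exp (3 * (b * n + 1)) *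
            Real.exp Y ^ 3) * ε := by gcongr
      _ = Real.exp (4 * d) * Real.exp (3 * b ^ 2 + 3 * (b * n + 1) + 3 * Y) * ε := by
        rw [e3, ← Real.exp_add, ← Real.exp_add]
      _ ≤ Real.exp (4 * d) * Real.exp (4 * Y) * ε := by
        gcongr
        nlinarith
  have hfin : 4 * G ≤ (1 / 2) ^ n := by
    have h2 : (2 : ℝ) ≤ Real.exp 1 := by linarith [Real.add_one_le_exp (1 : ℝ)]
    have h4 : (4 : ℝ) ≤ Real.exp 2 := by
      have : Real.exp 2 = Real.exp 1 * Real.exp 1 := by rw [← Real.exp_add]; norm_num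
      nlinarith
    have h5 : Real.exp (-1) ≤ 1 / 2 := by
      rw [Real.exp_neg, one_div]
      exact inv_anti₀ (by norm_num) h2
    calc 4 * G ≤ Real.exp 2 * G := by gcongr
      _ = Real.exp (-(2 * Y)) := by
        rw [hG, hε, ← Real.exp_add, ← Real.exp_add, ← Real.exp_add]
        congr 1
        ring
      _ ≤ Real.exp (-(n : ℝ)) := Real.exp_le_exp.mpr (by nlinarith)
      _ = Real.exp (-1) ^ n := by rw [← Real.exp_nat_mul]; congr 1; ring
      _ ≤ (1 / 2) ^ n := by
        exact pow_le_pow_left₀ (Real.exp_pos _).le h5 n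
  have hw : |w| * (d * ((|z| + 2) * ε) +
      d * (|z| * Real.exp (3 * (b * n + 1)) *
        (3 * (d * Real.exp Y) ^ 2 * (d * (Real.exp Y * ε))))) ≤ G + G := by
    rw [mul_add]
    exact add_le_add t3 t4
  linarith

/-- The algorithm computes the closed form of the Rényi mutual information with error at most
`2 ^ (-n)`. -/
theorem abs_renyiIter_sub_le {b s r z u w Y : ℝ} {n K : ℕ} (hp : ParamBound b s r z u w)
    (hY : Y = 8 * b ^ 2 * (n + 1))
    (hK : (1 + 2 * Y) * (12 * Y + 4 * Fintype.card m + 5) ≤ K) {C C' : Matrix m m ℂ}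
    (hC0 : (C - (((1 / 2) ^ n : ℝ) : ℂ) • 1).PosSemidef)
    (hC1 : ((1 - (((1 / 2) ^ n : ℝ) : ℂ)) • 1 - C).PosSemidef)
    (hC0' : (C' - (((1 / 2) ^ n : ℝ) : ℂ) • 1).PosSemidef)
    (hC1' : ((1 - (((1 / 2) ^ n : ℝ) : ℂ)) • 1 - C').PosSemidef) :
    |renyiIter K ((1 / 2) ^ K) Y s r z u w C C' -
      (-(u * (matLog (1 - C)).trace.re) - (matLog (1 - C')).trace.re
        - w * (matLog (1 + matPow (matPow (oddsMatrix C') s * matPow (oddsMatrix C) r *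
            matPow (oddsMatrix C') s) z)).trace.re)| ≤ (1 / 2) ^ n := by
  have hb := hp.two_le
  have hn : (0 : ℝ) ≤ n := Nat.cast_nonneg n
  have hY1 : 1 ≤ Y := by nlinarith
  set d : ℝ := (Fintype.card m : ℝ) with hd
  have hd0 : 0 ≤ d := Nat.cast_nonneg _
  set ε := Real.exp (-(6 * Y + 4 * d + 2)) with hε
  have hacc : Accurate K Y ε := accurate_of_le hY1 hd0 hK
  have hε0 : 0 < ε := Real.exp_pos _
  have hεY : Real.exp Y * ε ≤ 1 := by
    rw [hε, ← Real.exp_add, ← Real.exp_zero]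
    exact Real.exp_le_exp.mpr (by linarith)
  obtain ⟨U, c, hU, rfl, hc⟩ := exists_conjDiag_of_bounds hC0 hC1
  obtain ⟨U', c', hU', rfl, hc'⟩ := exists_conjDiag_of_bounds hC0' hC1'
  have hbn4 : 4 * (n : ℝ) ≤ b ^ 2 * n := mul_le_mul_of_nonneg_right (by nlinarith) hn
  have hnY : (n : ℝ) ≤ Y := by nlinarith
  have hl : ∀ {c : m → ℝ}, (∀ i, (1 / 2) ^ n ≤ c i ∧ c i ≤ 1 - (1 / 2) ^ n) →
      ∀ i, |logApprox K Y (1 - c i) - Real.log (1 - c i)| ≤ ε := by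
    intro c hc i
    have hpn : (0 : ℝ) < (1 / 2) ^ n := by positivity
    obtain ⟨h1, h2⟩ := abs_log_le_of_half_pow_le (x := 1 - c i) (n := n) (by linarith [(hc i).2])
      (by linarith [(hc i).1])
    refine hacc.logApprox (by linarith [(hc i).2]) ?_
    rw [abs_le]
    constructor <;> linarith
  obtain ⟨x, x', hx, hx', hxb, hxb', hxn, hxn', hxd⟩ :=
    expIter_odds_close hb hp.hs hY hacc hεY hU' hc'
  obtain ⟨y, y', hy, hy', hyb, hyb', hyn, hyn', hyd⟩ :=
    expIter_odds_close hb hp.hr hY hacc hεY hU hc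
  have hP : (conjDiag U' x * conjDiag U y * conjDiag U' x).IsHermitian := by
    refine (mul_mul_posSemidef (conjDiag_isHermitian _ _) ?_).isHermitian
    rw [conjDiag_posSemidef_iff (mul_eq_one_comm.mp hU)]
    exact fun i => (Real.exp_pos _).le.trans (hyb i).1
  have hP' : (conjDiag U' x' * conjDiag U y' * conjDiag U' x').IsHermitian := by
    refine (mul_mul_posSemidef (conjDiag_isHermitian _ _) ?_).isHermitian
    rw [conjDiag_posSemidef_iff (mul_eq_one_comm.mp hU)]
    exact fun i => (Real.exp_pos _).le.trans (hyb' i).1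
  -- The exact and the approximate sandwich have unrelated eigenbases. The error of the last term is
  -- split accordingly: `hgg` compares approximate and exact functions on the spectrum of the
  -- approximate sandwich, and `hsum` compares one exact function on the two matrices.
  obtain ⟨Q, p, hQ, hQ2, hPQ, -⟩ := hP.exists_conjDiag
  obtain ⟨Q', p', hQ', hQ2', hPQ', -⟩ := hP'.exists_conjDiag
  have hpb := eigenvalue_bounds_sandwich hU' hU hQ hxb hyb hPQ
  have hpb' := eigenvalue_bounds_sandwich hU' hU hQ' hxb' hyb' hPQ'
  have hPd := frobenius_norm_triple_sub_le (by positivity) hxn hxn' hyn hyn' hxd hyd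
  rw [hPQ, hPQ'] at hPd
  have hp0 : ∀ i, 0 < p i := fun i => (Real.exp_pos _).trans_le (hpb i).1
  have hp0' : ∀ i, 0 < p' i := fun i => (Real.exp_pos _).trans_le (hpb' i).1
  have hbn2 : b * n ≤ b ^ 2 * n := mul_le_mul_of_nonneg_right (by nlinarith) hn
  have hlogp' : ∀ i, |Real.log (p' i)| ≤ 3 * (b * n + 1) := by
    intro i
    rw [abs_le]
    constructor
    · have := Real.log_le_log (Real.exp_pos _) (hpb' i).1
      rwa [Real.log_exp] at this
    · have := Real.log_le_log (hp0' i) (hpb' i).2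
      rwa [Real.log_exp] at this
  set g : ℝ → ℝ := fun t => Real.log (1 + t ^ z) with hg
  set g' : ℝ → ℝ := fun t => logApprox K Y (1 + expApprox K (z * logApprox K Y t)) with hg'
  have hgg : ∀ i, |g' (p' i) - g (p' i)| ≤ (|z| + 2) * ε := by
    intro i
    refine hacc.log_one_add_rpow (hp0' i) ((hlogp' i).trans (by nlinarith)) ?_
    have h1 : |z| * |Real.log (p' i)| ≤ b * (3 * (b * n + 1)) :=
      mul_le_mul hp.hz (hlogp' i) (abs_nonneg _) (by linarith)
    have := hp.hz
    nlinarith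
  -- The function is log, then multiplication by z, then u ↦ log(1 + e^u). The last is 1-Lipschitz,
  -- and log has slope at most exp(3(bn + 1)) on both spectra.
  have hlip : ∀ i j, |g (p' i) - g (p j)| ≤ |z| * Real.exp (3 * (b * n + 1)) * |p' i - p j| := by
    intro i j
    simp only [hg]
    rw [Real.rpow_def_of_pos (hp0' i), Real.rpow_def_of_pos (hp0 j)]
    refine (abs_log_one_add_exp_sub_le _ _).trans ?_
    rw [← sub_mul, abs_mul, mul_comm, mul_assoc]
    exact mul_le_mul_of_nonneg_left (abs_log_sub_log_le (hpb' i).1 (hpb j).1) (abs_nonneg _)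
  have hG := frobenius_norm_conjDiag_sub_le hQ2' hQ2 (by positivity) hlip
  have hsum : |∑ i, g (p' i) - ∑ i, g (p i)| ≤
      d * (|z| * Real.exp (3 * (b * n + 1)) * (3 * (d * Real.exp Y) ^ 2 * (d * (Real.exp Y * ε)))) := by
    have h1 := abs_trace_re_le
      (conjDiag Q' (fun i => g (p' i)) - conjDiag Q (fun j => g (p j)))
    rw [Matrix.trace_sub, Complex.sub_re, trace_conjDiag_re hQ', trace_conjDiag_re hQ] at h1
    refine h1.trans (mul_le_mul_of_nonneg_left (hG.trans ?_) hd0)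
    exact mul_le_mul_of_nonneg_left hPd (by positivity)
  have e2 := abs_sum_sub_sum_le (hl hc)
  have e4 := abs_sum_sub_sum_le (hl hc')
  have e6 := abs_sum_sub_sum_le hgg
  have hapx : renyiIter K ((1 / 2) ^ K) Y s r z u w (conjDiag U c) (conjDiag U' c') =
      -(u * ∑ i, logApprox K Y (1 - c i)) - ∑ i, logApprox K Y (1 - c' i) -
        w * ∑ i, g' (p' i) := by
    rw [renyiIter, sandwichIter, hx', hy', hPQ', logIter_conjDiag hQ', expIter_conjDiag hQ',
      one_add_conjDiag hQ', logIter_conjDiag hQ', trace_conjDiag_re hQ', one_sub_conjDiag hU,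
      one_sub_conjDiag hU', logIter_conjDiag hU, logIter_conjDiag hU', trace_conjDiag_re hU,
      trace_conjDiag_re hU']
  have hext : -(u * (matLog (1 - conjDiag U c)).trace.re) - (matLog (1 - conjDiag U' c')).trace.re
        - w * (matLog (1 + matPow (matPow (oddsMatrix (conjDiag U' c')) s *
          matPow (oddsMatrix (conjDiag U c)) r *
            matPow (oddsMatrix (conjDiag U' c')) s) z)).trace.re =
      -(u * ∑ i, Real.log (1 - c i)) - ∑ i, Real.log (1 - c' i) - w * ∑ i, g (p i) := by
    rw [hx, hy, hPQ, matPow_conjDiag hQ, one_add_conjDiag hQ, matLog_conjDiag hQ,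
      trace_conjDiag_re hQ, one_sub_conjDiag hU,
      one_sub_conjDiag hU', matLog_conjDiag hU, matLog_conjDiag hU', trace_conjDiag_re hU,
      trace_conjDiag_re hU']
  rw [hapx, hext]
  refine le_trans ?_ (error_budget hp hY hd0 hε)
  have e7 := abs_sub_le (∑ i, g' (p' i)) (∑ i, g (p' i)) (∑ i, g (p i))
  have hA := mul_le_mul_of_nonneg_left e2 (abs_nonneg u)
  have hB := mul_le_mul_of_nonneg_left (e7.trans (add_le_add e6 hsum)) (abs_nonneg w)
  rw [← abs_mul] at hA hB
  have htri : ∀ a a' b b' c c' : ℝ, |-(a) - b - c - (-(a') - b' - c')| ≤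
      |a - a'| + |b - b'| + |c - c'| := by
    intro a a' b b' c c'
    calc |-(a) - b - c - (-(a') - b' - c')| = |(a - a') + (b - b') + (c - c')| := by
          rw [← abs_neg]
          congr 1
          ring
      _ ≤ _ := (abs_add_le _ _).trans (add_le_add (abs_add_le _ _) le_rfl)
  refine (htri _ _ _ _ _ _).trans ?_
  rw [← mul_sub, ← mul_sub]
  exact add_le_add (add_le_add hA e4) hB

end Accuracy

/-! ### Correctness and cost of loops -/

section RamLoops

/-- `for c in 0, …, (counter b) - 1 do P`. -/
def forLoop (c b : ℕ) (P : RamProgram) : RamProgram :=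
  .seq (.reset c) (.whileDo (.counterLt c b) (.seq P (.incr c)))

theorem setCounter_counter (s : RamState) (i v x : ℕ) :
    (s.setCounter i v).counter x = if x = i then v else s.counter x := by
  simp [RamState.setCounter, Function.update_apply]

theorem setCounter_array (s : RamState) (i v : ℕ) : (s.setCounter i v).array = s.array := rfl

theorem setCell_counter (s : RamState) (a k l : ℕ) (x : ℝ) :
    (s.setCell a k l x).counter = s.counter := rfl

theorem setCell_array (s : RamState) (a k l : ℕ) (x : ℝ) (a' k' l' : ℕ) :
    (s.setCell a k l x).array a' k' l' =
      if a' = a ∧ k' = k ∧ l' = l then x else s.array a' k' l' := rfl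

/-- The loop rule with an invariant. -/
theorem forLoop_exec {c b n T : ℕ} {P : RamProgram} (I : ℕ → RamState → Prop) {s₀ : RamState}
    (h0 : I 0 (s₀.setCounter c 0)) (hb : ∀ k s, I k s → s.counter b = n)
    (hstep : ∀ k s, k < n → I k s → s.counter c = k → ∃ t s', RamExec P s t s' ∧ t ≤ T ∧
      s'.counter c = k ∧ I (k + 1) (s'.setCounter c (k + 1))) :
    ∃ t s', RamExec (forLoop c b P) s₀ t s' ∧ t ≤ n * (T + 2) + 2 ∧ I n s' := by
  -- Induction on the number `j` of rounds left. A round costs the body plus one test and one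
  -- increment; the failing last test and the initial reset account for the final 2.
  have key : ∀ j k s, k + j = n → I k s → s.counter c = k → ∃ t s',
      RamExec (.whileDo (.counterLt c b) (.seq P (.incr c))) s t s' ∧ t ≤ j * (T + 2) + 1 ∧
        I n s' := by
    intro j
    induction j with
    | zero =>
      intro k s hk hI hc
      obtain rfl : k = n := by omega
      refine ⟨_, s, RamExec.whileFalse ?_, by simp [RamTest.cost], hI⟩
      rw [RamTest.Holds, hc, hb _ s hI]
      exact lt_irrefl _
    | succ j ih =>
      intro k s hk hI hc
      obtain ⟨t, s', hP, ht, hc', hI'⟩ := hstep k s (by omega) hI hc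
      have hincr := RamExec.incr c s'
      rw [hc'] at hincr
      obtain ⟨t', s'', hW, ht', hI''⟩ := ih (k + 1) _ (by omega) hI' (by simp [setCounter_counter])
      refine ⟨_, s'', RamExec.whileTrue ?_ (RamExec.seq hP hincr) hW, ?_, hI''⟩
      · rw [RamTest.Holds, hc, hb _ s hI]
        omega
      · simp only [RamTest.cost]
        nlinarith
  obtain ⟨t, s', hW, ht, hI⟩ := key n 0 _ (by omega) h0 (by simp [setCounter_counter])
  exact ⟨_, s', RamExec.seq (RamExec.reset c s₀) hW, by omega, hI⟩

/-- The array contents when the entries before `(i, j)` of the matrices in the arrays `tgt` have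
been overwritten by `val`. -/
def partialFill (s₀ : RamState) (N : ℕ) (tgt : ℕ → Prop) [DecidablePred tgt]
    (val : ℕ → ℕ → ℕ → ℝ) (i j : ℕ) : ℕ → ℕ → ℕ → ℝ :=
  fun a k l => if tgt a ∧ l < N ∧ (k < i ∨ k = i ∧ l < j) then val a k l else s₀.array a k l

/-- A double loop over the entries of a matrix. -/
theorem matLoop_exec {N T : ℕ} {P : RamProgram} {s₀ : RamState} {tgt : ℕ → Prop}
    [DecidablePred tgt] {val : ℕ → ℕ → ℕ → ℝ} (hN : s₀.counter 5 = N)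
    (hP : ∀ i j s, i < N → j < N → s.counter 7 = i → s.counter 8 = j →
      (∀ x, x < 7 ∨ 10 ≤ x → s.counter x = s₀.counter x) →
      s.array = partialFill s₀ N tgt val i j → ∃ t s', RamExec P s t s' ∧ t ≤ T ∧
        (∀ x, x ≠ 9 → s'.counter x = s.counter x) ∧
        s'.array = partialFill s₀ N tgt val i (j + 1)) :
    ∃ t s', RamExec (forLoop 7 5 (forLoop 8 5 P)) s₀ t s' ∧ t ≤ N * ((N * (T + 2) + 2) + 2) + 2 ∧
      (∀ x, x < 7 ∨ 10 ≤ x → s'.counter x = s₀.counter x) ∧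
      s'.array = fun a k l => if tgt a ∧ k < N ∧ l < N then val a k l else s₀.array a k l := by
  obtain ⟨t, s', h1, h2, h3, h4⟩ := forLoop_exec (c := 7) (b := 5) (n := N)
    (T := N * (T + 2) + 2) (P := forLoop 8 5 P)
    (fun i s => (∀ x, x < 7 ∨ 10 ≤ x → s.counter x = s₀.counter x) ∧
      s.array = partialFill s₀ N tgt val i 0) (s₀ := s₀)
    (by
      constructor
      · intro x hx
        rw [setCounter_counter, if_neg (by omega)]
      · rw [setCounter_array]
        ext a k l
        simp [partialFill])
    (fun k s hs => (hs.1 5 (by omega)).trans hN)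
    (by
      rintro i s hi ⟨hs1, hs2⟩ hc
      obtain ⟨t, s', h1, h2, h3, h4, h5⟩ := forLoop_exec (c := 8) (b := 5) (n := N) (T := T) (P := P)
        (fun j s => (∀ x, x < 7 ∨ 10 ≤ x → s.counter x = s₀.counter x) ∧ s.counter 7 = i ∧
          s.array = partialFill s₀ N tgt val i j) (s₀ := s)
        (by
          refine ⟨fun x hx => ?_, ?_, ?_⟩
          · rw [setCounter_counter, if_neg (by omega)]
            exact hs1 x hx
          · rw [setCounter_counter, if_neg (by omega), hc]
          · rw [setCounter_array, hs2])
        (fun k s hs => (hs.1 5 (by omega)).trans hN)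
        (by
          rintro j s hj ⟨hs1, hs7, hs2⟩ hc
          obtain ⟨t, s', h1, h2, h3, h4⟩ := hP i j s hi hj hs7 hc hs1 hs2
          refine ⟨t, s', h1, h2, (h3 8 (by omega)).trans hc, fun x hx => ?_, ?_, ?_⟩
          · rw [setCounter_counter, if_neg (by omega), h3 x (by omega)]
            exact hs1 x hx
          · rw [setCounter_counter, if_neg (by omega), h3 7 (by omega), hs7]
          · rw [setCounter_array, h4])
      refine ⟨t, s', h1, h2, h4, fun x hx => ?_, ?_⟩
      · rw [setCounter_counter, if_neg (by omega)]
        exact h3 x hx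
      · rw [setCounter_array, h5]
        ext a k l
        unfold partialFill
        -- Only columns l < N count, so a finished row i is the same as an unbegun row i + 1.
        have : (tgt a ∧ l < N ∧ (k < i ∨ k = i ∧ l < N)) ↔
            (tgt a ∧ l < N ∧ (k < i + 1 ∨ k = i + 1 ∧ l < 0)) := by
          refine and_congr_right fun _ => and_congr_right fun hl => ?_
          omega
        simp only [this])
  refine ⟨t, s', h1, h2, h3, ?_⟩
  rw [h4]
  ext a k l
  unfold partialFill
  have : (tgt a ∧ l < N ∧ (k < N ∨ k = N ∧ l < 0)) ↔ (tgt a ∧ k < N ∧ l < N) := by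
    constructor
    · rintro ⟨h1, h2, h3⟩
      exact ⟨h1, by omega, h2⟩
    · rintro ⟨h1, h2, h3⟩
      exact ⟨h1, h3, Or.inl h2⟩
  simp only [this]

/-- One step of filling in entries. -/
theorem partialFill_succ (s₀ : RamState) (N : ℕ) (tgt : ℕ → Prop) [DecidablePred tgt]
    (val : ℕ → ℕ → ℕ → ℝ) (i j : ℕ) (hj : j < N) (a k l : ℕ) :
    partialFill s₀ N tgt val i (j + 1) a k l =
      if tgt a ∧ k = i ∧ l = j then val a i j else partialFill s₀ N tgt val i j a k l := by
  unfold partialFill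
  by_cases h : tgt a ∧ k = i ∧ l = j
  · obtain ⟨h1, rfl, rfl⟩ := h
    rw [if_pos ⟨h1, hj, Or.inr ⟨rfl, by omega⟩⟩, if_pos ⟨h1, rfl, rfl⟩]
  · rw [if_neg h]
    have : (tgt a ∧ l < N ∧ (k < i ∨ k = i ∧ l < j + 1)) ↔
        (tgt a ∧ l < N ∧ (k < i ∨ k = i ∧ l < j)) := by
      refine and_congr_right fun ha => and_congr_right fun _ => ?_
      have : ¬ (k = i ∧ l = j) := fun h' => h ⟨ha, h'⟩
      omega
    simp only [this]

theorem partialFill_of_not_tgt {s₀ : RamState} {N : ℕ} {tgt : ℕ → Prop} [DecidablePred tgt]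
    {val : ℕ → ℕ → ℕ → ℝ} {i j a : ℕ} (ha : ¬ tgt a) (k l : ℕ) :
    partialFill s₀ N tgt val i j a k l = s₀.array a k l := by
  rw [partialFill, if_neg (fun h => ha h.1)]

/-- An entry is overwritten only at its own turn. Entrywise operations may therefore use a source
matrix as their destination. -/
theorem partialFill_current (s₀ : RamState) (N : ℕ) (tgt : ℕ → Prop) [DecidablePred tgt]
    (val : ℕ → ℕ → ℕ → ℝ) (i j a : ℕ) :
    partialFill s₀ N tgt val i j a i j = s₀.array a i j := by
  rw [partialFill, if_neg]
  omega

end RamLoops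

/-! ### Programs acting on stored matrices; linear combinations -/

section MatrixPrograms

variable {ι : Type*} [Fintype ι] [DecidableEq ι] {N : ℕ}

/-- The complex matrix stored in the arrays `2k` and `2k + 1`. -/
def storedMat (e : ι ≃ Fin N) (s : RamState) (k : ℕ) : Matrix ι ι ℂ :=
  Matrix.of fun i j => ⟨s.array (2 * k) (e i) (e j), s.array (2 * k + 1) (e i) (e j)⟩

/-- The program `P` transforms the stored matrices according to the relation `R`; it changes only
the counters `7, …, lvl - 1` and the arrays with numbers at least `40`. -/
def Implements (e : ι ≃ Fin N) (K : ℕ) (sc : ℕ → ℝ) (P : RamProgram)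
    (R : (ℕ → Matrix ι ι ℂ) → (ℕ → Matrix ι ι ℂ) → Prop) (lvl T : ℕ) : Prop :=
  ∀ s : RamState, s.counter 3 = 0 → s.counter 5 = N → s.counter 6 = K →
    (∀ a < 40, s.array a 0 0 = sc a) →
    ∃ t s', RamExec P s t s' ∧ t ≤ T ∧ (∀ x, x < 7 ∨ lvl ≤ x → s'.counter x = s.counter x) ∧
      (∀ a < 40, s'.array a = s.array a) ∧ R (storedMat e s) (storedMat e s')

variable {e : ι ≃ Fin N} {K : ℕ} {sc : ℕ → ℝ}

theorem Implements.mono {P : RamProgram} {R R' : (ℕ → Matrix ι ι ℂ) → (ℕ → Matrix ι ι ℂ) → Prop}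
    {lvl lvl' T T' : ℕ} (h : Implements e K sc P R lvl T) (hR : ∀ M M', R M M' → R' M M')
    (hl : lvl ≤ lvl') (hT : T ≤ T') : Implements e K sc P R' lvl' T' := by
  intro s h3 h5 h6 hsc
  obtain ⟨t, s', h1, h2, h3, h4, h5⟩ := h s h3 h5 h6 hsc
  exact ⟨t, s', h1, h2.trans hT, fun x hx => h3 x (by omega), h4, hR _ _ h5⟩

theorem Implements.seq {P Q : RamProgram}
    {R R' R'' : (ℕ → Matrix ι ι ℂ) → (ℕ → Matrix ι ι ℂ) → Prop}
    {lvl T T' : ℕ} (hP : Implements e K sc P R lvl T) (hQ : Implements e K sc Q R' lvl T')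
    (hR : ∀ M M' M'', R M M' → R' M' M'' → R'' M M'') :
    Implements e K sc (.seq P Q) R'' lvl (T + T') := by
  intro s h3 h5 h6 hsc
  obtain ⟨t, s', e1, e2, e3, e4, e5⟩ := hP s h3 h5 h6 hsc
  obtain ⟨t', s'', f1, f2, f3, f4, f5⟩ := hQ s' ((e3 3 (by omega)).trans h3)
    ((e3 5 (by omega)).trans h5) ((e3 6 (by omega)).trans h6)
    (fun a ha => by rw [e4 a ha]; exact hsc a ha)
  exact ⟨_, s'', RamExec.seq e1 f1, by omega, fun x hx => (f3 x hx).trans (e3 x hx),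
    fun a ha => (f4 a ha).trans (e4 a ha), hR _ _ _ e5 f5⟩

/-- The body leaves the counters from `lvl` on alone, so counter `lvl` is free to drive the loop.
Each nesting level thus raises `lvl` by one. -/
theorem Implements.loop {P : RamProgram} {R : (ℕ → Matrix ι ι ℂ) → (ℕ → Matrix ι ι ℂ) → Prop}
    {lvl T : ℕ} (hP : Implements e K sc P R lvl T) (hlvl : 7 ≤ lvl)
    (S : ℕ → (ℕ → Matrix ι ι ℂ) → (ℕ → Matrix ι ι ℂ) → Prop) (hS0 : ∀ M, S 0 M M)
    (hS : ∀ k M M' M'', S k M M' → R M' M'' → S (k + 1) M M'') :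
    Implements e K sc (forLoop lvl 6 P) (S K) (lvl + 1) (K * (T + 2) + 2) := by
  intro s h3 h5 h6 hsc
  have hmat : ∀ (s : RamState) (c v : ℕ), storedMat e (s.setCounter c v) = storedMat e s :=
    fun _ _ _ => rfl
  obtain ⟨t, s', e1, e2, e3, e4, e5⟩ := forLoop_exec (c := lvl) (b := 6) (n := K) (T := T) (P := P)
    (fun k s' => (∀ x, x < 7 ∨ lvl + 1 ≤ x → s'.counter x = s.counter x) ∧
      (∀ a < 40, s'.array a = s.array a) ∧ S k (storedMat e s) (storedMat e s')) (s₀ := s)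
    (by
      refine ⟨fun x hx => ?_, fun a _ => rfl, hS0 _⟩
      rw [setCounter_counter, if_neg (by omega)])
    (fun k s' hs' => (hs'.1 6 (by omega)).trans h6)
    (by
      rintro k s1 hk ⟨g1, g2, g3⟩ hc
      obtain ⟨t, s', e1, e2, e3, e4, e5⟩ := hP s1 ((g1 3 (by omega)).trans h3)
        ((g1 5 (by omega)).trans h5) ((g1 6 (by omega)).trans h6)
        (fun a ha => by rw [g2 a ha]; exact hsc a ha)
      refine ⟨t, s', e1, e2, (e3 lvl (by omega)).trans hc, fun x hx => ?_, fun a ha => ?_, ?_⟩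
      · rw [setCounter_counter, if_neg (by omega), e3 x (by omega)]
        exact g1 x hx
      · rw [setCounter_array, e4 a ha]
        exact g2 a ha
      · rw [hmat]
        exact hS _ _ _ _ g3 e5)
  exact ⟨t, s', e1, e2, e3, e4, e5⟩

/-- The program for `M_c := p M_i + q M_a + r M_b`, with scalars `p, q, r`. -/
def linProg (c p i q a r b : ℕ) : RamProgram :=
  forLoop 7 5 (forLoop 8 5 (.seq
    (.store (2 * c) 7 8 (.add (.add (.mul (.cell p 3 3) (.cell (2 * i) 7 8))
      (.mul (.cell q 3 3) (.cell (2 * a) 7 8))) (.mul (.cell r 3 3) (.cell (2 * b) 7 8))))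
    (.store (2 * c + 1) 7 8 (.add (.add (.mul (.cell p 3 3) (.cell (2 * i + 1) 7 8))
      (.mul (.cell q 3 3) (.cell (2 * a + 1) 7 8)))
      (.mul (.cell r 3 3) (.cell (2 * b + 1) 7 8))))))

theorem linProg_implements {c p i q a r b : ℕ} (hc : 20 ≤ c) (hp : p < 40) (hq : q < 40)
    (hr : r < 40) :
    Implements e K sc (linProg c p i q a r b)
      (fun M M' => M' = Function.update M c
        ((sc p : ℂ) • M i + (sc q : ℂ) • M a + (sc r : ℂ) • M b)) 10
      (N * ((N * (24 + 2) + 2) + 2) + 2) := by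
  intro s h3 h5 h6 hsc
  set val : ℕ → ℕ → ℕ → ℝ := fun x k l =>
    if x = 2 * c then sc p * s.array (2 * i) k l + sc q * s.array (2 * a) k l +
      sc r * s.array (2 * b) k l
    else sc p * s.array (2 * i + 1) k l + sc q * s.array (2 * a + 1) k l +
      sc r * s.array (2 * b + 1) k l with hval
  -- Two stores of cost 12 each. The target arrays have numbers at least 40, so the scalars `p, q,
  -- r` survive.
  obtain ⟨t, s', e1, e2, e3, e4⟩ := matLoop_exec (N := N) (T := 24) (s₀ := s)
    (tgt := fun x => x = 2 * c ∨ x = 2 * c + 1) (val := val)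
    (P := .seq
    (.store (2 * c) 7 8 (.add (.add (.mul (.cell p 3 3) (.cell (2 * i) 7 8))
      (.mul (.cell q 3 3) (.cell (2 * a) 7 8))) (.mul (.cell r 3 3) (.cell (2 * b) 7 8))))
    (.store (2 * c + 1) 7 8 (.add (.add (.mul (.cell p 3 3) (.cell (2 * i + 1) 7 8))
      (.mul (.cell q 3 3) (.cell (2 * a + 1) 7 8)))
      (.mul (.cell r 3 3) (.cell (2 * b + 1) 7 8))))) h5
    (by
      intro k l s1 hk hl g7 g8 gc ga
      have g3 : s1.counter 3 = 0 := (gc 3 (by omega)).trans h3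
      have gsc : ∀ x < 40, s1.array x 0 0 = sc x := by
        intro x hx
        rw [ga, partialFill_of_not_tgt (by omega)]
        exact hsc x hx
      have gcur : ∀ x, s1.array x k l = s.array x k l := by
        intro x
        rw [ga, partialFill_current]
      refine ⟨_, _, RamExec.seq (RamExec.store _ _ _ _ _) (RamExec.store _ _ _ _ _), ?_,
        fun x _ => rfl, ?_⟩
      · simp [RealExpr.cost]
      · ext x k' l'
        rw [partialFill_succ _ _ _ _ _ _ hl, ← ga]
        have hpc : ¬ p = 2 * c := by omega
        have hqc : ¬ q = 2 * c := by omega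
        have hrc : ¬ r = 2 * c := by omega
        have hodd : ∀ x, ¬ 2 * x + 1 = 2 * c := fun x => by omega
        simp only [setCell_array, setCell_counter, RealExpr.value, g7, g8, g3, gsc p hp, gsc q hq,
          gsc r hr, gcur, hval, hpc, hqc, hrc, hodd, false_and, if_false]
        by_cases hx : x = 2 * c + 1
        · subst hx
          by_cases hkl : k' = k ∧ l' = l
          · obtain ⟨rfl, rfl⟩ := hkl
            simp
          · simp [hkl]
        · by_cases hx' : x = 2 * c
          · subst hx'
            by_cases hkl : k' = k ∧ l' = l
            · obtain ⟨rfl, rfl⟩ := hkl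
              simp
            · simp [hkl]
          · simp [hx, hx'])
  refine ⟨t, s', e1, e2, e3, fun x hx => ?_, ?_⟩
  · rw [e4]
    ext k l
    exact if_neg (fun h => by omega)
  · ext x k l
    by_cases hx : x = c
    · subst hx
      rw [Function.update_self]
      apply Complex.ext <;> simp [storedMat, e4, hval]
    · rw [Function.update_of_ne hx]
      have h1 : ¬ (2 * x = 2 * c ∨ 2 * x = 2 * c + 1) := by omega
      have h2 : ¬ (2 * x + 1 = 2 * c ∨ 2 * x + 1 = 2 * c + 1) := by omega
      simp only [storedMat, e4, Matrix.of_apply, h1, h2, false_and, if_false]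

end MatrixPrograms

/-! ### Matrix multiplication -/

section MatrixMultiplication

variable {ι : Type*} [Fintype ι] [DecidableEq ι] {N : ℕ}
variable {e : ι ≃ Fin N} {K : ℕ} {sc : ℕ → ℝ}

/-- The body of the innermost loop of the matrix multiplication. -/
def mulStep (c a b : ℕ) : RamProgram :=
  .seq
    (.store (2 * c) 7 8 (.add (.cell (2 * c) 7 8) (.sub
      (.mul (.cell (2 * a) 7 9) (.cell (2 * b) 9 8))
      (.mul (.cell (2 * a + 1) 7 9) (.cell (2 * b + 1) 9 8)))))
    (.store (2 * c + 1) 7 8 (.add (.cell (2 * c + 1) 7 8) (.add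
      (.mul (.cell (2 * a) 7 9) (.cell (2 * b + 1) 9 8))
      (.mul (.cell (2 * a + 1) 7 9) (.cell (2 * b) 9 8)))))

/-- The computation of one entry of the product of two matrices. -/
def mulEntry (c a b : ℕ) : RamProgram :=
  .seq (.seq (.store (2 * c) 7 8 (.nat 0)) (.store (2 * c + 1) 7 8 (.nat 0)))
    (forLoop 9 5 (mulStep c a b))

/-- The program for `M_c := M_a M_b`. -/
def mulProg (c a b : ℕ) : RamProgram :=
  forLoop 7 5 (forLoop 8 5 (mulEntry c a b))

theorem mulEntry_exec {c a b i j : ℕ} (hca : a ≠ c) (hcb : b ≠ c) {s : RamState}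
    (h5 : s.counter 5 = N) (h7 : s.counter 7 = i) (h8 : s.counter 8 = j) :
    ∃ t s', RamExec (mulEntry c a b) s t s' ∧ t ≤ 4 + (N * (20 + 2) + 2) ∧
      (∀ x, x ≠ 9 → s'.counter x = s.counter x) ∧
      s'.array = ((s.setCell (2 * c) i j (∑ m ∈ Finset.range N,
        (s.array (2 * a) i m * s.array (2 * b) m j -
          s.array (2 * a + 1) i m * s.array (2 * b + 1) m j))).setCell (2 * c + 1) i j
            (∑ m ∈ Finset.range N, (s.array (2 * a) i m * s.array (2 * b + 1) m j +
              s.array (2 * a + 1) i m * s.array (2 * b) m j))).array := by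
  set F : ℕ → ℝ := fun k => ∑ m ∈ Finset.range k, (s.array (2 * a) i m * s.array (2 * b) m j -
    s.array (2 * a + 1) i m * s.array (2 * b + 1) m j) with hF
  set G : ℕ → ℝ := fun k => ∑ m ∈ Finset.range k, (s.array (2 * a) i m * s.array (2 * b + 1) m j +
    s.array (2 * a + 1) i m * s.array (2 * b) m j) with hG
  have d1 : ¬ 2 * a = 2 * c := by omega
  have d2 : ¬ 2 * b = 2 * c := by omega
  have d3 : ∀ x, ¬ 2 * x + 1 = 2 * c := fun x => by omega
  have d4 : ∀ x, ¬ 2 * x = 2 * c + 1 := fun x => by omega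
  have d5 : ¬ 2 * a + 1 = 2 * c + 1 := by omega
  have d6 : ¬ 2 * b + 1 = 2 * c + 1 := by omega
  obtain ⟨t, s', e1, e2, e3, e4⟩ := forLoop_exec (c := 9) (b := 5) (n := N) (T := 20)
    (P := mulStep c a b)
    (fun k s' => (∀ x, x ≠ 9 → s'.counter x = s.counter x) ∧
      s'.array = ((s.setCell (2 * c) i j (F k)).setCell (2 * c + 1) i j (G k)).array)
    (s₀ := (s.setCell (2 * c) i j 0).setCell (2 * c + 1) i j 0)
    (by
      refine ⟨fun x hx => ?_, ?_⟩
      · rw [setCounter_counter, if_neg hx]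
        rfl
      · simp [setCounter_array, hF, hG])
    (fun k s' hs => (hs.1 5 (by omega)).trans h5)
    (by
      rintro k s1 hk ⟨g1, g2⟩ hc
      have g7 : s1.counter 7 = i := (g1 7 (by omega)).trans h7
      have g8 : s1.counter 8 = j := (g1 8 (by omega)).trans h8
      refine ⟨_, _, RamExec.seq (RamExec.store _ _ _ _ _) (RamExec.store _ _ _ _ _), ?_, hc,
        fun x hx => ?_, ?_⟩
      · simp [RealExpr.cost]
      · rw [setCounter_counter, if_neg hx]
        exact g1 x hx
      · have hFs : F (k + 1) = F k + _ := Finset.sum_range_succ _ _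
        have hGs : G (k + 1) = G k + _ := Finset.sum_range_succ _ _
        rw [setCounter_array, hFs, hGs]
        ext x k' l'
        simp only [setCell_array, setCell_counter, RealExpr.value, g7, g8, hc, g2, d1, d2, d3, d4,
          d5, d6, false_and, if_false, true_and, if_true, and_self]
        by_cases hkl : k' = i ∧ l' = j
        · simp only [hkl, and_true, and_self]
          by_cases hx : x = 2 * c + 1
          · simp [hx]
          · by_cases hx' : x = 2 * c
            · simp [hx']
            · simp [hx, hx']
        · simp [hkl])
  have h0 : RamExec (.seq (.store (2 * c) 7 8 (.nat 0)) (.store (2 * c + 1) 7 8 (.nat 0))) s 4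
      ((s.setCell (2 * c) i j 0).setCell (2 * c + 1) i j 0) := by
    have := RamExec.seq (RamExec.store (2 * c) 7 8 (.nat 0) s)
      (RamExec.store (2 * c + 1) 7 8 (.nat 0) _)
    simpa [RealExpr.cost, RealExpr.value, h7, h8, setCell_counter] using this
  exact ⟨_, s', RamExec.seq h0 e1, by omega, e3, e4⟩

/-- Entries other than the current one are read while the product is being filled in, so in contrast
to linear combinations the destination has to differ from both factors. -/
theorem mulProg_implements {c a b : ℕ} (hc : 20 ≤ c) (hca : a ≠ c) (hcb : b ≠ c) :
    Implements e K sc (mulProg c a b)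
      (fun M M' => M' = Function.update M c (M a * M b)) 10
      (N * ((N * ((4 + (N * (20 + 2) + 2)) + 2) + 2) + 2) + 2) := by
  intro s h3 h5 h6 hsc
  set val : ℕ → ℕ → ℕ → ℝ := fun x k l =>
    if x = 2 * c then ∑ m ∈ Finset.range N, (s.array (2 * a) k m * s.array (2 * b) m l -
      s.array (2 * a + 1) k m * s.array (2 * b + 1) m l)
    else ∑ m ∈ Finset.range N, (s.array (2 * a) k m * s.array (2 * b + 1) m l +
      s.array (2 * a + 1) k m * s.array (2 * b) m l) with hval
  obtain ⟨t, s', e1, e2, e3, e4⟩ := matLoop_exec (N := N) (T := 4 + (N * (20 + 2) + 2)) (s₀ := s)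
    (tgt := fun x => x = 2 * c ∨ x = 2 * c + 1) (val := val) (P := mulEntry c a b) h5
    (by
      intro k l s1 hk hl g7 g8 gc ga
      obtain ⟨t, s', e1, e2, e3, e4⟩ := mulEntry_exec (N := N) hca hcb
        ((gc 5 (by omega)).trans h5) g7 g8
      refine ⟨t, s', e1, e2, e3, ?_⟩
      have gnt : ∀ x, x ≠ 2 * c → x ≠ 2 * c + 1 → s1.array x = s.array x := by
        intro x hx hx'
        ext k' l'
        rw [ga, partialFill_of_not_tgt (by omega)]
      rw [gnt (2 * a) (by omega) (by omega), gnt (2 * b) (by omega) (by omega),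
        gnt (2 * a + 1) (by omega) (by omega), gnt (2 * b + 1) (by omega) (by omega)] at e4
      ext x k' l'
      rw [e4, partialFill_succ _ _ _ _ _ _ hl, ← ga]
      simp only [setCell_array, hval]
      by_cases hx : x = 2 * c + 1
      · subst hx
        simp
      · by_cases hx' : x = 2 * c
        · subst hx'
          simp
        · simp [hx, hx'])
  refine ⟨t, s', e1, e2, e3, fun x hx => ?_, ?_⟩
  · rw [e4]
    ext k l
    exact if_neg (fun h => by omega)
  · ext x k l
    by_cases hx : x = c
    · subst hx
      rw [Function.update_self, Matrix.mul_apply, ← e.symm.sum_comp]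
      apply Complex.ext <;>
        simp [storedMat, e4, hval, Finset.sum_range, Complex.re_sum, Complex.im_sum]
    · rw [Function.update_of_ne hx]
      have h1 : ¬ (2 * x = 2 * c ∨ 2 * x = 2 * c + 1) := by omega
      have h2 : ¬ (2 * x + 1 = 2 * c ∨ 2 * x + 1 = 2 * c + 1) := by omega
      simp only [storedMat, e4, Matrix.of_apply, h1, h2, false_and, if_false]

end MatrixMultiplication

/-! ### Programs for powers, exponentials and logarithms of matrices -/

section Iterations

variable {ι : Type*} [Fintype ι] [DecidableEq ι] {N : ℕ}
variable {e : ι ≃ Fin N} {K : ℕ} {sc : ℕ → ℝ}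

/-- The matrix number `dst` becomes `f M`; besides, only the scratch matrices change. The matrix
number `20` is assumed to be the identity. -/
def Assigns (dst : ℕ) (f : (ℕ → Matrix ι ι ℂ) → Matrix ι ι ℂ) (M M' : ℕ → Matrix ι ι ℂ) : Prop :=
  M 20 = 1 → M' dst = f M ∧ ∀ m, m ≠ dst → m ≠ 23 → m ≠ 24 → M' m = M m

/-- A time bound for elementary matrix operations. -/
def matTime (N : ℕ) : ℕ := 40 * (N + 1) ^ 3

theorem linProg_assigns {c p i q a r b : ℕ} (hc : 20 ≤ c) (hp : p < 40) (hq : q < 40)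
    (hr : r < 40) {lvl : ℕ} (hlvl : 10 ≤ lvl) :
    Implements e K sc (linProg c p i q a r b)
      (Assigns c fun M => (sc p : ℂ) • M i + (sc q : ℂ) • M a + (sc r : ℂ) • M b) lvl
      (matTime N) := by
  refine (linProg_implements hc hp hq hr).mono ?_ hlvl ?_
  · rintro M M' rfl -
    exact ⟨Function.update_self _ _ _, fun m hm _ _ => Function.update_of_ne hm _ _⟩
  · unfold matTime
    ring_nf
    nlinarith [Nat.zero_le (N ^ 3)]

theorem mulProg_assigns {c a b : ℕ} (hc : 20 ≤ c) (hca : a ≠ c) (hcb : b ≠ c) {lvl : ℕ}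
    (hlvl : 10 ≤ lvl) :
    Implements e K sc (mulProg c a b) (Assigns c fun M => M a * M b) lvl (matTime N) := by
  refine (mulProg_implements hc hca hcb).mono ?_ hlvl ?_
  · rintro M M' rfl -
    exact ⟨Function.update_self _ _ _, fun m hm _ _ => Function.update_of_ne hm _ _⟩
  · unfold matTime
    ring_nf
    nlinarith [Nat.zero_le (N ^ 3)]

/-- Repeated squaring of the matrix number `23`. -/
def sqProg : RamProgram := forLoop 10 6 (.seq (mulProg 24 23 23) (linProg 23 5 24 4 24 4 24))

theorem sqProg_assigns (h4 : sc 4 = 0) (h5 : sc 5 = 1) :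
    Implements e K sc sqProg (Assigns 23 fun M => sqIter K (M 23)) 11
      (K * (2 * matTime N + 2) + 2) := by
  -- The square is formed in the scratch matrix 24 and copied back. The copy is a linear
  -- combination, with scalar number 5 equal to 1 and scalar number 4 equal to 0.
  have hstep : Implements e K sc (.seq (mulProg 24 23 23) (linProg 23 5 24 4 24 4 24))
      (Assigns 23 fun M => M 23 * M 23) 10 (2 * matTime N) := by
    rw [two_mul]
    refine (mulProg_assigns (by norm_num) (by norm_num) (by norm_num) le_rfl).seq
      (linProg_assigns (by norm_num) (by norm_num) (by norm_num) (by norm_num) le_rfl) ?_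
    intro M M' M'' h1 h2 h20
    obtain ⟨g1, g2⟩ := h1 h20
    obtain ⟨g3, g4⟩ := h2 (by rw [g2 20 (by norm_num) (by norm_num) (by norm_num), h20])
    refine ⟨?_, fun m hm hm' hm'' => (g4 m hm hm' hm'').trans (g2 m hm'' hm' hm'')⟩
    beta_reduce at *
    rw [g3, g1, h4, h5]
    simp
  refine (hstep.loop (by norm_num) (fun k => Assigns 23 fun M => sqIter k (M 23))
    (fun M _ => ⟨rfl, fun _ _ _ _ => rfl⟩) ?_)
  intro k M M' M'' h1 h2 h20
  obtain ⟨g1, g2⟩ := h1 h20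
  obtain ⟨g3, g4⟩ := h2 (by rw [g2 20 (by norm_num) (by norm_num) (by norm_num), h20])
  refine ⟨?_, fun m hm hm' hm'' => (g4 m hm hm' hm'').trans (g2 m hm hm' hm'')⟩
  beta_reduce at *
  rw [g3, g1, sqIter, sqIter, Function.iterate_succ_apply']

/-- The program for the approximate exponential of the matrix number `src`, multiplied by the
scalar number `q`; the result is the matrix number `dst`. -/
def expProg (dst q src : ℕ) : RamProgram :=
  .seq (linProg 23 5 20 q src 4 src) (.seq sqProg (linProg dst 5 23 4 23 4 23))

theorem matTime_pos (N : ℕ) : 40 ≤ matTime N := by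
  have : 1 ≤ (N + 1) ^ 3 := Nat.one_le_pow _ _ (by omega)
  unfold matTime
  omega

theorem expProg_assigns (h4 : sc 4 = 0) (h5 : sc 5 = 1) {dst q src : ℕ} (hd : 20 ≤ dst)
    (hq : q < 40) {lvl : ℕ} (hlvl : 11 ≤ lvl) :
    Implements e K sc (expProg dst q src) (Assigns dst fun M => expIter K (sc q) (M src)) lvl
      (3 * (K + 1) * matTime N) := by
  refine ((linProg_assigns (by norm_num) (by norm_num) hq (by norm_num) (by norm_num)).seq
    ((sqProg_assigns h4 h5).seq (linProg_assigns hd (by norm_num) (by norm_num) (by norm_num)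
      (by norm_num)) (R'' := fun M M'' => ∃ M', Assigns 23 (fun M => sqIter K (M 23)) M M' ∧ _)
        (fun M M' M'' h1 h2 => ⟨M', h1, h2⟩))
      (fun M M' M'' h1 h2 => ?_)).mono (fun _ _ h => h) hlvl ?_
  · obtain ⟨M₁, h2, h3⟩ := h2
    intro h20
    obtain ⟨g1, g2⟩ := h1 h20
    obtain ⟨g3, g4⟩ := h2 (by rw [g2 20 (by norm_num) (by norm_num) (by norm_num), h20])
    obtain ⟨g5, g6⟩ := h3 (by rw [g4 20 (by norm_num) (by norm_num) (by norm_num),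
      g2 20 (by norm_num) (by norm_num) (by norm_num), h20])
    refine ⟨?_, fun m hm hm' hm'' => by rw [g6 m hm hm' hm'', g4 m hm' hm' hm'',
      g2 m hm' hm' hm'']⟩
    beta_reduce at *
    rw [g5, g3, g1, h4, h5, h20]
    simp [expIter]
  · have := matTime_pos N
    nlinarith [Nat.zero_le (K * matTime N)]

/-- The program for the approximate logarithm of the matrix number `src`; the result is the
matrix number `dst`. -/
def logProg (dst src : ℕ) : RamProgram :=
  .seq (linProg dst 12 20 4 20 4 20) (forLoop 11 6 (.seq (expProg 23 8 dst)
    (.seq (mulProg 24 src 23) (linProg dst 5 dst 6 20 5 24))))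

theorem logProg_assigns (h4 : sc 4 = 0) (h5 : sc 5 = 1) (h6 : sc 6 = -1) {h : ℝ}
    (h8 : sc 8 = -h) {dst src : ℕ} (hd : 24 < dst) (hs : src ≠ 23 ∧ src ≠ 24)
    (hsd : src ≠ dst) :
    Implements e K sc (logProg dst src) (Assigns dst fun M => logIter K h (sc 12) (M src)) 12
      (6 * (K + 1) ^ 2 * matTime N) := by
  -- One Newton step L - 1 + X exp(-L): scalar 8 is -h, scalar 6 is -1, and matrix 20 is the
  -- identity. The condition 24 < `dst` keeps the iterate away from the scratch matrices.
  have hstep : Implements e K sc (.seq (expProg 23 8 dst)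
      (.seq (mulProg 24 src 23) (linProg dst 5 dst 6 20 5 24)))
      (Assigns dst fun M => logIterStep K h (M src) (M dst)) 11
      (3 * (K + 1) * matTime N + (matTime N + matTime N)) := by
    refine (expProg_assigns h4 h5 (by norm_num) (by norm_num) le_rfl).seq
      ((mulProg_assigns (by norm_num) hs.2 (by norm_num) (by norm_num)).seq
        (linProg_assigns (by omega) (by norm_num) (by norm_num) (by norm_num)
      (by norm_num)) (R'' := fun M M'' => ∃ M', Assigns 24 (fun M => M src * M 23) M M' ∧ _)
        (fun M M' M'' h1 h2 => ⟨M', h1, h2⟩))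
      (fun M M' M'' h1 h2 => ?_)
    obtain ⟨M₁, h2, h3⟩ := h2
    intro h20
    obtain ⟨g1, g2⟩ := h1 h20
    have e1 : M' 20 = 1 := by rw [g2 20 (by norm_num) (by norm_num) (by norm_num), h20]
    obtain ⟨g3, g4⟩ := h2 e1
    have e2 : M₁ 20 = 1 := by rw [g4 20 (by norm_num) (by norm_num) (by norm_num), e1]
    obtain ⟨g5, g6⟩ := h3 e2
    refine ⟨?_, fun m hm hm' hm'' => by rw [g6 m hm hm' hm'', g4 m hm'' hm' hm'',
      g2 m hm' hm' hm'']⟩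
    beta_reduce at *
    rw [g5, g3, g4 dst (by omega) (by omega) (by omega), g2 dst (by omega) (by omega) (by omega),
      g2 src hs.1 hs.1 hs.2, g1, e2, h5, h6, h8, logIterStep, expIter]
    simp [sub_eq_add_neg]
  refine ((linProg_assigns (by omega) (by norm_num) (by norm_num) (by norm_num)
    (by norm_num)).seq (hstep.loop (by norm_num) (fun k => Assigns dst fun M =>
      (logIterStep K h (M src))^[k] (M dst)) (fun M _ => ⟨rfl, fun _ _ _ _ => rfl⟩) ?_)
      (fun M M' M'' h1 h2 => ?_)).mono (fun _ _ h => h) le_rfl ?_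
  · intro k M M' M'' h1 h2 h20
    obtain ⟨g1, g2⟩ := h1 h20
    obtain ⟨g3, g4⟩ := h2 (by rw [g2 20 (by omega) (by norm_num) (by norm_num), h20])
    refine ⟨?_, fun m hm hm' hm'' => (g4 m hm hm' hm'').trans (g2 m hm hm' hm'')⟩
    beta_reduce at *
    rw [g3, g1, g2 src hsd hs.1 hs.2, Function.iterate_succ_apply']
  · intro h20
    obtain ⟨g1, g2⟩ := h1 h20
    obtain ⟨g3, g4⟩ := h2 (by rw [g2 20 (by omega) (by norm_num) (by norm_num), h20])
    refine ⟨?_, fun m hm hm' hm'' => (g4 m hm hm' hm'').trans (g2 m hm hm' hm'')⟩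
    beta_reduce at *
    rw [g3, g1, g2 src hsd hs.1 hs.2, h4, h20, logIter]
    simp
  · have := matTime_pos N
    nlinarith [Nat.zero_le (K * matTime N), Nat.zero_le (K ^ 2 * matTime N)]

/-- The program for the matrices whose traces enter the mutual information. -/
def coreProg : RamProgram :=
  .seq (logProg 25 21) <| .seq (linProg 26 5 20 6 21 4 20) <| .seq (logProg 27 26) <|
  .seq (logProg 28 22) <| .seq (linProg 29 5 20 6 22 4 20) <| .seq (logProg 30 29) <|
  .seq (linProg 31 5 28 6 30 4 20) <| .seq (expProg 32 9 31) <|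
  .seq (linProg 33 5 25 6 27 4 20) <| .seq (expProg 34 10 33) <|
  .seq (mulProg 35 32 34) <| .seq (mulProg 36 35 32) <| .seq (logProg 37 36) <|
  .seq (expProg 40 11 37) <| .seq (linProg 38 5 20 5 40 4 20) (logProg 39 38)

theorem Implements.exists_seq {P Q : RamProgram}
    {R R' : (ℕ → Matrix ι ι ℂ) → (ℕ → Matrix ι ι ℂ) → Prop}
    {lvl T T' : ℕ} (hP : Implements e K sc P R lvl T) (hQ : Implements e K sc Q R' lvl T') :
    Implements e K sc (.seq P Q) (fun M M'' => ∃ M', R M M' ∧ R' M' M'') lvl (T + T') :=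
  hP.seq hQ fun _ M' _ h h' => ⟨M', h, h'⟩

/-- Registers: 21 and 22 hold C and C'; 25 and 27 the logarithms of C and 1 - C; 28 and 30 those of
C' and 1 - C'; 32 and 34 the powers of the odds matrices; 36 the sandwich, 37 its logarithm, 40 its
z-th power, and 39 the last logarithm. -/
theorem coreProg_implements (h4 : sc 4 = 0) (h5 : sc 5 = 1) (h6 : sc 6 = -1) {h s r z : ℝ}
    (h8 : sc 8 = -h) (h9 : sc 9 = s * h) (h10 : sc 10 = r * h) (h11 : sc 11 = z * h) :
    Implements e K sc coreProg (fun M M' => M 20 = 1 →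
      M' 27 = logIter K h (sc 12) (1 - M 21) ∧ M' 30 = logIter K h (sc 12) (1 - M 22) ∧
      M' 39 = logIter K h (sc 12) (1 + expIter K (z * h) (logIter K h (sc 12)
        (sandwichIter K h (sc 12) s r (M 21) (M 22))))) 12
      (60 * (K + 1) ^ 2 * matTime N) := by
  have hlog : ∀ (dst src : ℕ) (_ : 24 < dst) (_ : src ≠ 23 ∧ src ≠ 24) (_ : src ≠ dst),
      Implements e K sc (logProg dst src) (Assigns dst fun M => logIter K h (sc 12) (M src)) 12
        (6 * (K + 1) ^ 2 * matTime N) :=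
    fun _ _ => logProg_assigns h4 h5 h6 h8
  have hexp : ∀ (dst q src : ℕ) (_ : 20 ≤ dst) (_ : q < 40),
      Implements e K sc (expProg dst q src) (Assigns dst fun M => expIter K (sc q) (M src)) 12
        (3 * (K + 1) * matTime N) := fun _ _ _ hd hq => expProg_assigns h4 h5 hd hq (by norm_num)
  have hsub : ∀ (c a b : ℕ) (_ : 20 ≤ c), Implements e K sc (linProg c 5 a 6 b 4 20)
      (Assigns c fun M => M a - M b) 12 (matTime N) := by
    intro c a b hc
    have := linProg_assigns (e := e) (K := K) (sc := sc) (N := N) (c := c) (p := 5) (i := a)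
      (q := 6) (a := b) (r := 4) (b := 20) hc (by norm_num) (by norm_num) (by norm_num)
      (lvl := 12) (by norm_num)
    simpa [h4, h5, h6, ← sub_eq_add_neg] using this
  have hadd : ∀ (c a b : ℕ) (_ : 20 ≤ c), Implements e K sc (linProg c 5 a 5 b 4 20)
      (Assigns c fun M => M a + M b) 12 (matTime N) := by
    intro c a b hc
    have := linProg_assigns (e := e) (K := K) (sc := sc) (N := N) (c := c) (p := 5) (i := a)
      (q := 5) (a := b) (r := 4) (b := 20) hc (by norm_num) (by norm_num) (by norm_num)
      (lvl := 12) (by norm_num)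
    simpa [h4, h5, h6, ← sub_eq_add_neg] using this
  have hmul : ∀ (c a b : ℕ) (_ : 20 ≤ c) (_ : a ≠ c) (_ : b ≠ c),
      Implements e K sc (mulProg c a b) (Assigns c fun M => M a * M b) 12 (matTime N) :=
    fun _ _ _ hc ha hb => mulProg_assigns hc ha hb (by norm_num)
  have key :=
    (hlog 25 21 (by norm_num) (by norm_num) (by norm_num)).exists_seq <|
    (hsub 26 20 21 (by norm_num)).exists_seq <|
    (hlog 27 26 (by norm_num) (by norm_num) (by norm_num)).exists_seq <|
    (hlog 28 22 (by norm_num) (by norm_num) (by norm_num)).exists_seq <|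
    (hsub 29 20 22 (by norm_num)).exists_seq <|
    (hlog 30 29 (by norm_num) (by norm_num) (by norm_num)).exists_seq <|
    (hsub 31 28 30 (by norm_num)).exists_seq <|
    (hexp 32 9 31 (by norm_num) (by norm_num)).exists_seq <|
    (hsub 33 25 27 (by norm_num)).exists_seq <|
    (hexp 34 10 33 (by norm_num) (by norm_num)).exists_seq <|
    (hmul 35 32 34 (by norm_num) (by norm_num) (by norm_num)).exists_seq <|
    (hmul 36 35 32 (by norm_num) (by norm_num) (by norm_num)).exists_seq <|
    (hlog 37 36 (by norm_num) (by norm_num) (by norm_num)).exists_seq <|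
    (hexp 40 11 37 (by norm_num) (by norm_num)).exists_seq <|
    (hadd 38 20 40 (by norm_num)).exists_seq <|
    (hlog 39 38 (by norm_num) (by norm_num) (by norm_num))
  refine key.mono ?_ le_rfl ?_
  · rintro M M' ⟨M₁, k₁, M₂, k₂, M₃, k₃, M₄, k₄, M₅, k₅, M₆, k₆, M₇, k₇, M₈, k₈, M₉, k₉, M₁₀, k₁₀,
      M₁₁, k₁₁, M₁₂, k₁₂, M₁₃, k₁₃, M₁₄, k₁₄, M₁₅, k₁₅, k₁₆⟩ h20
    have next : ∀ {M M' : ℕ → Matrix ι ι ℂ} {d : ℕ} {f}, Assigns d f M M' → M 20 = 1 → 24 < d →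
        M' 20 = 1 ∧ M' d = f M ∧ ∀ m, m ≠ d → m ≠ 23 → m ≠ 24 → M' m = M m :=
      fun hA hM hd => ⟨((hA hM).2 20 (by omega) (by norm_num) (by norm_num)).trans hM, hA hM⟩
    obtain ⟨i₁, j₁, l₁⟩ := next k₁ h20 (by norm_num)
    obtain ⟨i₂, j₂, l₂⟩ := next k₂ i₁ (by norm_num)
    obtain ⟨i₃, j₃, l₃⟩ := next k₃ i₂ (by norm_num)
    obtain ⟨i₄, j₄, l₄⟩ := next k₄ i₃ (by norm_num)
    obtain ⟨i₅, j₅, l₅⟩ := next k₅ i₄ (by norm_num)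
    obtain ⟨i₆, j₆, l₆⟩ := next k₆ i₅ (by norm_num)
    obtain ⟨i₇, j₇, l₇⟩ := next k₇ i₆ (by norm_num)
    obtain ⟨i₈, j₈, l₈⟩ := next k₈ i₇ (by norm_num)
    obtain ⟨i₉, j₉, l₉⟩ := next k₉ i₈ (by norm_num)
    obtain ⟨i₁₀, j₁₀, l₁₀⟩ := next k₁₀ i₉ (by norm_num)
    obtain ⟨i₁₁, j₁₁, l₁₁⟩ := next k₁₁ i₁₀ (by norm_num)
    obtain ⟨i₁₂, j₁₂, l₁₂⟩ := next k₁₂ i₁₁ (by norm_num)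
    obtain ⟨i₁₃, j₁₃, l₁₃⟩ := next k₁₃ i₁₂ (by norm_num)
    obtain ⟨i₁₄, j₁₄, l₁₄⟩ := next k₁₄ i₁₃ (by norm_num)
    obtain ⟨i₁₅, j₁₅, l₁₅⟩ := next k₁₅ i₁₄ (by norm_num)
    obtain ⟨i₁₆, j₁₆, l₁₆⟩ := next k₁₆ i₁₅ (by norm_num)
    have e22 : M₃ 22 = M 22 := by simp [l₁, l₂, l₃]
    have e26 : M₂ 26 = 1 - M 21 := by simp [j₂, i₁, l₁]
    have e27 : M₃ 27 = logIter K h (sc 12) (1 - M 21) := by rw [j₃, e26]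
    have e29 : M₅ 29 = 1 - M 22 := by simp [j₅, i₄, l₄, e22]
    have e30 : M₆ 30 = logIter K h (sc 12) (1 - M 22) := by rw [j₆, e29]
    have e28 : M₆ 28 = logIter K h (sc 12) (M 22) := by simp [l₆, l₅, j₄, e22]
    have e25 : M₈ 25 = logIter K h (sc 12) (M 21) := by
      simp [l₈, l₇, l₆, l₅, l₄, l₃, l₂, j₁]
    have e27' : M₈ 27 = logIter K h (sc 12) (1 - M 21) := by
      simp [l₈, l₇, l₆, l₅, l₄, e27]
    have e32 : M₈ 32 = expIter K (s * h) (logIter K h (sc 12) (M 22) -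
        logIter K h (sc 12) (1 - M 22)) := by rw [j₈, j₇, e28, e30, h9]
    have e34 : M₁₀ 34 = expIter K (r * h) (logIter K h (sc 12) (M 21) -
        logIter K h (sc 12) (1 - M 21)) := by rw [j₁₀, j₉, e25, e27', h10]
    have e36 : M₁₂ 36 = sandwichIter K h (sc 12) s r (M 21) (M 22) := by
      rw [j₁₂, l₁₁ 32 (by norm_num) (by norm_num) (by norm_num), j₁₁, e34,
        l₁₀ 32 (by norm_num) (by norm_num) (by norm_num),
        l₉ 32 (by norm_num) (by norm_num) (by norm_num), e32, sandwichIter]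
    refine ⟨?_, ?_, ?_⟩
    · simp [l₁₆, l₁₅, l₁₄, l₁₃, l₁₂, l₁₁, l₁₀, l₉, e27']
    · simp [l₁₆, l₁₅, l₁₄, l₁₃, l₁₂, l₁₁, l₁₀, l₉, l₈, l₇, e30]
    · rw [j₁₆, j₁₅, i₁₄, j₁₄, j₁₃, e36, h11]
  -- Six logarithms, three exponentials and seven elementary operations: 36 + 9 + 7 ≤ 60.
  · have h1 : (K + 1) * matTime N ≤ (K + 1) ^ 2 * matTime N :=
      Nat.mul_le_mul_right _ (Nat.le_self_pow two_ne_zero _)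
    have h2 : matTime N ≤ (K + 1) ^ 2 * matTime N := Nat.le_mul_of_pos_left _ (by positivity)
    simp only [mul_assoc]
    omega

end Iterations

/-! ### Scalar computations and the iteration count -/

section Scalars

/-- The state with counters `c` and arrays `A`, except that the first cells of the arrays
`4, …, 19` contain `σ`. -/
def scalarState (c : ℕ → ℕ) (A : ℕ → ℕ → ℕ → ℝ) (σ : ℕ → ℝ) : RamState where
  counter := c
  array := fun a k l => if (4 ≤ a ∧ a < 20) ∧ k = 0 ∧ l = 0 then σ a else A a k l

theorem store_scalar_exec {c : ℕ → ℕ} {A : ℕ → ℕ → ℕ → ℝ} {σ : ℕ → ℝ} (hc : c 3 = 0) {a : ℕ}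
    {x : RealExpr} {v : ℝ} (ha : 4 ≤ a ∧ a < 20) (hv : x.value (scalarState c A σ) = v) :
    RamExec (.store a 3 3 x) (scalarState c A σ) (x.cost + 1)
      (scalarState c A (Function.update σ a v)) := by
  have h := RamExec.store a 3 3 x (scalarState c A σ)
  have hs : (scalarState c A σ).setCell a ((scalarState c A σ).counter 3)
      ((scalarState c A σ).counter 3) (x.value (scalarState c A σ)) =
      scalarState c A (Function.update σ a v) := by
    rw [hv]
    simp only [scalarState, RamState.setCell, hc, Function.update_apply]
    congr 1
    ext a' k l
    by_cases h1 : a' = a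
    · subst h1
      by_cases h2 : k = 0 ∧ l = 0
      · simp [h2, ha]
      · simp [h2]
    · simp [h1]
  rwa [hs] at h

/-- The loop `for c in 0, …, (counter b) - 1 do cell a += 1`. -/
theorem count_exec {c : ℕ → ℕ} {A : ℕ → ℕ → ℕ → ℝ} {σ : ℕ → ℝ} (hc : c 3 = 0) {a b : ℕ}
    (ha : 4 ≤ a ∧ a < 20) (hb : b ≠ 7) (hσ : σ a = 0) :
    ∃ t v, RamExec (forLoop 7 b (.store a 3 3 (.add (.cell a 3 3) (.nat 1)))) (scalarState c A σ) t
      (scalarState (Function.update c 7 v) A (Function.update σ a (c b))) ∧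
      t ≤ c b * (4 + 2) + 2 := by
  obtain ⟨t, s', h1, h2, v, h3⟩ := forLoop_exec (c := 7) (b := b) (n := c b) (T := 4)
    (P := .store a 3 3 (.add (.cell a 3 3) (.nat 1))) (s₀ := scalarState c A σ)
    (fun k s => ∃ v, s = scalarState (Function.update c 7 v) A (Function.update σ a k))
    ⟨0, by simp [scalarState, RamState.setCounter, ← hσ]⟩
    (by
      rintro k s ⟨v, rfl⟩
      exact Function.update_of_ne hb _ _)
    (by
      rintro k s hk ⟨v, rfl⟩ hv
      refine ⟨_, _, store_scalar_exec (v := ((k + 1 : ℕ) : ℝ)) ?_ ha ?_, le_rfl, hv, k + 1, ?_⟩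
      · rw [Function.update_of_ne (by norm_num), hc]
      · simp [RealExpr.value, scalarState, hc, ha]
      · simp [scalarState, RamState.setCounter])
  exact ⟨t, v, h3 ▸ h1, h2⟩

/-- The loop that determines the number of iterations `K` and the step size `2⁻ᴷ`. -/
def ceilProg : RamProgram :=
  .whileDo (.realLt (.cell 14 3 3) (.cell 13 3 3)) (.seq (.incr 6) (.seq
    (.store 14 3 3 (.add (.cell 14 3 3) (.nat 1))) (.store 7 3 3 (.div (.cell 7 3 3) (.nat 2)))))

/-- Counter 6 and cell 14 both hold k while cell 7 holds 2^(-k). The loop stops at the first k that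
is not below the real bound in cell 13, that is, at its ceiling. A round costs 3 + 1 + 4 + 4 = 12.
-/
theorem ceilProg_exec {c : ℕ → ℕ} {A : ℕ → ℕ → ℕ → ℝ} {σ : ℕ → ℝ} (hc : c 3 = 0) :
    ∃ t, RamExec ceilProg (scalarState (Function.update c 6 0) A
        (Function.update (Function.update σ 14 0) 7 1)) t
      (scalarState (Function.update c 6 ⌈σ 13⌉₊) A
        (Function.update (Function.update σ 14 ⌈σ 13⌉₊) 7 ((1 / 2) ^ ⌈σ 13⌉₊))) ∧
      t ≤ ⌈σ 13⌉₊ * 12 + 3 := by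
  have key : ∀ j k : ℕ, k + j = ⌈σ 13⌉₊ → ∃ t, RamExec ceilProg
      (scalarState (Function.update c 6 k) A
        (Function.update (Function.update σ 14 k) 7 ((1 / 2) ^ k))) t
      (scalarState (Function.update c 6 ⌈σ 13⌉₊) A
        (Function.update (Function.update σ 14 ⌈σ 13⌉₊) 7 ((1 / 2) ^ ⌈σ 13⌉₊))) ∧
      t ≤ j * 12 + 3 := by
    intro j
    induction j with
    | zero =>
      intro k hk
      obtain rfl : k = ⌈σ 13⌉₊ := by omega
      refine ⟨_, RamExec.whileFalse ?_, by simp [RamTest.cost, RealExpr.cost]⟩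
      simpa [RamTest.Holds, RealExpr.value, scalarState, hc] using Nat.le_ceil (σ 13)
    | succ j ih =>
      intro k hk
      obtain ⟨t, ht, ht'⟩ := ih (k + 1) (by omega)
      have hlt : (k : ℝ) < σ 13 := Nat.lt_ceil.1 (by omega)
      have h1 := RamExec.incr 6 (scalarState (Function.update c 6 k) A
        (Function.update (Function.update σ 14 k) 7 ((1 / 2) ^ k)))
      have h1' : (scalarState (Function.update c 6 k) A
          (Function.update (Function.update σ 14 k) 7 ((1 / 2) ^ k))).setCounter 6
          ((scalarState (Function.update c 6 k) A
            (Function.update (Function.update σ 14 k) 7 ((1 / 2) ^ k))).counter 6 + 1) =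
          scalarState (Function.update c 6 (k + 1)) A
            (Function.update (Function.update σ 14 k) 7 ((1 / 2) ^ k)) := by
        simp [scalarState, RamState.setCounter]
      rw [h1'] at h1
      have h2 := store_scalar_exec (c := Function.update c 6 (k + 1)) (A := A)
        (σ := Function.update (Function.update σ 14 k) 7 ((1 / 2) ^ k)) (a := 14)
        (x := .add (.cell 14 3 3) (.nat 1)) (v := ((k + 1 : ℕ) : ℝ)) (by simpa using hc)
        (by norm_num) (by simp [RealExpr.value, scalarState, hc])
      have h3 := store_scalar_exec (c := Function.update c 6 (k + 1)) (A := A)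
        (σ := Function.update (Function.update (Function.update σ 14 k) 7 ((1 / 2) ^ k)) 14
          ((k + 1 : ℕ) : ℝ)) (a := 7)
        (x := .div (.cell 7 3 3) (.nat 2)) (v := (1 / 2) ^ (k + 1)) (by simpa using hc)
        (by norm_num) (by simp [RealExpr.value, scalarState, hc, pow_succ, div_eq_mul_inv])
      have h4 : Function.update (Function.update (Function.update (Function.update σ 14 (k : ℝ)) 7
          ((1 / 2) ^ k)) 14 ((k + 1 : ℕ) : ℝ)) 7 ((1 / 2) ^ (k + 1)) =
          Function.update (Function.update σ 14 ((k + 1 : ℕ) : ℝ)) 7 ((1 / 2) ^ (k + 1)) := by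
        ext x
        simp only [Function.update_apply]
        split_ifs <;> rfl
      rw [h4] at h3
      refine ⟨_, RamExec.whileTrue ?_ (RamExec.seq h1 (RamExec.seq h2 h3)) ht, ?_⟩
      · simpa [RamTest.Holds, RealExpr.value, scalarState, hc] using hlt
      · simp only [RamTest.cost, RealExpr.cost]
        omega
  simpa using key ⌈σ 13⌉₊ 0 (by omega)

end Scalars

/-! ### Initialization of counters and scalars -/

section Setup

/-- The program `P` leads from `s` to `s'` in at most `T` steps. -/
def Reaches (P : RamProgram) (s s' : RamState) (T : ℕ) : Prop := ∃ t ≤ T, RamExec P s t s'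

theorem Reaches.seq {P Q : RamProgram} {s s₁ s₂ : RamState} {T T' : ℕ} (h : Reaches P s s₁ T)
    (h' : Reaches Q s₁ s₂ T') : Reaches (.seq P Q) s s₂ (T + T') := by
  obtain ⟨t, ht, e⟩ := h
  obtain ⟨t', ht', e'⟩ := h'
  exact ⟨t + t', by omega, e.seq e'⟩

theorem Reaches.mono {P : RamProgram} {s s' : RamState} {T T' : ℕ} (h : Reaches P s s' T)
    (hT : T ≤ T') : Reaches P s s' T' := by
  obtain ⟨t, ht, e⟩ := h
  exact ⟨t, by omega, e⟩

/-- An upper bound for the parameters of the formula for the mutual information. -/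
noncomputable def paramSize (α z : ℝ) : ℝ :=
  2 + ((1 - α) / (2 * z)) ^ 2 + (α / z) ^ 2 + z ^ 2 + (1 / (1 - α)) ^ 2 + α ^ 2

/-- The starting value of the iteration for the logarithm. -/
noncomputable def iterStart (α z : ℝ) (n : ℕ) : ℝ := 8 * paramSize α z ^ 2 * (n + 1)

/-- The number of iterations. -/
noncomputable def iterCount (α z : ℝ) (N n : ℕ) : ℕ :=
  ⌈(1 + 2 * iterStart α z n) * (12 * iterStart α z n + 4 * N + 5)⌉₊

/-- Computation of the number of modes. -/
def counterProg : RamProgram := .seq (.incr 4) (.seq (.copy 5 0) (forLoop 7 1 (.incr 5)))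

/-- Counter 3 keeps the value 0 and counter 4 receives the value 1; they serve as the addresses of
the cells (0, 0) and (0, 1), where α and z are found. -/
theorem counterProg_exec {c : ℕ → ℕ} {A : ℕ → ℕ → ℕ → ℝ} {σ : ℕ → ℝ} (h4 : c 4 = 0) :
    ∃ c', Reaches counterProg (scalarState c A σ) (scalarState c' A σ) (c 1 * 3 + 4) ∧
      (∀ x, x < 4 ∨ x = 6 → c' x = c x) ∧ c' 4 = 1 ∧ c' 5 = c 0 + c 1 := by
  have h1 := RamExec.incr 4 (scalarState c A σ)
  have h2 := RamExec.copy 5 0 ((scalarState c A σ).setCounter 4 ((scalarState c A σ).counter 4 + 1))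
  obtain ⟨t, s', e1, e2, ⟨v, rfl⟩⟩ := forLoop_exec (c := 7) (b := 1) (n := c 1) (T := 1)
    (P := .incr 5)
    (fun k s => ∃ v, s = scalarState (Function.update (Function.update (Function.update c 4 1) 5
      (c 0 + k)) 7 v) A σ)
    (s₀ := ((scalarState c A σ).setCounter 4 ((scalarState c A σ).counter 4 + 1)).setCounter 5
      (((scalarState c A σ).setCounter 4 ((scalarState c A σ).counter 4 + 1)).counter 0))
    ⟨0, by simp [scalarState, RamState.setCounter, h4]⟩
    (by
      rintro k s ⟨v, rfl⟩
      simp [scalarState])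
    (by
      rintro k s hk ⟨v, rfl⟩ hv
      refine ⟨_, _, RamExec.incr _ _, le_rfl, ?_, k + 1, ?_⟩
      · simpa [setCounter_counter] using hv
      · simp only [scalarState, RamState.setCounter]
        congr 1
        ext x
        simp only [Function.update_apply]
        split_ifs <;> simp_all [add_assoc])
  refine ⟨_, ⟨_, ?_, h1.seq (h2.seq e1)⟩, ?_, ?_, ?_⟩
  · omega
  · rintro x hx
    rw [Function.update_of_ne (by omega), Function.update_of_ne (by omega),
      Function.update_of_ne (by omega)]
  · simp
  · simp

/-- The initialization of the scalars. -/
def scalarProg : RamProgram :=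
  .seq (forLoop 7 5 (.store 15 3 3 (.add (.cell 15 3 3) (.nat 1)))) <|
  .seq (forLoop 7 2 (.store 16 3 3 (.add (.cell 16 3 3) (.nat 1)))) <|
  .seq (.store 5 3 3 (.nat 1)) <|
  .seq (.store 6 3 3 (.sub (.nat 0) (.nat 1))) <|
  .seq (.store 9 3 3 (.div (.sub (.nat 1) (.cell 2 3 3)) (.mul (.nat 2) (.cell 2 3 4)))) <|
  .seq (.store 10 3 3 (.div (.cell 2 3 3) (.cell 2 3 4))) <|
  .seq (.store 19 3 3 (.div (.nat 1) (.sub (.nat 1) (.cell 2 3 3)))) <|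
  .seq (.store 18 3 3 (.div (.cell 2 3 3) (.sub (.nat 1) (.cell 2 3 3)))) <|
  .seq (.store 17 3 3 (.add (.add (.add (.add (.add (.nat 2) (.mul (.cell 9 3 3) (.cell 9 3 3)))
    (.mul (.cell 10 3 3) (.cell 10 3 3))) (.mul (.cell 2 3 4) (.cell 2 3 4)))
    (.mul (.cell 19 3 3) (.cell 19 3 3))) (.mul (.cell 2 3 3) (.cell 2 3 3)))) <|
  .seq (.store 12 3 3 (.mul (.mul (.nat 8) (.mul (.cell 17 3 3) (.cell 17 3 3)))
    (.add (.cell 16 3 3) (.nat 1)))) <|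
  .seq (.store 13 3 3 (.mul (.add (.nat 1) (.mul (.nat 2) (.cell 12 3 3)))
    (.add (.add (.mul (.nat 12) (.cell 12 3 3)) (.mul (.nat 4) (.cell 15 3 3))) (.nat 5)))) <|
  .seq (.store 14 3 3 (.nat 0)) <|
  .seq (.store 7 3 3 (.nat 1)) <|
  .seq ceilProg <|
  .seq (.store 8 3 3 (.sub (.nat 0) (.cell 7 3 3))) <|
  .seq (.store 9 3 3 (.mul (.cell 9 3 3) (.cell 7 3 3))) <|
  .seq (.store 10 3 3 (.mul (.cell 10 3 3) (.cell 7 3 3)))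
    (.store 11 3 3 (.mul (.cell 2 3 4) (.cell 7 3 3)))

set_option maxHeartbeats 2000000 in
theorem scalarProg_exec {c : ℕ → ℕ} {A : ℕ → ℕ → ℕ → ℝ} {α z : ℝ} (h3 : c 3 = 0) (h4 : c 4 = 1)
    (h6 : c 6 = 0) (hα : A 2 0 0 = α) (hz : A 2 0 1 = z) :
    ∃ c' σ, Reaches scalarProg (scalarState c A 0) (scalarState c' A σ)
        (c 5 * 6 + c 2 * 6 + iterCount α z (c 5) (c 2) * 12 + 200) ∧
      (∀ x, x < 6 → c' x = c x) ∧ c' 6 = iterCount α z (c 5) (c 2) ∧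
      σ 4 = 0 ∧ σ 5 = 1 ∧ σ 6 = -1 ∧ σ 8 = -((1 / 2) ^ iterCount α z (c 5) (c 2)) ∧
      σ 9 = (1 - α) / (2 * z) * (1 / 2) ^ iterCount α z (c 5) (c 2) ∧
      σ 10 = α / z * (1 / 2) ^ iterCount α z (c 5) (c 2) ∧
      σ 11 = z * (1 / 2) ^ iterCount α z (c 5) (c 2) ∧ σ 12 = iterStart α z (c 2) ∧
      σ 18 = α / (1 - α) ∧ σ 19 = 1 / (1 - α) := by
  -- Expressions cannot read a counter as a number, so N and n become real numbers by counting up in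
  -- the cells 15 and 16.
  obtain ⟨t₁, v₁, e₁, f₁⟩ := count_exec (c := c) (A := A) (σ := 0) h3 (a := 15) (b := 5)
    (by norm_num) (by norm_num) rfl
  obtain ⟨t₂, v₂, e₂, f₂⟩ := count_exec (c := Function.update c 7 v₁) (A := A)
    (σ := Function.update 0 15 (c 5)) (by simpa using h3) (a := 16) (b := 2)
    (by norm_num) (by norm_num) (by simp)
  have hn : Function.update c 7 v₁ 2 = c 2 := by simp
  rw [Function.update_idem, hn] at e₂
  rw [hn] at f₂
  set N := c 5
  set n := c 2
  set c₂ := Function.update c 7 v₂ with hc₂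
  have k3 : c₂ 3 = 0 := by simpa [hc₂] using h3
  have k4 : c₂ 4 = 1 := by simpa [hc₂] using h4
  -- Counter 6 is still 0, so the search for the ceiling needs no reset.
  have k6 : Function.update c₂ 6 0 = c₂ := by
    rw [Function.update_eq_self_iff]
    simp [hc₂, h6]
  have e₃ := store_scalar_exec (A := A) (σ := Function.update (Function.update 0 15 (N : ℝ)) 16 n)
    k3 (a := 5) (x := .nat 1) (v := 1) (by norm_num) (by simp [RealExpr.value])
  have e₄ := store_scalar_exec (A := A) (σ := Function.update (Function.update (Function.update 0
    15 (N : ℝ)) 16 n) 5 1) k3 (a := 6) (x := .sub (.nat 0) (.nat 1)) (v := -1) (by norm_num)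
    (by simp [RealExpr.value])
  set σ₄ := Function.update (Function.update (Function.update (Function.update (0 : ℕ → ℝ)
    15 (N : ℝ)) 16 n) 5 1) 6 (-1) with hσ₄
  have e₅ := store_scalar_exec (A := A) (σ := σ₄) k3 (a := 9)
    (x := .div (.sub (.nat 1) (.cell 2 3 3)) (.mul (.nat 2) (.cell 2 3 4)))
    (v := (1 - α) / (2 * z)) (by norm_num) (by simp [RealExpr.value, scalarState, k3, k4, hα, hz])
  set σ₅ := Function.update σ₄ 9 ((1 - α) / (2 * z)) with hσ₅
  have e₆ := store_scalar_exec (A := A) (σ := σ₅) k3 (a := 10)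
    (x := .div (.cell 2 3 3) (.cell 2 3 4))
    (v := α / z) (by norm_num) (by simp [RealExpr.value, scalarState, k3, k4, hα, hz])
  set σ₆ := Function.update σ₅ 10 (α / z) with hσ₆
  have e₇ := store_scalar_exec (A := A) (σ := σ₆) k3 (a := 19)
    (x := .div (.nat 1) (.sub (.nat 1) (.cell 2 3 3)))
    (v := 1 / (1 - α)) (by norm_num) (by simp [RealExpr.value, scalarState, k3, hα])
  set σ₇ := Function.update σ₆ 19 (1 / (1 - α)) with hσ₇
  have e₈ := store_scalar_exec (A := A) (σ := σ₇) k3 (a := 18)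
    (x := .div (.cell 2 3 3) (.sub (.nat 1) (.cell 2 3 3)))
    (v := α / (1 - α)) (by norm_num) (by simp [RealExpr.value, scalarState, k3, hα])
  set σ₈ := Function.update σ₇ 18 (α / (1 - α)) with hσ₈
  have e₉ := store_scalar_exec (A := A) (σ := σ₈) k3 (a := 17)
    (x := .add (.add (.add (.add (.add (.nat 2) (.mul (.cell 9 3 3) (.cell 9 3 3)))
      (.mul (.cell 10 3 3) (.cell 10 3 3))) (.mul (.cell 2 3 4) (.cell 2 3 4)))
      (.mul (.cell 19 3 3) (.cell 19 3 3))) (.mul (.cell 2 3 3) (.cell 2 3 3)))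
    (v := paramSize α z) (by norm_num)
    (by simp [RealExpr.value, scalarState, k3, k4, hα, hz, hσ₈, hσ₇, hσ₆, hσ₅, paramSize, sq])
  set σ₉ := Function.update σ₈ 17 (paramSize α z) with hσ₉
  have e₁₀ := store_scalar_exec (A := A) (σ := σ₉) k3 (a := 12)
    (x := .mul (.mul (.nat 8) (.mul (.cell 17 3 3) (.cell 17 3 3))) (.add (.cell 16 3 3) (.nat 1)))
    (v := iterStart α z n) (by norm_num)
    (by simp [RealExpr.value, scalarState, k3, hσ₉, hσ₈, hσ₇, hσ₆, hσ₅, hσ₄, iterStart, sq])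
  set σ₁₀ := Function.update σ₉ 12 (iterStart α z n) with hσ₁₀
  have e₁₁ := store_scalar_exec (A := A) (σ := σ₁₀) k3 (a := 13)
    (x := .mul (.add (.nat 1) (.mul (.nat 2) (.cell 12 3 3)))
      (.add (.add (.mul (.nat 12) (.cell 12 3 3)) (.mul (.nat 4) (.cell 15 3 3))) (.nat 5)))
    (v := (1 + 2 * iterStart α z n) * (12 * iterStart α z n + 4 * N + 5)) (by norm_num)
    (by simp [RealExpr.value, scalarState, k3, hσ₁₀, hσ₉, hσ₈, hσ₇, hσ₆, hσ₅, hσ₄])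
  set σ₁₁ := Function.update σ₁₀ 13 ((1 + 2 * iterStart α z n) * (12 * iterStart α z n + 4 * N + 5))
    with hσ₁₁
  have e₁₂ := store_scalar_exec (A := A) (σ := σ₁₁) k3 (a := 14) (x := .nat 0) (v := 0)
    (by norm_num) (by simp [RealExpr.value])
  have e₁₃ := store_scalar_exec (A := A) (σ := Function.update σ₁₁ 14 0) k3 (a := 7) (x := .nat 1)
    (v := 1) (by norm_num) (by simp [RealExpr.value])
  obtain ⟨t₁₄, e₁₄, f₁₄⟩ := ceilProg_exec (A := A) (σ := σ₁₁) k3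
  have hK : ⌈σ₁₁ 13⌉₊ = iterCount α z N n := by simp [hσ₁₁, iterCount]
  rw [k6, hK] at e₁₄
  rw [hK] at f₁₄
  set K := iterCount α z N n
  set c₃ := Function.update c₂ 6 K with hc₃
  have i3 : c₃ 3 = 0 := by simpa [hc₃] using k3
  have i4 : c₃ 4 = 1 := by simpa [hc₃] using k4
  set h : ℝ := (1 / 2) ^ K with hh
  set σ₁₄ := Function.update (Function.update σ₁₁ 14 (K : ℝ)) 7 h with hσ₁₄
  have e₁₅ := store_scalar_exec (A := A) (σ := σ₁₄) i3 (a := 8) (x := .sub (.nat 0) (.cell 7 3 3))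
    (v := -h) (by norm_num) (by simp [RealExpr.value, scalarState, i3, hσ₁₄])
  set σ₁₅ := Function.update σ₁₄ 8 (-h) with hσ₁₅
  -- The cells 9 and 10 held the bare exponents as long as the size of the parameters was computed;
  -- from now on they hold them multiplied by the step size.
  have e₁₆ := store_scalar_exec (A := A) (σ := σ₁₅) i3 (a := 9)
    (x := .mul (.cell 9 3 3) (.cell 7 3 3)) (v := (1 - α) / (2 * z) * h) (by norm_num)
    (by simp [RealExpr.value, scalarState, i3, hσ₁₅, hσ₁₄, hσ₁₁, hσ₁₀, hσ₉, hσ₈, hσ₇, hσ₆, hσ₅])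
  set σ₁₆ := Function.update σ₁₅ 9 ((1 - α) / (2 * z) * h) with hσ₁₆
  have e₁₇ := store_scalar_exec (A := A) (σ := σ₁₆) i3 (a := 10)
    (x := .mul (.cell 10 3 3) (.cell 7 3 3)) (v := α / z * h) (by norm_num)
    (by simp [RealExpr.value, scalarState, i3, hσ₁₆, hσ₁₅, hσ₁₄, hσ₁₁, hσ₁₀, hσ₉, hσ₈, hσ₇, hσ₆])
  set σ₁₇ := Function.update σ₁₆ 10 (α / z * h) with hσ₁₇
  have e₁₈ := store_scalar_exec (A := A) (σ := σ₁₇) i3 (a := 11)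
    (x := .mul (.cell 2 3 4) (.cell 7 3 3)) (v := z * h) (by norm_num)
    (by simp [RealExpr.value, scalarState, i3, i4, hz, hσ₁₇, hσ₁₆, hσ₁₅, hσ₁₄])
  refine ⟨c₃, Function.update σ₁₇ 11 (z * h), ⟨_, ?_, e₁.seq <| e₂.seq <| e₃.seq <| e₄.seq <|
    e₅.seq <| e₆.seq <| e₇.seq <| e₈.seq <| e₉.seq <| e₁₀.seq <| e₁₁.seq <| e₁₂.seq <| e₁₃.seq <|
    e₁₄.seq <| e₁₅.seq <| e₁₆.seq <| e₁₇.seq e₁₈⟩, ?_, ?_, ?_⟩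
  · simp only [RealExpr.cost]
    omega
  · intro x hx
    rw [hc₃, hc₂, Function.update_of_ne (by omega), Function.update_of_ne (by omega)]
  · simp [hc₃]
  · simp [hσ₁₇, hσ₁₆, hσ₁₅, hσ₁₄, hσ₁₁, hσ₁₀, hσ₉, hσ₈, hσ₇, hσ₆, hσ₅, hσ₄]

end Setup

/-! ### Loading the matrices, output, and the complete program -/

section LoadAndOutput

/-- A double loop that fills the arrays `a` and `a + 1`. -/
theorem fillPair_reaches {N T a : ℕ} {P : RamProgram} {s₀ : RamState} (f g : ℕ → ℕ → ℝ)
    (hN : s₀.counter 5 = N)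
    (hP : ∀ i j s, i < N → j < N → s.counter 7 = i → s.counter 8 = j →
      (∀ x, x < 7 → s.counter x = s₀.counter x) →
      (∀ x, x ≠ a → x ≠ a + 1 → s.array x = s₀.array x) →
      Reaches P s ((s.setCell a i j (f i j)).setCell (a + 1) i j (g i j)) T) :
    ∃ s', Reaches (forLoop 7 5 (forLoop 8 5 P)) s₀ s' (N * ((N * (T + 2) + 2) + 2) + 2) ∧
      (∀ x, x < 7 → s'.counter x = s₀.counter x) ∧
      (∀ x, x ≠ a → x ≠ a + 1 → s'.array x = s₀.array x) ∧
      (∀ i j, i < N → j < N → s'.array a i j = f i j ∧ s'.array (a + 1) i j = g i j) := by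
  set val : ℕ → ℕ → ℕ → ℝ := fun x i j => if x = a then f i j else g i j with hval
  obtain ⟨t, s', e1, e2, e3, e4⟩ := matLoop_exec (N := N) (T := T) (P := P) (s₀ := s₀)
    (tgt := fun x => x = a ∨ x = a + 1) (val := val) hN
    (by
      intro i j s hi hj h7 h8 hc ha
      obtain ⟨t, ht, h⟩ := hP i j s hi hj h7 h8 (fun x hx => hc x (Or.inl hx)) (by
        intro x hx hx'
        ext k l
        rw [ha, partialFill_of_not_tgt (by omega)])
      refine ⟨t, _, h, ht, fun _ _ => rfl, ?_⟩
      ext x k l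
      rw [partialFill_succ _ _ _ _ _ _ hj, ← ha]
      simp only [setCell_array, hval]
      by_cases hx : x = a
      · subst hx
        simp
      · by_cases hx' : x = a + 1
        · subst hx'
          simp
        · simp [hx, hx'])
  refine ⟨s', ⟨t, e2, e1⟩, fun x hx => e3 x (Or.inl hx), fun x hx hx' => ?_, fun i j hi hj => ?_⟩
  · rw [e4]
    ext k l
    exact if_neg (fun h => by omega)
  · rw [e4]
    simp [hi, hj, hval]

/-- Store a complex number as an entry of the matrix in the arrays `a` and `a + 1`. -/
def storePair (a : ℕ) (x y : RealExpr) : RamProgram :=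
  .seq (.store a 7 8 x) (.store (a + 1) 7 8 y)

theorem storePair_reaches {a i j : ℕ} {x y : RealExpr} {s : RamState} {v w : ℝ}
    (h7 : s.counter 7 = i) (h8 : s.counter 8 = j) (hx : x.value s = v)
    (hy : y.value (s.setCell a i j v) = w) (hcx : x.cost = 1) (hcy : y.cost = 1) :
    Reaches (storePair a x y) s ((s.setCell a i j v).setCell (a + 1) i j w) 4 := by
  have h1 := RamExec.store a 7 8 x s
  rw [h7, h8, hx, hcx] at h1
  have h2 := RamExec.store (a + 1) 7 8 y (s.setCell a i j v)
  rw [setCell_counter, h7, h8, hy, hcy] at h2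
  exact ⟨_, le_rfl, h1.seq h2⟩

theorem reaches_ite {b : RamTest} {P Q : RamProgram} {s s' : RamState} {T : ℕ}
    (h : b.Holds s → Reaches P s s' T) (h' : ¬ b.Holds s → Reaches Q s s' T) :
    Reaches (.ifThenElse b P Q) s s' (b.cost + T) := by
  by_cases hb : b.Holds s
  · obtain ⟨t, ht, e⟩ := h hb
    exact ⟨_, by omega, RamExec.ifTrue hb e⟩
  · obtain ⟨t, ht, e⟩ := h' hb
    exact ⟨_, by omega, RamExec.ifFalse hb e⟩

/-- Load the identity matrix. -/
def loadOne : RamProgram :=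
  forLoop 7 5 <| forLoop 8 5 <| .ifThenElse (.counterLt 7 8) (storePair 40 (.nat 0) (.nat 0))
    (.ifThenElse (.counterLt 8 7) (storePair 40 (.nat 0) (.nat 0))
      (storePair 40 (.nat 1) (.nat 0)))

/-- Load the correlation matrix. -/
def loadCorr : RamProgram :=
  forLoop 7 5 <| forLoop 8 5 <| storePair 42 (.cell 0 7 8) (.cell 1 7 8)

/-- Load the block diagonal part of the correlation matrix. -/
def loadBlock : RamProgram :=
  forLoop 7 5 <| forLoop 8 5 <| .ifThenElse (.counterLt 7 0)
    (.ifThenElse (.counterLt 8 0) (storePair 44 (.cell 0 7 8) (.cell 1 7 8))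
      (storePair 44 (.nat 0) (.nat 0)))
    (.ifThenElse (.counterLt 8 0) (storePair 44 (.nat 0) (.nat 0))
      (storePair 44 (.cell 0 7 8) (.cell 1 7 8)))

/-- The modes of `A` come first, so two indices lie in the same block exactly when both or neither
are below `NA`. An entry costs at most two comparisons and two stores of cost 2, hence 6. -/
theorem load_reaches {s : RamState} {NA N : ℕ} (h0 : s.counter 0 = NA) (h5 : s.counter 5 = N) :
    ∃ s', Reaches (.seq loadOne (.seq loadCorr loadBlock)) s s'
        (3 * (N * ((N * (6 + 2) + 2) + 2) + 2)) ∧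
      (∀ x, x < 7 → s'.counter x = s.counter x) ∧
      (∀ x, x < 40 → s'.array x = s.array x) ∧
      (∀ i j, i < N → j < N →
        (s'.array 40 i j = if i = j then 1 else 0) ∧ s'.array 41 i j = 0 ∧
        s'.array 42 i j = s.array 0 i j ∧ s'.array 43 i j = s.array 1 i j ∧
        (s'.array 44 i j = if i < NA ↔ j < NA then s.array 0 i j else 0) ∧
        (s'.array 45 i j = if i < NA ↔ j < NA then s.array 1 i j else 0)) := by
  obtain ⟨s₁, a1, a2, a3, a4⟩ := fillPair_reaches (N := N) (T := 6) (a := 40) (s₀ := s)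
    (P := .ifThenElse (.counterLt 7 8) (storePair 40 (.nat 0) (.nat 0))
    (.ifThenElse (.counterLt 8 7) (storePair 40 (.nat 0) (.nat 0))
      (storePair 40 (.nat 1) (.nat 0)))) (fun i j => if i = j then 1 else 0) (fun _ _ => 0) h5
    (by
      intro i j s₁ hi hj h7 h8 hc ha
      refine reaches_ite (T := 5) (fun hb => ?_) (fun hb => reaches_ite (T := 4) (fun hb' => ?_)
        (fun hb' => ?_))
      · simp only [RamTest.Holds, h7, h8] at hb
        refine (storePair_reaches h7 h8 ?_ ?_ rfl rfl).mono (by norm_num) <;>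
          simp [RealExpr.value, hb.ne]
      · simp only [RamTest.Holds, h7, h8] at hb'
        refine (storePair_reaches h7 h8 ?_ ?_ rfl rfl) <;>
          simp [RealExpr.value, hb'.ne']
      · simp only [RamTest.Holds, h7, h8] at hb hb'
        refine (storePair_reaches h7 h8 ?_ ?_ rfl rfl) <;>
          simp [RealExpr.value, show i = j by omega])
  obtain ⟨s₂, b1, b2, b3, b4⟩ := fillPair_reaches (N := N) (T := 6) (a := 42) (s₀ := s₁)
    (P := storePair 42 (.cell 0 7 8) (.cell 1 7 8)) (s₁.array 0) (s₁.array 1)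
    ((a2 5 (by norm_num)).trans h5)
    (by
      intro i j s₂ hi hj h7 h8 hc ha
      refine (storePair_reaches h7 h8 ?_ ?_ rfl rfl).mono (by norm_num)
      · rw [RealExpr.value, h7, h8, ha 0 (by norm_num) (by norm_num)]
      · rw [RealExpr.value, setCell_counter, h7, h8, setCell_array, if_neg (by norm_num),
          ha 1 (by norm_num) (by norm_num)])
  obtain ⟨s₃, c1, c2, c3, c4⟩ := fillPair_reaches (N := N) (T := 6) (a := 44) (s₀ := s₂)
    (P := .ifThenElse (.counterLt 7 0)
    (.ifThenElse (.counterLt 8 0) (storePair 44 (.cell 0 7 8) (.cell 1 7 8))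
      (storePair 44 (.nat 0) (.nat 0)))
    (.ifThenElse (.counterLt 8 0) (storePair 44 (.nat 0) (.nat 0))
      (storePair 44 (.cell 0 7 8) (.cell 1 7 8))))
    (fun i j => if i < NA ↔ j < NA then s₂.array 0 i j else 0)
    (fun i j => if i < NA ↔ j < NA then s₂.array 1 i j else 0)
    ((b2 5 (by norm_num)).trans ((a2 5 (by norm_num)).trans h5))
    (by
      intro i j s₃ hi hj h7 h8 hc ha
      have g0 : s₃.counter 0 = NA := by
        rw [hc 0 (by norm_num), b2 0 (by norm_num), a2 0 (by norm_num), h0]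
      refine reaches_ite (T := 5) (fun hb => reaches_ite (T := 4) (fun hb' => ?_)
        (fun hb' => ?_)) (fun hb => reaches_ite (T := 4) (fun hb' => ?_)
        (fun hb' => ?_))
      all_goals
        simp only [RamTest.Holds, h7, h8, g0] at hb hb'
        refine (storePair_reaches h7 h8 ?_ ?_ rfl rfl) <;>
          simp [RealExpr.value, hb, hb', setCell_array, setCell_counter, h7, h8, ha])
  refine ⟨s₃, (a1.seq (b1.seq c1)).mono (by omega), fun x hx => ?_, fun x hx => ?_,
    fun i j hi hj => ?_⟩
  · rw [c2 x hx, b2 x hx, a2 x hx]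
  · rw [c3 x (by omega) (by omega), b3 x (by omega) (by omega), a3 x (by omega) (by omega)]
  · have e0 : s₂.array 0 = s.array 0 := by
      rw [b3 0 (by norm_num) (by norm_num), a3 0 (by norm_num) (by norm_num)]
    have e1 : s₂.array 1 = s.array 1 := by
      rw [b3 1 (by norm_num) (by norm_num), a3 1 (by norm_num) (by norm_num)]
    refine ⟨?_, ?_, ?_, ?_, ?_, ?_⟩
    · rw [c3 40 (by norm_num) (by norm_num), b3 40 (by norm_num) (by norm_num), (a4 i j hi hj).1]
    · rw [c3 41 (by norm_num) (by norm_num), b3 41 (by norm_num) (by norm_num), (a4 i j hi hj).2]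
    · rw [c3 42 (by norm_num) (by norm_num), (b4 i j hi hj).1, a3 0 (by norm_num) (by norm_num)]
    · rw [c3 43 (by norm_num) (by norm_num), (b4 i j hi hj).2, a3 1 (by norm_num) (by norm_num)]
    · rw [(c4 i j hi hj).1, e0]
    · rw [(c4 i j hi hj).2, e1]

/-- The output of the linear combination of three traces. -/
def outputProg : RamProgram :=
  forLoop 7 5 (.store 3 3 3 (.sub (.cell 3 3 3) (.add (.add (.mul (.cell 18 3 3) (.cell 54 7 7))
    (.cell 60 7 7)) (.mul (.cell 19 3 3) (.cell 78 7 7)))))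

/-- The arrays 54, 60 and 78 are the real parts of the matrices 27, 30 and 39. The output cell has
to start at 0 because the diagonal entries are subtracted from it one by one. -/
theorem outputProg_reaches {ι : Type*} [Fintype ι] {N : ℕ} (e : ι ≃ Fin N) {s : RamState}
    (h3 : s.counter 3 = 0) (h5 : s.counter 5 = N) (hs : s.array 3 0 0 = 0) :
    ∃ s', Reaches outputProg s s' (N * (12 + 2) + 2) ∧
      s'.output = -(s.array 18 0 0 * (storedMat e s 27).trace.re) - (storedMat e s 30).trace.re -
        s.array 19 0 0 * (storedMat e s 39).trace.re := by
  set F : ℕ → ℝ := fun i => s.array 18 0 0 * s.array 54 i i + s.array 60 i i +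
    s.array 19 0 0 * s.array 78 i i with hF
  obtain ⟨t, s', e1, e2, e3, e4, e5⟩ := forLoop_exec (c := 7) (b := 5) (n := N) (T := 12)
    (P := .store 3 3 3 (.sub (.cell 3 3 3) (.add (.add (.mul (.cell 18 3 3) (.cell 54 7 7))
      (.cell 60 7 7)) (.mul (.cell 19 3 3) (.cell 78 7 7)))))
    (fun k s' => (∀ x, x ≠ 7 → s'.counter x = s.counter x) ∧
      (∀ x, x ≠ 3 → s'.array x = s.array x) ∧ s'.array 3 0 0 = -∑ i ∈ Finset.range k, F i)
    (s₀ := s)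
    (by
      refine ⟨fun x hx => ?_, fun x hx => rfl, by simp [setCounter_array, hs]⟩
      rw [setCounter_counter, if_neg hx])
    (fun k s' hs' => (hs'.1 5 (by norm_num)).trans h5)
    (by
      rintro k s₁ hk ⟨g1, g2, g3⟩ hc
      refine ⟨_, _, RamExec.store _ _ _ _ _, by simp [RealExpr.cost], hc, fun x hx => ?_,
        fun x hx => ?_, ?_⟩
      · rw [setCounter_counter, if_neg hx]
        exact g1 x hx
      · rw [setCounter_array, ← g2 x hx]
        ext k' l'
        rw [setCell_array, if_neg (fun h => hx h.1)]
      · have k3 : s₁.counter 3 = 0 := (g1 3 (by norm_num)).trans h3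
        rw [setCounter_array, setCell_array, if_pos ⟨rfl, k3.symm, k3.symm⟩,
          Finset.sum_range_succ]
        simp only [RealExpr.value, k3, hc, g3, g2 18 (by norm_num), g2 54 (by norm_num),
          g2 60 (by norm_num), g2 19 (by norm_num), g2 78 (by norm_num), hF]
        ring)
  refine ⟨s', ⟨t, e2, e1⟩, ?_⟩
  have htr : ∀ k, (storedMat e s k).trace.re = ∑ i ∈ Finset.range N, s.array (2 * k) i i := by
    intro k
    rw [Matrix.trace, Complex.re_sum, ← e.symm.sum_comp, Finset.sum_range]
    simp [storedMat]
  rw [RamState.output, e5, htr, htr, htr, hF, Finset.sum_add_distrib, Finset.sum_add_distrib,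
    Finset.mul_sum, Finset.mul_sum]
  ring

/-- The program for the mutual information. -/
def mutualInfoProg : RamProgram :=
  .seq counterProg (.seq scalarProg (.seq (.seq loadOne (.seq loadCorr loadBlock))
    (.seq coreProg outputProg)))

theorem mutualInfoProg_reaches (NA NB n : ℕ) (α z : ℝ)
    (C : Matrix (Fin NA ⊕ Fin NB) (Fin NA ⊕ Fin NB) ℂ) :
    ∃ s, Reaches mutualInfoProg (ramInput NA NB n α z C) s
        (3000 * (iterCount α z (NA + NB) n + n + 1) ^ 2 * (NA + NB + 1) ^ 3) ∧
      s.output = renyiIter (iterCount α z (NA + NB) n) ((1 / 2) ^ iterCount α z (NA + NB) n)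
        (iterStart α z n) ((1 - α) / (2 * z)) (α / z) z (α / (1 - α)) (1 / (1 - α)) C
        (blockDiagPart C) := by
  set N := NA + NB with hN
  set K := iterCount α z N n with hK
  set h : ℝ := (1 / 2) ^ K with hh
  set A := (ramInput NA NB n α z C).array with hA
  set c₀ := (ramInput NA NB n α z C).counter with hc₀
  -- The input leaves the arrays 4, …, 19 blank, so it is a state with all scalars zero.
  have hin : ramInput NA NB n α z C = scalarState c₀ A 0 := by
    rw [scalarState, RamState.mk.injEq]
    refine ⟨rfl, ?_⟩
    ext a k l
    split_ifs with hx
    · have h1 : ¬ a ≤ 1 := by omega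
      have h2 : ¬ a = 2 := by omega
      simp [ramInput, h1, h2]
    · rfl
  have hA2 : A 2 0 0 = α ∧ A 2 0 1 = z := by
    constructor <;> simp [hA, ramInput]
  have hA01 : ∀ i j, A 0 (finSumFinEquiv i : Fin N) (finSumFinEquiv j : Fin N) = (C i j).re ∧
      A 1 (finSumFinEquiv i : Fin N) (finSumFinEquiv j : Fin N) = (C i j).im := by
    intro i j
    have hi := (finSumFinEquiv i).isLt
    have hj := (finSumFinEquiv j).isLt
    constructor <;> simp [hA, ramInput, hi, hj]
  obtain ⟨c₁, p1, q1, q4, q5⟩ := counterProg_exec (c := c₀) (A := A) (σ := 0) rfl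
  have q5' : c₁ 5 = N := q5
  have q2 : c₁ 2 = n := q1 2 (by norm_num)
  obtain ⟨c₂, σ, p2, r1, r6, s4, s5, s6, s8, s9, s10, s11, s12, s18, s19⟩ :=
    scalarProg_exec (c := c₁) (A := A) (q1 3 (by norm_num)) q4 (q1 6 (by norm_num)) hA2.1 hA2.2
  rw [q5', q2] at p2 r6 s8 s9 s10 s11
  rw [q2] at s12
  obtain ⟨s₃, p3, t1, t2, t3⟩ := load_reaches (s := scalarState c₂ A σ) (NA := NA) (N := N)
    ((r1 0 (by norm_num)).trans (q1 0 (by norm_num))) ((r1 5 (by norm_num)).trans q5')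
  have hsc : ∀ a, 4 ≤ a → a < 20 → s₃.array a 0 0 = σ a := by
    intro a ha ha'
    rw [t2 a (by omega)]
    simp [scalarState, ha, ha']
  have hin01 : ∀ a < 2, (scalarState c₂ A σ).array a = A a := by
    intro a ha
    ext k l
    exact if_neg (fun h => by omega)
  have g3 : s₃.counter 3 = 0 := by
    rw [t1 3 (by norm_num)]
    exact (r1 3 (by norm_num)).trans (q1 3 (by norm_num))
  have g5 : s₃.counter 5 = N := by
    rw [t1 5 (by norm_num)]
    exact (r1 5 (by norm_num)).trans q5'
  have g6 : s₃.counter 6 = K := by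
    rw [t1 6 (by norm_num)]
    exact r6
  obtain ⟨t, s₄, e1, e2, e3, e4, e5⟩ := coreProg_implements (e := finSumFinEquiv (m := NA) (n := NB))
    (K := K) (sc := fun a => s₃.array a 0 0) (h := h) (s := (1 - α) / (2 * z)) (r := α / z) (z := z)
    (by rw [hsc 4 (by norm_num) (by norm_num), s4]) (by rw [hsc 5 (by norm_num) (by norm_num), s5])
    (by rw [hsc 6 (by norm_num) (by norm_num), s6]) (by rw [hsc 8 (by norm_num) (by norm_num), s8])
    (by rw [hsc 9 (by norm_num) (by norm_num), s9])
    (by rw [hsc 10 (by norm_num) (by norm_num), s10])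
    (by rw [hsc 11 (by norm_num) (by norm_num), s11]) s₃ g3 g5 g6 (fun _ _ => rfl)
  have m20 : storedMat (finSumFinEquiv (m := NA) (n := NB)) s₃ 20 = 1 := by
    ext i j
    obtain ⟨u1, u2, -⟩ := t3 (finSumFinEquiv i) (finSumFinEquiv j) (Fin.isLt _) (Fin.isLt _)
    simp only [storedMat, Matrix.of_apply, Nat.reduceMul, Nat.reduceAdd, u1, u2, Matrix.one_apply,
      Fin.val_inj, EmbeddingLike.apply_eq_iff_eq]
    split_ifs <;> rfl
  have m21 : storedMat (finSumFinEquiv (m := NA) (n := NB)) s₃ 21 = C := by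
    ext i j
    obtain ⟨-, -, u1, u2, -⟩ := t3 (finSumFinEquiv i) (finSumFinEquiv j) (Fin.isLt _) (Fin.isLt _)
    simp only [storedMat, Matrix.of_apply, Nat.reduceMul, Nat.reduceAdd, u1, u2,
      hin01 0 (by norm_num), hin01 1 (by norm_num), (hA01 i j).1, (hA01 i j).2]
  have m22 : storedMat (finSumFinEquiv (m := NA) (n := NB)) s₃ 22 = blockDiagPart C := by
    ext i j
    obtain ⟨-, -, -, -, u1, u2⟩ := t3 (finSumFinEquiv i) (finSumFinEquiv j) (Fin.isLt _)
      (Fin.isLt _)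
    simp only [storedMat, Matrix.of_apply, Nat.reduceMul, Nat.reduceAdd, u1, u2,
      hin01 0 (by norm_num), hin01 1 (by norm_num), (hA01 i j).1, (hA01 i j).2]
    rcases i with i | i <;> rcases j with j | j <;>
      simp [blockDiagPart, Matrix.toBlocks₁₁, Matrix.toBlocks₂₂] <;> rfl
  obtain ⟨v27, v30, v39⟩ := e5 m20
  obtain ⟨s₅, p5, w⟩ := outputProg_reaches (finSumFinEquiv (m := NA) (n := NB)) (s := s₄)
    ((e3 3 (by norm_num)).trans g3) ((e3 5 (by norm_num)).trans g5) (by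
      rw [e4 3 (by norm_num), t2 3 (by norm_num)]
      simp [scalarState, hA, ramInput])
  rw [hin]
  refine ⟨s₅, (p1.seq (p2.seq (p3.seq (Reaches.seq ⟨t, e2, e1⟩ p5)))).mono ?_, ?_⟩
  · have hc1 : c₀ 1 = NB := rfl
    have h1 : 1 ≤ (N + 1) ^ 3 := Nat.one_le_pow _ _ (by omega)
    have h2 : 1 ≤ (K + n + 1) ^ 2 := Nat.one_le_pow _ _ (by omega)
    have b1 : K + n + 1 ≤ (K + n + 1) ^ 2 * (N + 1) ^ 3 :=
      (Nat.le_self_pow two_ne_zero _).trans (Nat.le_mul_of_pos_right _ h1)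
    have b2 : (N + 1) ^ 2 ≤ (K + n + 1) ^ 2 * (N + 1) ^ 3 :=
      (Nat.pow_le_pow_right (by omega) (by norm_num)).trans (Nat.le_mul_of_pos_left _ h2)
    have b3 : (K + 1) ^ 2 * (N + 1) ^ 3 ≤ (K + n + 1) ^ 2 * (N + 1) ^ 3 :=
      Nat.mul_le_mul_right _ (Nat.pow_le_pow_left (by omega) _)
    -- The matrix iterations contribute 60 · 40 = 2400; initialization, loading and output fit into
    -- the remaining 600.
    have b4 : 60 * (K + 1) ^ 2 * (40 * (N + 1) ^ 3) = 2400 * ((K + 1) ^ 2 * (N + 1) ^ 3) := by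
      ring
    have b5 : 3 * (N * (N * (6 + 2) + 2 + 2) + 2) ≤ 24 * (N + 1) ^ 2 := by
      ring_nf
      omega
    have b6 : NB ≤ N := by omega
    have b7 : N + 1 ≤ (N + 1) ^ 2 := Nat.le_self_pow two_ne_zero _
    rw [hc1, matTime, ← hN, ← hK, mul_assoc 3000, b4]
    omega
  · rw [w, v27, v30, v39, m21, m22, e4 18 (by norm_num), e4 19 (by norm_num),
      hsc 18 (by norm_num) (by norm_num), hsc 19 (by norm_num) (by norm_num), s18, s19,
      hsc 12 (by norm_num) (by norm_num), s12, renyiIter]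

end LoadAndOutput

/-! ### Polynomial bounds and the main theorem -/

section Complexity

/-- Since |x| ≤ 2 + x², a sum of squares bounds all parameters by arithmetic alone. The ratio α/(1 -
α) is a product of two bounded quantities, which explains the square in its bound. -/
theorem paramBound_paramSize (α z : ℝ) :
    ParamBound (paramSize α z) ((1 - α) / (2 * z)) (α / z) z (α / (1 - α)) (1 / (1 - α)) := by
  have habs : ∀ x : ℝ, |x| ≤ 2 + x ^ 2 := fun x => by
    nlinarith [sq_nonneg (|x| - 1), sq_abs x]
  have hw : |1 / (1 - α)| ≤ paramSize α z := by
    unfold paramSize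
    linarith [habs (1 / (1 - α)), sq_nonneg ((1 - α) / (2 * z)), sq_nonneg (α / z), sq_nonneg z,
      sq_nonneg α]
  have hα : |α| ≤ paramSize α z := by
    unfold paramSize
    linarith [habs α, sq_nonneg ((1 - α) / (2 * z)), sq_nonneg (α / z), sq_nonneg z,
      sq_nonneg (1 / (1 - α))]
  refine ⟨?_, ?_, ?_, ?_, ?_, hw⟩
  · unfold paramSize
    linarith [sq_nonneg ((1 - α) / (2 * z)), sq_nonneg (α / z), sq_nonneg z,
      sq_nonneg (1 / (1 - α)), sq_nonneg α]
  · unfold paramSize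
    linarith [habs ((1 - α) / (2 * z)), sq_nonneg (α / z), sq_nonneg z,
      sq_nonneg (1 / (1 - α)), sq_nonneg α]
  · unfold paramSize
    linarith [sq_nonneg ((1 - α) / (2 * z)), habs (α / z), sq_nonneg z,
      sq_nonneg (1 / (1 - α)), sq_nonneg α]
  · unfold paramSize
    linarith [sq_nonneg ((1 - α) / (2 * z)), sq_nonneg (α / z), habs z,
      sq_nonneg (1 / (1 - α)), sq_nonneg α]
  · rw [div_eq_mul_one_div, abs_mul, sq]
    exact mul_le_mul hα hw (abs_nonneg _) ((abs_nonneg _).trans hα)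

theorem iterCount_le (α z : ℝ) (N n : ℕ) :
    iterCount α z N n ≤ 1718 * ⌈paramSize α z ^ 2⌉₊ ^ 2 * (N + n + 1) ^ 2 := by
  set B := ⌈paramSize α z ^ 2⌉₊ with hB
  have hb : paramSize α z ^ 2 ≤ B := Nat.le_ceil _
  have h2 := (paramBound_paramSize α z).two_le
  have hB1 : (1 : ℝ) ≤ B := by nlinarith
  have hN : (0 : ℝ) ≤ N := Nat.cast_nonneg N
  have hn : (0 : ℝ) ≤ n := Nat.cast_nonneg n
  set x : ℝ := N + n + 1 with hx
  have hx1 : 1 ≤ x := by linarith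
  have hBx : 1 ≤ B * x := one_le_mul_of_one_le_of_one_le hB1 hx1
  have hxB : x ≤ B * x := le_mul_of_one_le_left (by linarith) hB1
  have hY0 : 0 ≤ iterStart α z n := by unfold iterStart; positivity
  have hY : iterStart α z n ≤ 8 * (B * x) := by
    have : paramSize α z ^ 2 * (n + 1) ≤ B * x :=
      mul_le_mul hb (by linarith) (by linarith) (by linarith)
    unfold iterStart
    linarith
  rw [iterCount, Nat.ceil_le]
  push_cast
  -- With Y ≤ 8Bx and Bx ≥ 1 the factors are at most 17Bx and (96 + 4 + 1)Bx, and 17 · 101 = 1717.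
  calc (1 + 2 * iterStart α z n) * (12 * iterStart α z n + 4 * N + 5)
      ≤ (17 * (B * x)) * (101 * (B * x)) :=
        mul_le_mul (by linarith) (by linarith) (by positivity) (by positivity)
    _ ≤ 1718 * (B : ℝ) ^ 2 * x ^ 2 := by nlinarith [sq_nonneg ((B : ℝ) * x)]

/-- The iteration count is quadratic in N + n + 1 and enters squared; with the cubic cost of matrix
operations the degree is 4 + 3 = 7. The parameters α and z affect only the coefficient. -/
theorem running_time_le (α z : ℝ) (N n : ℕ) :
    3000 * (iterCount α z N n + n + 1) ^ 2 * (N + 1) ^ 3 ≤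
      3000 * (1720 * ⌈paramSize α z ^ 2⌉₊ ^ 2) ^ 2 * (N + n + 1) ^ 7 := by
  set B := ⌈paramSize α z ^ 2⌉₊ with hB
  have hB1 : 1 ≤ B := Nat.one_le_ceil_iff.2 (by
    have := (paramBound_paramSize α z).two_le
    positivity)
  have h1 : n + 1 ≤ B ^ 2 * (N + n + 1) ^ 2 :=
    calc n + 1 ≤ N + n + 1 := by omega
      _ ≤ (N + n + 1) ^ 2 := Nat.le_self_pow two_ne_zero _
      _ ≤ B ^ 2 * (N + n + 1) ^ 2 := Nat.le_mul_of_pos_left _ (by positivity)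
  have h2 : iterCount α z N n + n + 1 ≤ 1720 * B ^ 2 * (N + n + 1) ^ 2 := by
    have := iterCount_le α z N n
    rw [mul_assoc, ← hB] at this
    rw [mul_assoc]
    omega
  calc 3000 * (iterCount α z N n + n + 1) ^ 2 * (N + 1) ^ 3
      ≤ 3000 * (1720 * B ^ 2 * (N + n + 1) ^ 2) ^ 2 * (N + n + 1) ^ 3 := by
        gcongr
        omega
    _ = 3000 * (1720 * B ^ 2) ^ 2 * (N + n + 1) ^ 7 := by ring

variable {A B : Type*} [Fintype A] [DecidableEq A] [Fintype B] [DecidableEq B]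

/-- The block diagonal part is P D Pᴴ + Q D Qᴴ for the two block projections. Applied to C - 2^(-n)
and 1 - 2^(-n) - C, it gives C' the same spectral bounds as C. -/
theorem blockDiagPart_posSemidef {D : Matrix (A ⊕ B) (A ⊕ B) ℂ} (hD : D.PosSemidef) :
    (blockDiagPart D).PosSemidef := by
  have h : blockDiagPart D =
      (Matrix.fromBlocks 1 0 0 0 : Matrix (A ⊕ B) (A ⊕ B) ℂ) * D *
          (Matrix.fromBlocks 1 0 0 0 : Matrix (A ⊕ B) (A ⊕ B) ℂ)ᴴ +
        (Matrix.fromBlocks 0 0 0 1 : Matrix (A ⊕ B) (A ⊕ B) ℂ) * D *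
          (Matrix.fromBlocks 0 0 0 1 : Matrix (A ⊕ B) (A ⊕ B) ℂ)ᴴ := by
    conv_rhs => rw [← Matrix.fromBlocks_toBlocks D]
    simp [Matrix.fromBlocks_multiply, Matrix.fromBlocks_conjTranspose, Matrix.fromBlocks_add,
      blockDiagPart]
  rw [h]
  exact (hD.mul_mul_conjTranspose_same _).add (hD.mul_mul_conjTranspose_same _)

theorem blockDiagPart_sub_smul_one (D : Matrix (A ⊕ B) (A ⊕ B) ℂ) (c : ℂ) :
    blockDiagPart (D - c • 1) = blockDiagPart D - c • 1 := by
  ext i j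
  rcases i with i | i <;> rcases j with j | j <;>
    simp [blockDiagPart, Matrix.toBlocks₁₁, Matrix.toBlocks₂₂, Matrix.one_apply]

theorem blockDiagPart_smul_one_sub (D : Matrix (A ⊕ B) (A ⊕ B) ℂ) (c : ℂ) :
    blockDiagPart (c • 1 - D) = c • 1 - blockDiagPart D := by
  ext i j
  rcases i with i | i <;> rcases j with j | j <;>
    simp [blockDiagPart, Matrix.toBlocks₁₁, Matrix.toBlocks₂₂, Matrix.one_apply]

/-- Here 1 - C is ε plus a positive semidefinite matrix, so the closed form applies to every input
of the algorithm. -/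
theorem isUnit_one_sub_of_posSemidef {m : Type*} [Fintype m] [DecidableEq m] {C : Matrix m m ℂ}
    {ε : ℝ} (hε : 0 < ε) (hC : ((1 - (ε : ℂ)) • 1 - C).PosSemidef) : IsUnit (1 - C) := by
  have h : 1 - C = (ε : ℂ) • 1 + ((1 - (ε : ℂ)) • 1 - C) := by
    rw [sub_smul, one_smul]
    abel
  rw [h]
  exact ((Matrix.PosDef.one.smul (by exact_mod_cast hε)).add_posSemidef hC).isUnit

end Complexity

theorem mainTheorem8 :
    -- the closed form, for all Gaussian states such that `1 - C` is invertible
    (∀ (NA NB : ℕ) (C : Matrix (Fin NA ⊕ Fin NB) (Fin NA ⊕ Fin NB) ℂ)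
      (ρ : Matrix (Finset (Fin NA) × Finset (Fin NB)) (Finset (Fin NA) × Finset (Fin NB)) ℂ),
      IsGaussianState mode ρ C → IsUnit (1 - C) →
        IsGaussianState mode (reduceA ρ ⊗ₖ reduceB ρ) (blockDiagPart C) ∧
        ∀ α z : ℝ, α ≠ 1 → z ≠ 0 →
          renyiMutualInfo α z ρ =
            - (α * (matLog (1 - C)).trace.re / (1 - α))
              - (matLog (1 - blockDiagPart C)).trace.re
              - (matLog (1 + matPow
                    (matPow (oddsMatrix (blockDiagPart C)) ((1 - α) / (2 * z))
                      * matPow (oddsMatrix C) (α / z)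
                      * matPow (oddsMatrix (blockDiagPart C)) ((1 - α) / (2 * z))) z)).trace.re
                  / (1 - α)) ∧
    -- computability in polynomial time
    (∃ P : RamProgram, ∀ α z : ℝ, α ≠ 1 → z ≠ 0 → ∃ p : Polynomial ℕ,
      ∀ (NA NB n : ℕ) (C : Matrix (Fin NA ⊕ Fin NB) (Fin NA ⊕ Fin NB) ℂ)
        (ρ : Matrix (Finset (Fin NA) × Finset (Fin NB)) (Finset (Fin NA) × Finset (Fin NB)) ℂ),
        IsGaussianState mode ρ C →
        (C - ((1 / 2 : ℂ) ^ n) • (1 : Matrix (Fin NA ⊕ Fin NB) (Fin NA ⊕ Fin NB) ℂ)).PosSemidef →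
        ((1 - (1 / 2 : ℂ) ^ n) • (1 : Matrix (Fin NA ⊕ Fin NB) (Fin NA ⊕ Fin NB) ℂ)
          - C).PosSemidef →
        ∃ (t : ℕ) (s : RamState), RamExec P (ramInput NA NB n α z C) t s ∧
          t ≤ p.eval (NA + NB + n) ∧
          |s.output - renyiMutualInfo α z ρ| ≤ (1 / 2 : ℝ) ^ n) := by
  -- The program is fixed before α and z, which it reads from its input; only the coefficient of the
  -- polynomial depends on them.
  refine ⟨fun NA NB C ρ hρ hu => gaussianState_renyiMutualInfo hρ hu, mutualInfoProg,
    fun α z hα hz => ⟨Polynomial.C (3000 * (1720 * ⌈paramSize α z ^ 2⌉₊ ^ 2) ^ 2) *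
      (Polynomial.X + 1) ^ 7, fun NA NB n C ρ hρ h0 h1 => ?_⟩⟩
  have hcast : ((1 / 2 : ℂ) ^ n) = (((1 / 2) ^ n : ℝ) : ℂ) := by push_cast; rfl
  rw [hcast] at h0 h1
  have hu : IsUnit (1 - C) := isUnit_one_sub_of_posSemidef (by positivity) h1
  have h0' := blockDiagPart_posSemidef h0
  have h1' := blockDiagPart_posSemidef h1
  rw [blockDiagPart_sub_smul_one] at h0'
  rw [blockDiagPart_smul_one_sub] at h1'
  obtain ⟨s, ⟨t, ht, hexec⟩, hs⟩ := mutualInfoProg_reaches NA NB n α z C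
  refine ⟨t, s, hexec, ht.trans ((running_time_le α z (NA + NB) n).trans ?_), ?_⟩
  · simp
  · have hacc := abs_renyiIter_sub_le (paramBound_paramSize α z) (Y := iterStart α z n) rfl
      (K := iterCount α z (NA + NB) n)
      (by
        rw [Fintype.card_sum, Fintype.card_fin, Fintype.card_fin]
        exact Nat.le_ceil _) h0 h1 h0' h1'
    rw [hs, (gaussianState_renyiMutualInfo hρ hu).2 α z hα hz]
    convert hacc using 3
    ring
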